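/- Let $n\ge 1$, let $V=\mathbb{C}^{2n|1}$ carry the even form $B$ with $B(u_i,u_{2n+1-i})=-B(u_{2n+1-i},u_i)=1$ for $1\le i\le n$, $B(u_{2n+1},u_{2n+1})=1$ and all other values on the basis $0$ ($u_1,\dots,u_{2n}$ even, $u_{2n+1}$ odd), and let $V'=\mathbb{C}^{2|2}=X'\oplus Y'$ carry the even form $B'$ with $B'(v_1,v_2)=B'(v_2,v_1)=1$, $B'(w_1,w_2)=-B'(w_2,w_1)=1$ and all other values $0$, where $X'=\mathrm{Span}(v_1,w_1)$ and $Y'=\mathrm{Span}(v_2,w_2)$ ($v_1,v_2$ even, $w_1,w_2$ odd). Put $\mathfrak{spo}(2n|1)=\mathfrak{spo}(V,B)$ and $\mathfrak{osp}(2|2)=\mathfrak{osp}(V',B')$, let $E=V\otimes X'$, and let both algebras act on the supersymmetric algebra $S(E)$ by the spinor-oscillator representation of $\mathfrak{spo}(V\otimes V',B\otimes B')$. Let $\mathfrak{gl}(1|1)=\mathfrak{gl}(X')$ act through the subalgebra $\mathfrak{k}'\subset\mathfrak{osp}(2|2)$ preserving $X'$ and $Y'$, let $\mathfrak{n}'^{+}=\{T\in\mathfrak{osp}(2|2):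 T(X')\subseteq Y',\ T(Y')=0\}$, and let $S(E)^{\mathfrak{n}'^{+}}$ be the space of vectors annihilated by $\mathfrak{n}'^{+}$. Let $V^{2n|1}_\lambda$ be the irreducible $\mathfrak{spo}(2n|1)$-module of highest weight $\lambda=(\lambda_1,\dots,\lambda_n)$ (where $\lambda_i$ is the eigenvalue of $E_{i,i}-E_{2n+1-i,2n+1-i}$) for the Borel subalgebra $\mathfrak{b}^{\mathrm{spo}}$ whose elements are upper triangular in the ordered basis $u_1,\dots,u_n,u_{2n+1},u_{n+1},\dots,u_{2n}$, and let $V^{1|1}_{(a,b)}$ be the irreducible $\mathfrak{gl}(1|1)$-module of highest weight $(a,b)$ for the upper triangular Borel subalgebra. Put $\alpha=\frac{2n-1}{2}$. Then, as $\mathfrak{spo}(2n|1)+\mathfrak{gl}(1|1)$-modules (the parities of the modules being chosen suitably, so that the inclusion is even), $$V^{2n|1}_{(0_n)}\otimes V^{1|1}_{(\alpha,-\alpha)}\ \oplus\ \bigoplus_{d=0}^{\infty}\bigoplus_{k=1}^{n}V^{2n|1}_{(d+1,1_{k-1},0_{n-k})}\otimes V^{1|1}_{(d+1+\alpha,\,k-1-\alpha)}\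 \oplus\ \bigoplus_{d=0}^{\infty}V^{2n|1}_{(d+1,1_{n-1})}\otimes V^{1|1}_{(d+1+\alpha,\,n-\alpha)}\ \subseteq\ S(E)^{\mathfrak{n}'^{+}}.$$ Moreover, each of these summands is obtained by restriction from the $(\mathfrak{gl}(2n|1),\mathfrak{gl}(1|1))$ duality: it is contained in an irreducible $\mathfrak{gl}(2n|1)+\mathfrak{gl}(1|1)$-submodule of $S(E)$, and its joint highest weight vector is also a highest weight vector for $\mathfrak{gl}(2n|1)$, with respect to the Borel subalgebra $\widetilde{\mathfrak{b}}$ of matrices that are upper triangular in the ordered basis above, of weight $(0_{2n+1})$, $(d+1,1_{k-1},0_{2n+1-k})$ and $(d+1,1_{n-1},0_n,1)$ respectively (listing the eigenvalues of $E_{1,1},\dots,E_{2n+1,2n+1}$). -/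

import Mathlib

open scoped TensorProduct DirectSum

noncomputable section

set_option linter.unusedSectionVars false

namespace SpoHowe

/-! ### Linear Lie superalgebras -/

/-- The sign `(-1)^a` of a parity `a`. -/
def sgn (a : ZMod 2) : ℂ := if a = 0 then 1 else -1

section Lie

variable {ι : Type} [Fintype ι] [DecidableEq ι]

/-- The matrices of parity `a`, when the `i`-th basis vector has parity `p i`. -/
def homPart (p : ι → ZMod 2) (a : ZMod 2) : Submodule ℂ (Matrix ι ι ℂ) where
  carrier := {X | ∀ i j, p i + p j ≠ a → X i j = 0}
  add_mem' := by
    intro X Y hX hY i j h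
    simp [hX i j h, hY i j h]
  zero_mem' := by
    intro i j _
    rfl
  smul_mem' := by
    intro c X hX i j h
    simp [hX i j h]

/-- The component of parity `a` of a matrix. -/
def parityComp (p : ι → ZMod 2) (a : ZMod 2) : Matrix ι ι ℂ →ₗ[ℂ] Matrix ι ι ℂ where
  toFun X := Matrix.of fun i j => if p i + p j = a then X i j else 0
  map_add' := by
    intro X Y
    ext i j
    simp only [Matrix.of_apply, Matrix.add_apply]
    split_ifs <;> simp
  map_smul' := by
    intro c X
    ext i j
    simp only [Matrix.of_apply, Matrix.smul_apply, RingHom.id_apply]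
    split_ifs <;> simp

/-- The supercommutator: `X * Y - (-1)^(a b) Y * X` for `X`, `Y` of parities `a`, `b`, extended
bilinearly. -/
def superBracket (p : ι → ZMod 2) (X Y : Matrix ι ι ℂ) : Matrix ι ι ℂ :=
  ∑ a : ZMod 2, ∑ b : ZMod 2,
    (parityComp p a X * parityComp p b Y - sgn (a * b) • (parityComp p b Y * parityComp p a X))

/-- A Lie superalgebra of matrices: a `ℤ/2`-graded subspace of `gl(p)` which is closed under the
supercommutator. -/
structure LieSuperSub (p : ι → ZMod 2) extends Submodule ℂ (Matrix ι ι ℂ) where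
  comp_mem : ∀ (a : ZMod 2) (X : Matrix ι ι ℂ), X ∈ toSubmodule → parityComp p a X ∈ toSubmodule
  bracket_mem : ∀ X Y : Matrix ι ι ℂ, X ∈ toSubmodule → Y ∈ toSubmodule →
    superBracket p X Y ∈ toSubmodule

/-- The supercommutator on a Lie superalgebra of matrices. -/
def LieSuperSub.bracket {p : ι → ZMod 2} (L : LieSuperSub p) (X Y : L.toSubmodule) :
    L.toSubmodule :=
  ⟨superBracket p X.1 Y.1, L.bracket_mem X.1 Y.1 X.2 Y.2⟩

/-- The general linear Lie superalgebra of the superspace with basis parities `p`. -/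
def glSuper (p : ι → ZMod 2) : LieSuperSub p where
  toSubmodule := ⊤
  comp_mem := fun _ _ _ => Submodule.mem_top
  bracket_mem := fun _ _ _ _ => Submodule.mem_top

/-- The condition `B(X v, w) + (-1)^(a |v|) B(v, X w) = 0` on basis vectors `v = e_i`, `w = e_j`,
for a matrix `X` of parity `a`; here `B i j = B(e_i, e_j)`. -/
def PreservesForm (p : ι → ZMod 2) (B : Matrix ι ι ℂ) (a : ZMod 2) (X : Matrix ι ι ℂ) : Prop :=
  X.transpose * B + Matrix.diagonal (fun i => sgn (a * p i)) * (B * X) = 0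

theorem parityComp_comp (p : ι → ZMod 2) (a b : ZMod 2) (X : Matrix ι ι ℂ) :
    parityComp p a (parityComp p b X) = if a = b then parityComp p b X else 0 := by
  ext i j
  by_cases hab : a = b
  · subst hab
    by_cases h : p i + p j = a <;> simp [parityComp, h]
  · by_cases h : p i + p j = a
    · have h' : ¬ (p i + p j = b) := fun h2 => hab (h.symm.trans h2)
      simp [parityComp, hab, h']
    · simp [parityComp, hab, h]

theorem parityComp_mem_homPart (p : ι → ZMod 2) (a : ZMod 2) (X : Matrix ι ι ℂ) :
    parityComp p a X ∈ homPart p a := by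
  intro i j h
  simp [parityComp, h]

theorem parityComp_of_mem {p : ι → ZMod 2} {c : ZMod 2} {X : Matrix ι ι ℂ} (hX : X ∈ homPart p c)
    (a : ZMod 2) : parityComp p a X = if a = c then X else 0 := by
  ext i j
  by_cases hac : a = c
  · subst hac
    by_cases h : p i + p j = a
    · simp [parityComp, h]
    · simp [parityComp, h, hX i j h]
  · by_cases h : p i + p j = a
    · have h' : p i + p j ≠ c := fun h2 => hac (h.symm.trans h2)
      simp [parityComp, hac, hX i j h']
    · simp [parityComp, hac, h]

theorem sgn_add (a b : ZMod 2) : sgn (a + b) = sgn a * sgn b := by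
  have h2 : ∀ x : ZMod 2, x = 0 ∨ x = 1 := by decide
  have h11 : (1 : ZMod 2) + 1 = 0 := by decide
  rcases h2 a with rfl | rfl <;> rcases h2 b with rfl | rfl <;> simp [sgn, h11]

theorem sgn_mul_self (a : ZMod 2) : sgn a * sgn a = 1 := by
  unfold sgn
  split_ifs <;> norm_num

theorem superBracket_of_mem {p : ι → ZMod 2} {a b : ZMod 2} {X Y : Matrix ι ι ℂ}
    (hX : X ∈ homPart p a) (hY : Y ∈ homPart p b) :
    superBracket p X Y = X * Y - sgn (a * b) • (Y * X) := by
  unfold superBracket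
  rw [Finset.sum_eq_single a, Finset.sum_eq_single b]
  · rw [parityComp_of_mem hX a, parityComp_of_mem hY b, if_pos rfl, if_pos rfl]
  · intro b' _ hb'
    rw [parityComp_of_mem hY b', if_neg hb']
    simp
  · simp
  · intro a' _ ha'
    rw [parityComp_of_mem hX a', if_neg ha']
    simp
  · simp

theorem mul_mem_homPart {p : ι → ZMod 2} {a b : ZMod 2} {X Y : Matrix ι ι ℂ}
    (hX : X ∈ homPart p a) (hY : Y ∈ homPart p b) : X * Y ∈ homPart p (a + b) := by
  intro i j h
  rw [Matrix.mul_apply]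
  refine Finset.sum_eq_zero fun k _ => ?_
  by_cases h1 : p i + p k = a
  · by_cases h2 : p k + p j = b
    · exfalso
      apply h
      rw [← h1, ← h2]
      generalize p i = x
      generalize p j = y
      generalize p k = z
      revert x y z
      decide
    · rw [hY k j h2, mul_zero]
  · rw [hX i k h1, zero_mul]

theorem diag_mul_comm {p : ι → ZMod 2} {b : ZMod 2} {Y : Matrix ι ι ℂ} (hY : Y ∈ homPart p b)
    (a : ZMod 2) :
    Matrix.diagonal (fun i => sgn (a * p i)) * Y =
      sgn (a * b) • (Y * Matrix.diagonal (fun i => sgn (a * p i))) := by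
  ext i j
  rw [Matrix.diagonal_mul, Matrix.smul_apply, Matrix.mul_diagonal]
  by_cases h : p i + p j = b
  · rw [← h, mul_add, sgn_add, smul_eq_mul]
    linear_combination (-(sgn (a * p i) * Y i j)) * sgn_mul_self (a * p j)
  · rw [hY i j h]
    simp

theorem PreservesForm.superBracket {p : ι → ZMod 2} {B : Matrix ι ι ℂ} {a b : ZMod 2}
    {X Y : Matrix ι ι ℂ} (hX : X ∈ homPart p a) (hY : Y ∈ homPart p b)
    (hXB : PreservesForm p B a X) (hYB : PreservesForm p B b Y) :
    PreservesForm p B (a + b) (X * Y - sgn (a * b) • (Y * X)) := by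
  unfold PreservesForm at *
  have hX' := eq_neg_of_add_eq_zero_left hXB
  have hY' := eq_neg_of_add_eq_zero_left hYB
  have hD : Matrix.diagonal (fun i => sgn ((a + b) * p i)) =
      Matrix.diagonal (fun i => sgn (a * p i)) * Matrix.diagonal (fun i => sgn (b * p i)) := by
    rw [Matrix.diagonal_mul_diagonal]
    congr 1
    funext i
    rw [add_mul, sgn_add]
  have cX := congrArg Matrix.transpose (diag_mul_comm hX b)
  have cY := congrArg Matrix.transpose (diag_mul_comm hY a)
  have hDD : Matrix.diagonal (fun i => sgn (b * p i)) * Matrix.diagonal (fun i => sgn (a * p i)) =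
      Matrix.diagonal (fun i => sgn (a * p i)) * Matrix.diagonal (fun i => sgn (b * p i)) := by
    rw [Matrix.diagonal_mul_diagonal, Matrix.diagonal_mul_diagonal]
    congr 1
    funext i
    ring
  rw [Matrix.transpose_mul, Matrix.transpose_smul, Matrix.transpose_mul,
    Matrix.diagonal_transpose] at cX cY
  rw [hD]
  generalize Matrix.diagonal (fun i => sgn (a * p i)) = D at *
  generalize Matrix.diagonal (fun i => sgn (b * p i)) = D' at *
  have hs := sgn_mul_self (a * b)
  rw [mul_comm b a] at cX
  generalize sgn (a * b) = s at *
  have e1 : Y.transpose * (X.transpose * B) = s • (D * (D' * (B * Y * X))) := by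
    rw [hX', mul_neg, ← mul_assoc, cY, smul_mul_assoc, ← smul_neg]
    rw [mul_assoc D, ← mul_assoc Y.transpose, hY']
    simp only [mul_assoc, neg_mul, mul_neg, neg_neg]
  have e2 : X.transpose * (Y.transpose * B) = s • (D * (D' * (B * X * Y))) := by
    rw [hY', mul_neg, ← mul_assoc, cX, smul_mul_assoc, ← smul_neg]
    rw [mul_assoc D', ← mul_assoc X.transpose, hX']
    simp only [mul_assoc, neg_mul, mul_neg, neg_neg]
    rw [← mul_assoc D', hDD, mul_assoc]
  rw [Matrix.transpose_sub, Matrix.transpose_smul, Matrix.transpose_mul, Matrix.transpose_mul,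
    Matrix.sub_mul, smul_mul_assoc, mul_assoc, mul_assoc, e1, e2, smul_smul, hs, one_smul,
    mul_sub, mul_smul_comm]
  simp only [mul_sub, mul_smul_comm, mul_assoc]
  abel

/-- The Lie superalgebra of a bilinear form `B` on the superspace with basis parities `p`: its
part of parity `a` consists of the `X` with `B(X v, w) + (-1)^(a |v|) B(v, X w) = 0`. It is
`spo(B)` or `osp(B)` according to the symmetry of `B`. -/
def ospSuper (p : ι → ZMod 2) (B : Matrix ι ι ℂ) : LieSuperSub p where
  carrier := {X | ∀ a, PreservesForm p B a (parityComp p a X)}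
  add_mem' := by
    intro X Y hX hY a
    have h1 := hX a
    have h2 := hY a
    unfold PreservesForm at *
    rw [map_add, Matrix.transpose_add, add_mul, mul_add, mul_add, add_add_add_comm, h1, h2,
      add_zero]
  zero_mem' := by
    intro a
    simp [PreservesForm]
  smul_mem' := by
    intro c X hX a
    have h1 := hX a
    unfold PreservesForm at *
    rw [map_smul, Matrix.transpose_smul, smul_mul_assoc, mul_smul_comm, mul_smul_comm,
      ← smul_add, h1, smul_zero]
  comp_mem := by
    intro a X hX b
    rw [parityComp_comp]
    split_ifs with h
    · exact h ▸ hX b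
    · simp [PreservesForm]
  bracket_mem := by
    intro X Y hX hY
    unfold SpoHowe.superBracket
    refine Submodule.sum_mem _ fun a _ => Submodule.sum_mem _ fun b _ => ?_
    have hXa := parityComp_mem_homPart p a X
    have hYb := parityComp_mem_homPart p b Y
    have hZ : parityComp p a X * parityComp p b Y - sgn (a * b) • (parityComp p b Y * parityComp p a X) ∈
        homPart p (a + b) :=
      Submodule.sub_mem _ (mul_mem_homPart hXa hYb)
        (Submodule.smul_mem _ _ (add_comm b a ▸ mul_mem_homPart hYb hXa))
    intro c
    rw [parityComp_of_mem hZ c]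
    split_ifs with h
    · rw [h]
      exact PreservesForm.superBracket hXa hYb (hX a) (hY b)
    · simp [PreservesForm]

/-! ### Representations of Lie superalgebras -/

/-- A representation of a Lie superalgebra of matrices on a `ℤ/2`-graded complex vector space. -/
structure SuperRep {p : ι → ZMod 2} (L : LieSuperSub p) where
  carrier : Type
  [addCommGroup : AddCommGroup carrier]
  [module : Module ℂ carrier]
  /-- The homogeneous parts of the space. -/
  part : ZMod 2 → Submodule ℂ carrier
  isInternal : DirectSum.IsInternal part
  /-- The action. -/
  ρ : L.toSubmodule →ₗ[ℂ] Module.End ℂ carrier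
  ρ_mem : ∀ (a b : ZMod 2) (X : L.toSubmodule) (v : carrier),
    X.1 ∈ homPart p a → v ∈ part b → ρ X v ∈ part (a + b)
  ρ_bracket : ∀ (a b : ZMod 2) (X Y : L.toSubmodule),
    X.1 ∈ homPart p a → Y.1 ∈ homPart p b →
      ρ (L.bracket X Y) = ρ X * ρ Y - sgn (a * b) • (ρ Y * ρ X)

attribute [instance] SuperRep.addCommGroup SuperRep.module

instance {p : ι → ZMod 2} (L : LieSuperSub p) : CoeSort (SuperRep L) Type :=
  ⟨SuperRep.carrier⟩

/-- Irreducibility: the space is nonzero, and `0` and the whole space are the only graded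
invariant subspaces. -/
def SuperRep.IsIrreducible {p : ι → ZMod 2} {L : LieSuperSub p} (M : SuperRep L) : Prop :=
  Nontrivial M ∧ ∀ N : Submodule ℂ M, (N ≤ ⨆ a, N ⊓ M.part a) →
    (∀ X : L.toSubmodule, ∀ v ∈ N, M.ρ X v ∈ N) → N = ⊥ ∨ N = ⊤

end Lie

/-! ### Supersymmetric algebras -/

section SuperSym

variable {κ : Type} [Fintype κ] [DecidableEq κ]

/-- The supersymmetric algebra `S(E) = S(E₀) ⊗ Λ(E₁)` of the superspace `E` with basis `κ` and
parities `r`. -/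
abbrev SuperSym (r : κ → ZMod 2) : Type :=
  MvPolynomial {k // r k = 0} ℂ ⊗[ℂ] ExteriorAlgebra ℂ ({k // r k ≠ 0} → ℂ)

/-- The homogeneous parts of the `ℤ/2`-grading of the supersymmetric algebra. -/
def superSymPart (r : κ → ZMod 2) (a : ZMod 2) : Submodule ℂ (SuperSym r) :=
  LinearMap.range (TensorProduct.map LinearMap.id
    (CliffordAlgebra.evenOdd (0 : QuadraticForm ℂ ({k // r k ≠ 0} → ℂ)) a).subtype)

/-- Multiplication by the basis vector `k`. -/
def mulOp (r : κ → ZMod 2) (k : κ) : Module.End ℂ (SuperSym r) :=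
  if h : r k = 0 then
    TensorProduct.map (LinearMap.mulLeft ℂ (MvPolynomial.X ⟨k, h⟩)) LinearMap.id
  else
    TensorProduct.map LinearMap.id
      (LinearMap.mulLeft ℂ (ExteriorAlgebra.ι ℂ (Pi.single ⟨k, h⟩ 1)))

/-- The superderivation dual to the basis vector `k`: a partial derivative if `k` is even, a left
contraction if `k` is odd. -/
def derOp (r : κ → ZMod 2) (k : κ) : Module.End ℂ (SuperSym r) :=
  if h : r k = 0 then
    TensorProduct.map (MvPolynomial.pderiv ⟨k, h⟩).toLinearMap LinearMap.id
  else
    TensorProduct.map LinearMap.id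
      (CliffordAlgebra.contractLeft (Q := (0 : QuadraticForm ℂ ({k // r k ≠ 0} → ℂ)))
        (LinearMap.proj ⟨k, h⟩))

/-- The natural action of `gl(E)` on `S(E)` by superderivations. -/
def naturalAction (r : κ → ZMod 2) (A : Matrix κ κ ℂ) : Module.End ℂ (SuperSym r) :=
  ∑ k, ∑ l, A k l • (mulOp r k * derOp r l)

end SuperSym

/-! ### The spaces `V = ℂ^(2n|1)` and `V' = ℂ^(2|2) = X' ⊕ Y'` -/

/-- Indices of the basis `u_1, …, u_{2n}` (even), `u_{2n+1}` (odd) of `V`. -/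
abbrev IdxV (n : ℕ) : Type := Fin (2 * n) ⊕ Unit

/-- Indices of the basis of `V'`: `inl 0 = v₁`, `inl 1 = w₁` span `X' = ℂ^(1|1)`, and
`inr 0 = v₂`, `inr 1 = w₂` span `Y'`. -/
abbrev IdxV' : Type := Fin 2 ⊕ Fin 2

def parV (n : ℕ) : IdxV n → ZMod 2 := Sum.elim (fun _ => 0) (fun _ => 1)

def parX : Fin 2 → ZMod 2 := ![0, 1]

def parV' : IdxV' → ZMod 2 := Sum.elim parX parX

/-- The form on `V`: `B(u_i, u_{2n+1-i}) = 1 = -B(u_{2n+1-i}, u_i)` for `1 ≤ i ≤ n`, and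
`B(u_{2n+1}, u_{2n+1}) = 1`. -/
def formV (n : ℕ) : Matrix (IdxV n) (IdxV n) ℂ :=
  Matrix.fromBlocks
    (Matrix.of fun i j => if j = i.rev then (if (i : ℕ) < n then 1 else -1) else 0) 0 0 1

/-- The form on `V'`: `B'(v₁, v₂) = B'(v₂, v₁) = 1` and `B'(w₁, w₂) = -B'(w₂, w₁) = 1`. -/
def formV' : Matrix IdxV' IdxV' ℂ :=
  Matrix.fromBlocks 0 1 (Matrix.diagonal ![1, -1]) 0

/-- `spo(2n|1)`. -/
def spo (n : ℕ) : LieSuperSub (parV n) := ospSuper (parV n) (formV n)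

/-- `osp(2|2)`. -/
def osp22 : LieSuperSub parV' := ospSuper parV' formV'

/-- `gl(1|1) = gl(X')`. -/
def gl11 : LieSuperSub parX := glSuper parX

/-- The subalgebra `k'` of `osp(2|2)` preserving `X'` and `Y'`. -/
def kPrime : Submodule ℂ (Matrix IdxV' IdxV' ℂ) where
  carrier := {T | T ∈ osp22.toSubmodule ∧ T.toBlocks₂₁ = 0 ∧ T.toBlocks₁₂ = 0}
  add_mem' := by
    rintro S T ⟨h1, h2, h3⟩ ⟨h4, h5, h6⟩
    refine ⟨Submodule.add_mem _ h1 h4, ?_, ?_⟩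
    · have : (S + T).toBlocks₂₁ = S.toBlocks₂₁ + T.toBlocks₂₁ := rfl
      rw [this, h2, h5, add_zero]
    · have : (S + T).toBlocks₁₂ = S.toBlocks₁₂ + T.toBlocks₁₂ := rfl
      rw [this, h3, h6, add_zero]
  zero_mem' := ⟨Submodule.zero_mem _, rfl, rfl⟩
  smul_mem' := by
    rintro c T ⟨h1, h2, h3⟩
    refine ⟨Submodule.smul_mem _ c h1, ?_, ?_⟩
    · have : (c • T).toBlocks₂₁ = c • T.toBlocks₂₁ := rfl
      rw [this, h2, smul_zero]
    · have : (c • T).toBlocks₁₂ = c • T.toBlocks₁₂ := rfl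
      rw [this, h3, smul_zero]

/-- The subalgebra `n'⁺` of `osp(2|2)` of the `T` with `T(X') ⊆ Y'` and `T(Y') = 0`. -/
def nPrimePlus : Submodule ℂ (Matrix IdxV' IdxV' ℂ) where
  carrier := {T | T ∈ osp22.toSubmodule ∧ T.toBlocks₁₁ = 0 ∧ T.toBlocks₁₂ = 0 ∧ T.toBlocks₂₂ = 0}
  add_mem' := by
    rintro S T ⟨h1, h2, h3, h4⟩ ⟨h5, h6, h7, h8⟩
    refine ⟨Submodule.add_mem _ h1 h5, ?_, ?_, ?_⟩
    · have : (S + T).toBlocks₁₁ = S.toBlocks₁₁ + T.toBlocks₁₁ := rfl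
      rw [this, h2, h6, add_zero]
    · have : (S + T).toBlocks₁₂ = S.toBlocks₁₂ + T.toBlocks₁₂ := rfl
      rw [this, h3, h7, add_zero]
    · have : (S + T).toBlocks₂₂ = S.toBlocks₂₂ + T.toBlocks₂₂ := rfl
      rw [this, h4, h8, add_zero]
  zero_mem' := ⟨Submodule.zero_mem _, rfl, rfl, rfl⟩
  smul_mem' := by
    rintro c T ⟨h1, h2, h3, h4⟩
    refine ⟨Submodule.smul_mem _ c h1, ?_, ?_, ?_⟩
    · have : (c • T).toBlocks₁₁ = c • T.toBlocks₁₁ := rfl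
      rw [this, h2, smul_zero]
    · have : (c • T).toBlocks₁₂ = c • T.toBlocks₁₂ := rfl
      rw [this, h3, smul_zero]
    · have : (c • T).toBlocks₂₂ = c • T.toBlocks₂₂ := rfl
      rw [this, h4, smul_zero]

/-- The isomorphism `gl(1|1) = gl(X') → k'`, extending `A` from `X'` to `V' = X' ⊕ Y'` (see
`mem_kPrime_iff`). -/
def glToOsp : Matrix (Fin 2) (Fin 2) ℂ →ₗ[ℂ] Matrix IdxV' IdxV' ℂ where
  toFun A := Matrix.fromBlocks A 0 0 !![-(A 0 0), -(A 1 0); A 0 1, -(A 1 1)]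
  map_add' := by
    intro A A'
    ext i j
    rcases i with i | i <;> rcases j with j | j <;> fin_cases i <;> fin_cases j <;>
      simp <;> ring
  map_smul' := by
    intro c A
    ext i j
    rcases i with i | i <;> rcases j with j | j <;> fin_cases i <;> fin_cases j <;> simp

theorem mem_kPrime_iff (T : Matrix IdxV' IdxV' ℂ) : T ∈ kPrime ↔ ∃ A, T = glToOsp A := by
  constructor
  · rintro ⟨h1, h2, h3⟩
    refine ⟨T.toBlocks₁₁, ?_⟩
    have e0 := h1 0
    have e1 := h1 1
    unfold PreservesForm at e0 e1
    have t0 := congrFun (congrFun e0 (Sum.inl 0)) (Sum.inr 0)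
    have t1 := congrFun (congrFun e0 (Sum.inl 1)) (Sum.inr 1)
    have t2 := congrFun (congrFun e1 (Sum.inl 0)) (Sum.inr 1)
    have t3 := congrFun (congrFun e1 (Sum.inl 1)) (Sum.inr 0)
    have h11 : (1 : ZMod 2) + 1 = 0 := by decide
    simp [Matrix.mul_apply, Fintype.sum_sum_type, Fin.sum_univ_two, parityComp, parV', parX,
      formV', sgn, h11] at t0 t1 t2 t3
    have z1 : ∀ i j, T (Sum.inr i) (Sum.inl j) = 0 := fun i j => congrFun (congrFun h2 i) j
    have z2 : ∀ i j, T (Sum.inl i) (Sum.inr j) = 0 := fun i j => congrFun (congrFun h3 i) j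
    ext i j
    rcases i with i | i <;> rcases j with j | j <;> fin_cases i <;> fin_cases j <;>
      simp [glToOsp, Matrix.toBlocks₁₁, z1, z2]
    · linear_combination t0
    · linear_combination t2
    · linear_combination -t3
    · linear_combination t1
  · rintro ⟨A, rfl⟩
    refine ⟨?_, rfl, rfl⟩
    intro a
    have h2 : ∀ x : ZMod 2, x = 0 ∨ x = 1 := by decide
    have h11 : (1 : ZMod 2) + 1 = 0 := by decide
    unfold PreservesForm
    ext i j
    rcases h2 a with rfl | rfl <;> rcases i with i | i <;> rcases j with j | j <;>
      fin_cases i <;> fin_cases j <;>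
      simp [Matrix.mul_apply, Fintype.sum_sum_type, Fin.sum_univ_two, parityComp, parV', parX,
        formV', sgn, glToOsp, h11]

/-! ### The spinor-oscillator representation -/

/-- Indices of the basis of `Ẽ = V ⊗ V'`. -/
abbrev IdxEt (n : ℕ) : Type := IdxV n × IdxV'

/-- Indices of the basis of `E = V ⊗ X'`: `x_i = (inl i, 0)`, `x_{2n+1} = (inr (), 1)` are even,
`η_i = (inl i, 1)`, `η_{2n+1} = (inr (), 0)` are odd. -/
abbrev IdxE (n : ℕ) : Type := IdxV n × Fin 2

def parE (n : ℕ) : IdxE n → ZMod 2 := fun e => parV n e.1 + parX e.2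

/-- `S(E)`. -/
abbrev SE (n : ℕ) : Type := SuperSym (parE n)

/-- The form `B̃(v ⊗ v', w ⊗ w') = (-1)^(|v'| |w|) B(v, w) B'(v', w')` on `Ẽ`. -/
def formEt (n : ℕ) : Matrix (IdxEt n) (IdxEt n) ℂ :=
  Matrix.of fun e f => sgn (parV' e.2 * parV n f.1) * formV n e.1 f.1 * formV' e.2 f.2

theorem formEt_mul_transpose (n : ℕ) : formEt n * (formEt n).transpose = 1 := by
  have hV : formV n * (formV n).transpose = 1 := by
    ext i j
    rcases i with i | i <;> rcases j with j | j
    · simp only [formV, Matrix.mul_apply, Fintype.sum_sum_type, Matrix.transpose_apply,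
        Matrix.fromBlocks_apply₁₁, Matrix.fromBlocks_apply₁₂, Matrix.of_apply]
      by_cases h : i = j
      · subst h
        simp
        split_ifs <;> norm_num
      · have h' : j ≠ i := fun e => h e.symm
        simp [h, h']
    · simp [formV, Matrix.mul_apply]
    · simp [formV, Matrix.mul_apply]
    · simp [formV, Matrix.mul_apply]
  have hV' : formV' * formV'.transpose = 1 := by
    ext i j
    rcases i with i | i <;> rcases j with j | j <;> fin_cases i <;> fin_cases j <;>
      simp [formV', Matrix.mul_apply]
  ext e f
  have key : (formEt n * (formEt n).transpose) e f =
      ∑ x, ∑ y, (sgn (parV' e.2 * parV n x) * sgn (parV' f.2 * parV n x)) *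
        (formV n e.1 x * formV n f.1 x) * (formV' e.2 y * formV' f.2 y) := by
    rw [Matrix.mul_apply, Fintype.sum_prod_type]
    refine Finset.sum_congr rfl fun x _ => Finset.sum_congr rfl fun y _ => ?_
    simp only [formEt, Matrix.transpose_apply, Matrix.of_apply]
    ring
  have k' : ∑ y, formV' e.2 y * formV' f.2 y = (1 : Matrix IdxV' IdxV' ℂ) e.2 f.2 := by
    rw [← hV']
    rfl
  have k : ∑ x, formV n e.1 x * formV n f.1 x = (1 : Matrix (IdxV n) (IdxV n) ℂ) e.1 f.1 := by
    rw [← hV]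
    rfl
  rw [key]
  simp_rw [← Finset.mul_sum, k']
  obtain ⟨e1, e2⟩ := e
  obtain ⟨f1, f2⟩ := f
  dsimp only at k ⊢
  by_cases h : e2 = f2
  · subst h
    simp_rw [sgn_mul_self, one_mul]
    rw [← Finset.sum_mul, k]
    simp [Matrix.one_apply, Prod.ext_iff]
  · simp [h]

/-- The operators on `S(E)` given by the basis vectors of `Ẽ = E ⊕ (V ⊗ Y')`: multiplication by
`e` for `e ∈ E`, and the superderivation extending `B̃(f, ·)` for `f ∈ V ⊗ Y'`. -/
def iotaOp (n : ℕ) : IdxEt n → Module.End ℂ (SE n)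
  | (i, Sum.inl a) => mulOp (parE n) (i, a)
  | (i, Sum.inr b) =>
      ∑ e : IdxE n, formEt n (i, Sum.inr b) (e.1, Sum.inl e.2) • derOp (parE n) e

/-- The spinor-oscillator representation of `spo(Ẽ, B̃)` on `S(E)`:
`ω(T) = (1/2) ∑_a ι(T e_a) ι(e^a)`, where `(e^a)` is the basis of `Ẽ` with
`B̃(e^a, e_b) = δ_{a b}`. It is the element of the Weyl-Clifford algebra that is quadratic in `Ẽ`
and has supercommutator `ι(T e)` with `ι(e)` for all `e ∈ Ẽ`. -/
def omega (n : ℕ) (T : Matrix (IdxEt n) (IdxEt n) ℂ) : Module.End ℂ (SE n) :=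
  (1 / 2 : ℂ) • ∑ e, ∑ f, (T * (formEt n)⁻¹) e f • (iotaOp n e * iotaOp n f)

/-- `X · (v ⊗ v') = X v ⊗ v'` on `Ẽ`, for `X ∈ gl(V)`. -/
def actV (n : ℕ) (X : Matrix (IdxV n) (IdxV n) ℂ) : Matrix (IdxEt n) (IdxEt n) ℂ :=
  Matrix.of fun e f => if e.2 = f.2 then X e.1 f.1 else 0

/-- `T · (v ⊗ v') = (-1)^(|T| |v|) v ⊗ T v'` on `Ẽ`, for `T ∈ gl(V')`. -/
def actV' (n : ℕ) (T : Matrix IdxV' IdxV' ℂ) : Matrix (IdxEt n) (IdxEt n) ℂ :=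
  Matrix.of fun e f =>
    if e.1 = f.1 then sgn ((parV' e.2 + parV' f.2) * parV n f.1) * T e.2 f.2 else 0

/-- The action of `spo(2n|1)` on `S(E)`. -/
def spoAction (n : ℕ) (X : Matrix (IdxV n) (IdxV n) ℂ) : Module.End ℂ (SE n) :=
  omega n (actV n X)

/-- The action of `gl(1|1) ≅ k'` on `S(E)`. -/
def gl11Action (n : ℕ) (A : Matrix (Fin 2) (Fin 2) ℂ) : Module.End ℂ (SE n) :=
  omega n (actV' n (glToOsp A))

/-- The action of `gl(2n|1)` on `S(E)` which is induced by its action on `E = V ⊗ X'`. -/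
def glVAction (n : ℕ) (X : Matrix (IdxV n) (IdxV n) ℂ) : Module.End ℂ (SE n) :=
  naturalAction (parE n) (Matrix.of fun e f => if e.2 = f.2 then X e.1 f.1 else 0)

/-- The space `S(E)^{n'⁺}` of harmonic supersymmetric tensors. -/
def harmonicTensors (n : ℕ) : Submodule ℂ (SE n) :=
  ⨅ T ∈ nPrimePlus, LinearMap.ker (omega n (actV' n T))

/-! ### Borel subalgebras and highest weights -/

/-- The nilradical of the Borel subalgebra `b̃` of `gl(2n|1)`: matrices which are strictly upper
triangular for the order `u_1, …, u_n, u_{2n+1}, u_{n+1}, …, u_{2n}` of the basis. Its elements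
in `spo(2n|1)` form the nilradical of the Borel subalgebra `b^spo`, with even part the strictly
upper triangular matrices of `sp(2n)` and odd part spanned by the
`E_{k,2n+1} + E_{2n+1,2n+1-k}`, `1 ≤ k ≤ n`. -/
def IsPosNilp (n : ℕ) (X : Matrix (IdxV n) (IdxV n) ℂ) : Prop :=
  (∀ i j : Fin (2 * n), j ≤ i → X (Sum.inl i) (Sum.inl j) = 0) ∧
  (∀ i : Fin (2 * n), (i : ℕ) < n → X (Sum.inr ()) (Sum.inl i) = 0) ∧
  (∀ i : Fin (2 * n), n ≤ (i : ℕ) → X (Sum.inl i) (Sum.inr ()) = 0) ∧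
  X (Sum.inr ()) (Sum.inr ()) = 0

/-- The index of `u_i` for `1 ≤ i ≤ n` (with `i` counted from `0`). -/
def lowIdx {n : ℕ} (i : Fin n) : IdxV n := Sum.inl (Fin.castLE (by omega) i)

/-- `v` is a `b^spo`-highest weight vector of weight `lam = (lam_1, …, lam_n)`, that is,
`E_{i,i} - E_{2n+1-i,2n+1-i}` has eigenvalue `lam_i`. -/
def IsSpoHWV {n : ℕ} (M : SuperRep (spo n)) (lam : Fin n → ℂ) (v : M) : Prop :=
  v ≠ 0 ∧ (∃ a, v ∈ M.part a) ∧
  (∀ X : (spo n).toSubmodule, IsPosNilp n X.1 → M.ρ X v = 0) ∧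
  (∀ X : (spo n).toSubmodule, X.1.IsDiag →
    M.ρ X v = (∑ i : Fin n, lam i * X.1 (lowIdx i) (lowIdx i)) • v)

/-- `w` is a highest weight vector of weight `mu = (mu_1, mu_2)` with respect to the upper
triangular Borel subalgebra of `gl(1|1)`. -/
def IsGl11HWV (M : SuperRep gl11) (mu : Fin 2 → ℂ) (w : M) : Prop :=
  w ≠ 0 ∧ (∃ a, w ∈ M.part a) ∧
  (∀ A : gl11.toSubmodule, (∀ i j : Fin 2, j ≤ i → A.1 i j = 0) → M.ρ A w = 0) ∧
  (∀ A : gl11.toSubmodule, A.1.IsDiag → M.ρ A w = (∑ i : Fin 2, mu i * A.1 i i) • w)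

/-- `f ∈ S(E)` is a `b̃`-highest weight vector of weight `lam` for `gl(2n|1)`. -/
def IsGlVHWV (n : ℕ) (lam : IdxV n → ℂ) (f : SE n) : Prop :=
  f ≠ 0 ∧ (∃ a, f ∈ superSymPart (parE n) a) ∧
  (∀ X, IsPosNilp n X → glVAction n X f = 0) ∧
  (∀ X : Matrix (IdxV n) (IdxV n) ℂ, X.IsDiag →
    glVAction n X f = (∑ i : IdxV n, lam i * X i i) • f)

/-- `N` is a graded subspace of `S(E)` invariant under `gl(2n|1) + gl(1|1)`. -/
def IsGlGlInvariant (n : ℕ) (N : Submodule ℂ (SE n)) : Prop :=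
  (N ≤ ⨆ a, N ⊓ superSymPart (parE n) a) ∧
  (∀ X, ∀ f ∈ N, glVAction n X f ∈ N) ∧ (∀ A, ∀ f ∈ N, gl11Action n A f ∈ N)

/-- `N` is an irreducible `gl(2n|1) + gl(1|1)`-submodule of `S(E)`. -/
def IsGlGlIrreducible (n : ℕ) (N : Submodule ℂ (SE n)) : Prop :=
  IsGlGlInvariant n N ∧ N ≠ ⊥ ∧ ∀ N' ≤ N, IsGlGlInvariant n N' → N' = ⊥ ∨ N' = N

/-! ### The constituents -/

/-- The labels of the three families: the trivial one, the pairs `(d, k)` with `d ≥ 0` and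
`1 ≤ k ≤ n` (the element of `Fin n` is `k - 1`), and the `d ≥ 0`. -/
abbrev Label (n : ℕ) : Type := Unit ⊕ (ℕ × Fin n) ⊕ ℕ

/-- `α = (2 n - 1) / 2`. -/
def alpha (n : ℕ) : ℂ := (2 * n - 1) / 2

/-- The weights `(0_n)`, `(d+1, 1_{k-1}, 0_{n-k})`, `(d+1, 1_{n-1})` of `spo(2n|1)`. -/
def spoWeight {n : ℕ} : Label n → Fin n → ℂ
  | Sum.inl _ => fun _ => 0
  | Sum.inr (Sum.inl (d, k)) =>
      fun i => if (i : ℕ) = 0 then (d : ℂ) + 1 else if (i : ℕ) ≤ k then 1 else 0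
  | Sum.inr (Sum.inr d) => fun i => if (i : ℕ) = 0 then (d : ℂ) + 1 else 1

/-- The weights `(α, -α)`, `(d+1+α, k-1-α)`, `(d+1+α, n-α)` of `gl(1|1)`. -/
def glWeight {n : ℕ} : Label n → Fin 2 → ℂ
  | Sum.inl _ => ![alpha n, -alpha n]
  | Sum.inr (Sum.inl (d, k)) => ![(d : ℂ) + 1 + alpha n, ((k : ℕ) : ℂ) - alpha n]
  | Sum.inr (Sum.inr d) => ![(d : ℂ) + 1 + alpha n, (n : ℂ) - alpha n]

/-- The weights `(0_{2n+1})`, `(d+1, 1_{k-1}, 0_{2n+1-k})`, `(d+1, 1_{n-1}, 0_n, 1)` of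
`gl(2n|1)`. -/
def glVWeight {n : ℕ} : Label n → IdxV n → ℂ
  | Sum.inl _ => fun _ => 0
  | Sum.inr (Sum.inl (d, k)) =>
      Sum.elim (fun i => if (i : ℕ) = 0 then (d : ℂ) + 1 else if (i : ℕ) ≤ k then 1 else 0)
        (fun _ => 0)
  | Sum.inr (Sum.inr d) =>
      Sum.elim (fun i => if (i : ℕ) = 0 then (d : ℂ) + 1 else if (i : ℕ) < n then 1 else 0)
        (fun _ => 1)

/-- The direct sum of the outer tensor products `V_λ ⊗ W_μ` over the three families. -/
abbrev ConstituentSum {n : ℕ} (V : (Fin n → ℂ) → SuperRep (spo n))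
    (W : (Fin 2 → ℂ) → SuperRep gl11) : Type :=
  ⨁ c : Label n, (V (spoWeight c) : Type) ⊗[ℂ] (W (glWeight c) : Type)

/-- The vector `v ⊗ w` in the summand with label `c`. -/
def pureTensor {n : ℕ} (V : (Fin n → ℂ) → SuperRep (spo n)) (W : (Fin 2 → ℂ) → SuperRep gl11)
    (c : Label n) (v : V (spoWeight c)) (w : W (glWeight c)) : ConstituentSum V W :=
  DirectSum.lof ℂ (Label n)
    (fun c : Label n => (V (spoWeight c) : Type) ⊗[ℂ] (W (glWeight c) : Type)) c (v ⊗ₜ[ℂ] w)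

end SpoHowe

end

open SpoHowe

open scoped TensorProduct DirectSum

noncomputable section

set_option linter.unusedSectionVars false

namespace SpoHowe

/-! The space S(E) is a Fock space: `mulOp` and `derOp` satisfy the super canonical commutation
relations, and the quadratic elements ∑ A_{kl} m_k d_l represent gl(E). Normal ordering puts the
spinor-oscillator representation into this form. The algebra spo(2n|1) acts as a subalgebra of
gl(V), with no constant term because X' has superdimension 0 (`spoAction_eq`). The algebra gl(1|1)
acts by superderivations plus α times the supertrace, because V has superdimension 2n - 1 = 2α
(`gl11Action_eq`). The algebra n'⁺ acts by combinations of the second-order operators `lapOp`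
(`mem_harmonicTensors`), which supercommute with spo(2n|1) and are transformed linearly among
themselves by gl(X').

Every label c has an explicit vector `labelVec c`: the vacuum, or a power of u_1 ⊗ v_1 times the
product of the u_p ⊗ w_1 over an initial segment of the ordered basis. It is killed by the raising
operators of gl(V), by the lowering operator of gl(1|1) and by all Laplacians `lapOp`. Let M =
`spoMod c` be the spo(2n|1)-module it generates. Since gl(1|1) supercommutes with spo(2n|1), the
lowering operator kills all of M, and M together with its image under the raising operator is a copy
of M ⊗ W inside the harmonic tensors. Here W has dimension 2, except for the trivial label, where
the raising operator vanishes on M and W has dimension 1.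

Irreducibility of M rests on the positive definite Fock form (`exists_fock_form`), for which X in
gl(V) has adjoint X*. The odd part of spo(2n|1) is not stable under X ↦ X*, but its even part sp(2n)
is, so every highest weight occurring in S(E) is dominant (`IsHW.dominant`). A nonzero submodule of
M contains a highest weight vector, of weight ν say. If μ is the weight of the generator, the
Casimir element gives (ν, ν + 2ρ) = (μ, μ + 2ρ), that is, (μ + ν + 2ρ, μ - ν) = 0. As μ + ν + 2ρ is
strictly positive on positive roots, that vector is a multiple of the generator
(`IsHW.eq_cyc_of_ne_bot`). For gl(2n|1) + gl(1|1) the adjoint of every operator stays in the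
algebra, and unitarity alone gives irreducibility of `glMod c` (`mem_of_unitary`).

Two points remain. The weight (d+1, 1_{n-1}) belongs to two labels, so one module V_λ is fixed and
carried to each place by the isomorphism of `IsHW.exists_iso`, which is even because λ determines
the parity of `labelVec c`. The sum is direct because `labelOp`, a Casimir element of gl(1|1) plus i
times the degree, takes different eigenvalues on different constituents (`labelEig_injective`). -/

theorem zmod2_cases (a : ZMod 2) : a = 0 ∨ a = 1 := by
  revert a; decide

/-! ### Creation and annihilation operators on an exterior algebra -/

section Exterior

variable {σ : Type} [DecidableEq σ]

/-- Left multiplication by a basis vector on an exterior algebra. -/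
def wedgeOp (k : σ) : Module.End ℂ (ExteriorAlgebra ℂ (σ → ℂ)) :=
  LinearMap.mulLeft ℂ (ExteriorAlgebra.ι ℂ (Pi.single k 1))

/-- Left contraction by a dual basis vector on an exterior algebra. -/
def contrOp (k : σ) : Module.End ℂ (ExteriorAlgebra ℂ (σ → ℂ)) :=
  CliffordAlgebra.contractLeft (Q := (0 : QuadraticForm ℂ (σ → ℂ))) (LinearMap.proj k)

theorem contrOp_wedgeOp (k l : σ) (y : ExteriorAlgebra ℂ (σ → ℂ)) :
    contrOp k (wedgeOp l y) = (if k = l then (1 : ℂ) else 0) • y - wedgeOp l (contrOp k y) := by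
  have e := CliffordAlgebra.contractLeft_ι_mul (Q := (0 : QuadraticForm ℂ (σ → ℂ)))
    (d := LinearMap.proj k) (Pi.single l 1) y
  rw [LinearMap.proj_apply, Pi.single_apply] at e
  exact e

theorem wedgeOp_wedgeOp (k l : σ) (y : ExteriorAlgebra ℂ (σ → ℂ)) :
    wedgeOp k (wedgeOp l y) = -wedgeOp l (wedgeOp k y) := by
  unfold wedgeOp
  simp only [LinearMap.mulLeft_apply]
  rw [← mul_assoc, ← mul_assoc, ← neg_mul]
  congr 1
  exact eq_neg_of_add_eq_zero_left
    (ExteriorAlgebra.ι_add_mul_swap (R := ℂ) (Pi.single k 1 : σ → ℂ) (Pi.single l 1))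

theorem contrOp_contrOp (k l : σ) (y : ExteriorAlgebra ℂ (σ → ℂ)) :
    contrOp k (contrOp l y) = -contrOp l (contrOp k y) :=
  CliffordAlgebra.contractLeft_comm (Q := (0 : QuadraticForm ℂ (σ → ℂ)))
    (LinearMap.proj k) (LinearMap.proj l) y

theorem contrOp_one (k : σ) : contrOp k 1 = 0 :=
  CliffordAlgebra.contractLeft_one (Q := (0 : QuadraticForm ℂ (σ → ℂ))) (LinearMap.proj k)

theorem involute_wedgeOp (k : σ) (y : ExteriorAlgebra ℂ (σ → ℂ)) :
    CliffordAlgebra.involute (Q := (0 : QuadraticForm ℂ (σ → ℂ))) (wedgeOp k y) =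
      -wedgeOp k (CliffordAlgebra.involute (Q := (0 : QuadraticForm ℂ (σ → ℂ))) y) := by
  have : wedgeOp k y = CliffordAlgebra.ι (0 : QuadraticForm ℂ (σ → ℂ)) (Pi.single k 1) * y := rfl
  rw [this, map_mul, CliffordAlgebra.involute_ι, neg_mul]
  rfl

theorem involute_contrOp (k : σ) (y : ExteriorAlgebra ℂ (σ → ℂ)) :
    CliffordAlgebra.involute (Q := (0 : QuadraticForm ℂ (σ → ℂ))) (contrOp k y) =
      -contrOp k (CliffordAlgebra.involute (Q := (0 : QuadraticForm ℂ (σ → ℂ))) y) := by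
  unfold contrOp
  induction y using CliffordAlgebra.left_induction with
  | algebraMap c => simp only [CliffordAlgebra.contractLeft_algebraMap, AlgHom.commutes, map_zero,
      neg_zero]
  | add x y hx hy => rw [map_add, map_add, map_add, map_add, hx, hy, neg_add]
  | ι_mul x v hx =>
    rw [CliffordAlgebra.contractLeft_ι_mul, map_sub, map_mul, map_mul, CliffordAlgebra.involute_ι,
      hx, map_smul, neg_mul, neg_mul, map_neg, CliffordAlgebra.contractLeft_ι_mul]
    simp only [mul_neg]
    abel

end Exterior

/-! ### Creation and annihilation operators on a supersymmetric algebra -/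

section Fock

variable {κ : Type} [Fintype κ] [DecidableEq κ] (r : κ → ZMod 2)

theorem mulOp_even {k : κ} (h : r k = 0) (x y) :
    mulOp r k (x ⊗ₜ y) = (MvPolynomial.X ⟨k, h⟩ * x) ⊗ₜ y := by
  rw [mulOp, dif_pos h]
  rfl

theorem mulOp_odd {k : κ} (h : r k ≠ 0) (x y) :
    mulOp r k (x ⊗ₜ y) = x ⊗ₜ wedgeOp ⟨k, h⟩ y := by
  rw [mulOp, dif_neg h]
  rfl

theorem derOp_even {k : κ} (h : r k = 0) (x y) :
    derOp r k (x ⊗ₜ y) = (MvPolynomial.pderiv ⟨k, h⟩ x) ⊗ₜ y := by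
  rw [derOp, dif_pos h]
  rfl

theorem derOp_odd {k : κ} (h : r k ≠ 0) (x y) :
    derOp r k (x ⊗ₜ y) = x ⊗ₜ contrOp ⟨k, h⟩ y := by
  rw [derOp, dif_neg h]
  rfl

theorem neg_one_smul_superSym (v : SuperSym r) : (-1 : ℂ) • v = -v := neg_one_smul ℂ v

theorem sgn_zero : sgn 0 = 1 := by simp [sgn]

theorem sgn_one : sgn 1 = -1 := by simp [sgn]

theorem eq_one_of_ne_zero {a : ZMod 2} (h : a ≠ 0) : a = 1 := (zmod2_cases a).resolve_left h

/-- Even generators act on the polynomial factor and odd ones on the exterior factor, so mixed pairs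
commute outright. This agrees with the sign rule, since the product of the parities is then 0. -/
theorem derOp_mulOp (k l : κ) :
    derOp r k * mulOp r l = sgn (r k * r l) • (mulOp r l * derOp r k) +
      if k = l then 1 else 0 := by
  refine TensorProduct.ext' fun x y => ?_
  rw [LinearMap.add_apply, LinearMap.smul_apply, Module.End.mul_apply, Module.End.mul_apply]
  by_cases hk : r k = 0 <;> by_cases hl : r l = 0
  · rw [mulOp_even r hl, derOp_even r hk, derOp_even r hk, mulOp_even r hl, Derivation.leibniz,
      MvPolynomial.pderiv_X, hk, zero_mul, sgn_zero, one_smul]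
    by_cases h : k = l
    · subst h
      simp [TensorProduct.add_tmul]
    · have h' : l ≠ k := fun e => h e.symm
      simp [h, h']
  · have h : k ≠ l := fun e => hl (e ▸ hk)
    rw [mulOp_odd r hl, derOp_even r hk, derOp_even r hk, mulOp_odd r hl, hk, zero_mul, sgn_zero,
      one_smul, if_neg h, LinearMap.zero_apply, add_zero]
  · have h : k ≠ l := fun e => hk (e ▸ hl)
    rw [mulOp_even r hl, derOp_odd r hk, derOp_odd r hk, mulOp_even r hl, hl, mul_zero, sgn_zero,
      one_smul, if_neg h, LinearMap.zero_apply, add_zero]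
  · rw [mulOp_odd r hl, derOp_odd r hk, derOp_odd r hk, mulOp_odd r hl, contrOp_wedgeOp,
      eq_one_of_ne_zero hk, eq_one_of_ne_zero hl, mul_one, sgn_one, neg_smul, one_smul,
      TensorProduct.tmul_sub, sub_eq_add_neg, add_comm]
    congr 1
    simp only [Subtype.mk.injEq]
    split_ifs <;> simp

theorem mulOp_mulOp (k l : κ) :
    mulOp r k * mulOp r l = sgn (r k * r l) • (mulOp r l * mulOp r k) := by
  refine TensorProduct.ext' fun x y => ?_
  rw [LinearMap.smul_apply, Module.End.mul_apply, Module.End.mul_apply]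
  by_cases hk : r k = 0 <;> by_cases hl : r l = 0
  · simp only [mulOp_even r hk, mulOp_even r hl]
    rw [hk, zero_mul, sgn_zero, one_smul, mul_left_comm]
  · simp only [mulOp_even r hk, mulOp_odd r hl]
    rw [hk, zero_mul, sgn_zero, one_smul]
  · simp only [mulOp_odd r hk, mulOp_even r hl]
    rw [hl, mul_zero, sgn_zero, one_smul]
  · simp only [mulOp_odd r hk, mulOp_odd r hl]
    rw [eq_one_of_ne_zero hk, eq_one_of_ne_zero hl, mul_one, sgn_one, neg_smul, one_smul,
      wedgeOp_wedgeOp, TensorProduct.tmul_neg]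

/-- The commutator of two derivations is a derivation, and this one kills every variable. -/
theorem pderiv_comm {σ : Type} (i j : σ) (x : MvPolynomial σ ℂ) :
    MvPolynomial.pderiv i (MvPolynomial.pderiv j x) =
      MvPolynomial.pderiv j (MvPolynomial.pderiv i x) := by
  classical
  have h : ⁅(MvPolynomial.pderiv i : Derivation ℂ (MvPolynomial σ ℂ) (MvPolynomial σ ℂ)),
      (MvPolynomial.pderiv j : Derivation ℂ (MvPolynomial σ ℂ) (MvPolynomial σ ℂ))⁆ = 0 := by
    refine MvPolynomial.derivation_ext fun k => ?_
    rw [Derivation.commutator_apply, MvPolynomial.pderiv_X, MvPolynomial.pderiv_X]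
    simp only [Pi.single_apply]
    split_ifs <;> simp
  have := congrArg (fun D => D x) h
  simp only [Derivation.commutator_apply, Derivation.coe_zero, Pi.zero_apply] at this
  exact sub_eq_zero.1 this

theorem derOp_derOp (k l : κ) :
    derOp r k * derOp r l = sgn (r k * r l) • (derOp r l * derOp r k) := by
  refine TensorProduct.ext' fun x y => ?_
  rw [LinearMap.smul_apply, Module.End.mul_apply, Module.End.mul_apply]
  by_cases hk : r k = 0 <;> by_cases hl : r l = 0
  · simp only [derOp_even r hk, derOp_even r hl]
    rw [hk, zero_mul, sgn_zero, one_smul, pderiv_comm]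
  · simp only [derOp_even r hk, derOp_odd r hl]
    rw [hk, zero_mul, sgn_zero, one_smul]
  · simp only [derOp_odd r hk, derOp_even r hl]
    rw [hl, mul_zero, sgn_zero, one_smul]
  · simp only [derOp_odd r hk, derOp_odd r hl]
    rw [eq_one_of_ne_zero hk, eq_one_of_ne_zero hl, mul_one, sgn_one, neg_smul, one_smul,
      contrOp_contrOp, TensorProduct.tmul_neg]

/-- The vacuum vector. -/
def vac : SuperSym r := 1 ⊗ₜ 1

theorem derOp_vac (k : κ) : derOp r k (vac r) = 0 := by
  by_cases hk : r k = 0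
  · rw [vac, derOp_even r hk, MvPolynomial.pderiv_one, TensorProduct.zero_tmul]
  · rw [vac, derOp_odd r hk, contrOp_one, TensorProduct.tmul_zero]

/-! ### The grading of the supersymmetric algebra through its parity operator. -/

theorem tmul_mem_superSymPart (a : ZMod 2) (x) (y)
    (hy : y ∈ CliffordAlgebra.evenOdd (0 : QuadraticForm ℂ ({k // r k ≠ 0} → ℂ)) a) :
    x ⊗ₜ y ∈ superSymPart r a :=
  ⟨x ⊗ₜ ⟨y, hy⟩, by simp⟩

theorem superSymPart_induction {a : ZMod 2} {N : Submodule ℂ (SuperSym r)}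
    (h : ∀ x y, y ∈ CliffordAlgebra.evenOdd (0 : QuadraticForm ℂ ({k // r k ≠ 0} → ℂ)) a →
      x ⊗ₜ y ∈ N) : superSymPart r a ≤ N := by
  rintro _ ⟨t, rfl⟩
  induction t using TensorProduct.induction_on with
  | zero => simp
  | tmul x y => exact h x y.1 y.2
  | add s t hs ht => rw [map_add]; exact N.add_mem hs ht

theorem vac_mem : vac r ∈ superSymPart r 0 := by
  refine tmul_mem_superSymPart r 0 _ _ ?_
  exact CliffordAlgebra.one_le_evenOdd_zero _ (Submodule.one_le.1 le_rfl)

/-- The parity operator of a supersymmetric algebra. -/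
def parityOp : Module.End ℂ (SuperSym r) :=
  TensorProduct.map LinearMap.id
    (CliffordAlgebra.involute (Q := (0 : QuadraticForm ℂ ({k // r k ≠ 0} → ℂ)))).toLinearMap

theorem parityOp_tmul (x y) : parityOp r (x ⊗ₜ y) = x ⊗ₜ
    (CliffordAlgebra.involute (Q := (0 : QuadraticForm ℂ ({k // r k ≠ 0} → ℂ))) y) := rfl

theorem parityOp_of_mem {a : ZMod 2} {v : SuperSym r} (hv : v ∈ superSymPart r a) :
    parityOp r v = sgn a • v := by
  refine superSymPart_induction r
    (N := LinearMap.eqLocus (parityOp r) (sgn a • LinearMap.id)) ?_ hv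
  intro x y hy
  rw [LinearMap.mem_eqLocus, parityOp_tmul, LinearMap.smul_apply, LinearMap.id_apply]
  rcases zmod2_cases a with rfl | rfl
  · rw [CliffordAlgebra.involute_eq_of_mem_even hy, sgn_zero, one_smul]
  · rw [CliffordAlgebra.involute_eq_of_mem_odd hy, sgn_one, neg_smul, one_smul,
      TensorProduct.tmul_neg]

theorem iSup_superSymPart : ⨆ a, superSymPart r a = ⊤ := by
  rw [eq_top_iff]
  rintro v -
  induction v using TensorProduct.induction_on with
  | zero => simp
  | add s t hs ht => exact Submodule.add_mem _ hs ht
  | tmul x y =>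
    have hy : y ∈ (⊤ : Submodule ℂ (CliffordAlgebra (0 : QuadraticForm ℂ ({k // r k ≠ 0} → ℂ)))) :=
      trivial
    rw [← (CliffordAlgebra.evenOdd_isCompl (0 : QuadraticForm ℂ ({k // r k ≠ 0} → ℂ))).sup_eq_top,
      Submodule.mem_sup] at hy
    obtain ⟨y0, h0, y1, h1, rfl⟩ := hy
    change x ⊗ₜ (y0 + y1 : ExteriorAlgebra ℂ ({k // r k ≠ 0} → ℂ)) ∈ _
    rw [TensorProduct.tmul_add]
    exact Submodule.add_mem _
      (Submodule.mem_iSup_of_mem 0 (tmul_mem_superSymPart r 0 _ _ h0))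
      (Submodule.mem_iSup_of_mem 1 (tmul_mem_superSymPart r 1 _ _ h1))

/-- This turns gradedness into an eigenvalue equation for a single operator, in which form all later
parity statements are checked. -/
theorem mem_superSymPart_iff {a : ZMod 2} {v : SuperSym r} :
    v ∈ superSymPart r a ↔ parityOp r v = sgn a • v := by
  refine ⟨parityOp_of_mem r, fun h => ?_⟩
  have hv : v ∈ ⨆ a, superSymPart r a := by rw [iSup_superSymPart]; trivial
  have hs : ⨆ a, superSymPart r a = superSymPart r 0 ⊔ superSymPart r 1 := by
    refine le_antisymm (iSup_le fun a => ?_) (sup_le (le_iSup _ 0) (le_iSup _ 1))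
    rcases zmod2_cases a with rfl | rfl
    · exact le_sup_left
    · exact le_sup_right
  rw [hs, Submodule.mem_sup] at hv
  obtain ⟨v0, h0, v1, h1, rfl⟩ := hv
  rw [map_add, parityOp_of_mem r h0, parityOp_of_mem r h1, sgn_zero, sgn_one, one_smul,
    neg_one_smul_superSym] at h
  rcases zmod2_cases a with rfl | rfl
  · have : v1 = 0 := by
      rw [sgn_zero, one_smul, add_right_inj, neg_eq_iff_add_eq_zero, ← two_smul ℂ] at h
      simpa using h
    rw [this, add_zero]
    exact h0
  · have : v0 = 0 := by
      rw [sgn_one, neg_one_smul_superSym, neg_add, add_left_inj, ← sub_eq_zero, sub_neg_eq_add,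
        ← two_smul ℂ] at h
      simpa using h
    rw [this, zero_add]
    exact h1

theorem parityOp_mulOp (k : κ) (v : SuperSym r) :
    parityOp r (mulOp r k v) = sgn (r k) • mulOp r k (parityOp r v) := by
  induction v using TensorProduct.induction_on with
  | zero => simp
  | add s t hs ht => simp only [map_add, hs, ht, smul_add]
  | tmul x y =>
    by_cases hk : r k = 0
    · rw [mulOp_even r hk, parityOp_tmul, parityOp_tmul, mulOp_even r hk, hk, sgn_zero, one_smul]
    · rw [mulOp_odd r hk, parityOp_tmul, parityOp_tmul, mulOp_odd r hk, eq_one_of_ne_zero hk,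
        sgn_one, neg_one_smul_superSym, involute_wedgeOp, TensorProduct.tmul_neg]

theorem parityOp_derOp (k : κ) (v : SuperSym r) :
    parityOp r (derOp r k v) = sgn (r k) • derOp r k (parityOp r v) := by
  induction v using TensorProduct.induction_on with
  | zero => simp
  | add s t hs ht => simp only [map_add, hs, ht, smul_add]
  | tmul x y =>
    by_cases hk : r k = 0
    · rw [derOp_even r hk, parityOp_tmul, parityOp_tmul, derOp_even r hk, hk, sgn_zero, one_smul]
    · rw [derOp_odd r hk, parityOp_tmul, parityOp_tmul, derOp_odd r hk, eq_one_of_ne_zero hk,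
        sgn_one, neg_one_smul_superSym, involute_contrOp, TensorProduct.tmul_neg]

theorem mulOp_mem (k : κ) {a : ZMod 2} {v : SuperSym r} (hv : v ∈ superSymPart r a) :
    mulOp r k v ∈ superSymPart r (r k + a) := by
  rw [mem_superSymPart_iff] at hv ⊢
  rw [parityOp_mulOp, hv, map_smul, smul_smul, sgn_add]

theorem derOp_mem (k : κ) {a : ZMod 2} {v : SuperSym r} (hv : v ∈ superSymPart r a) :
    derOp r k v ∈ superSymPart r (r k + a) := by
  rw [mem_superSymPart_iff] at hv ⊢
  rw [parityOp_derOp, hv, map_smul, smul_smul, sgn_add]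

end Fock

/-! ### The Fock inner product -/

/-- The basis consists of the wedge monomials. The reordering signs are left unspecified: that they
are ±1 suffices to make wedge and contraction adjoint when the basis is declared orthonormal. -/
theorem exists_exterior_basis_of_linearOrder {σ : Type} [LinearOrder σ] [Fintype σ] :
    ∃ (b : Module.Basis (Finset σ) ℂ (ExteriorAlgebra ℂ (σ → ℂ))),
      (∀ k S, k ∉ S → ∃ u : ℤˣ, wedgeOp k (b S) = u • b (insert k S)) ∧
      (∀ k S, k ∉ S → contrOp k (b S) = 0) := by
  have hsing : ∀ k : σ, (Pi.basisFun ℂ σ).ExteriorAlgebra {k} =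
      ExteriorAlgebra.ι ℂ (Pi.single k 1) := by
    intro k
    rw [ExteriorAlgebra.basis_apply_ofCard _ (n := 1) (by simp), ExteriorAlgebra.ιMulti_family,
      ExteriorAlgebra.ιMulti_succ_apply]
    have : (Set.powersetCard.ofFinEmbEquiv.symm
        (Set.powersetCard.ofCard (s := ({k} : Finset σ)) (n := 1) (by simp))) 0 = k := by
      have := (Set.powersetCard.mem_range_ofFinEmbEquiv_symm_iff_mem
        (Set.powersetCard.ofCard (s := ({k} : Finset σ)) (n := 1) (by simp)) _).1 ⟨0, rfl⟩
      exact Finset.mem_singleton.1 this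
    simp [this]
  refine ⟨(Pi.basisFun ℂ σ).ExteriorAlgebra, ?_, ?_⟩
  · intro k S h
    have hd : Disjoint (Set.powersetCard.ofCard (n := 1) (s := ({k} : Finset σ)) (by simp)).val
        (Set.powersetCard.ofCard (s := S) rfl).val := Finset.disjoint_singleton_left.2 h
    have := ExteriorAlgebra.basis_mul_of_disjoint (Pi.basisFun ℂ σ) _ _ hd
    refine ⟨Equiv.Perm.sign (Set.powersetCard.permOfDisjoint hd), ?_⟩
    rw [wedgeOp, LinearMap.mulLeft_apply, ← hsing]
    refine this.trans ?_
    congr 2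
    rw [Set.powersetCard.coe_disjUnion, Finset.disjUnion_eq_union]
    rfl
  · intro k S h
    -- By the Leibniz rule, contraction by the k-th coordinate kills a product of vectors whose k-th
    -- coordinates all vanish.
    have key : ∀ (m : ℕ) (v : Fin m → σ → ℂ), (∀ i, v i k = 0) →
        contrOp k (ExteriorAlgebra.ιMulti ℂ m v) = 0 := by
      intro m
      induction m with
      | zero =>
        intro v _
        rw [ExteriorAlgebra.ιMulti_zero_apply, contrOp_one]
      | succ m ih =>
        intro v hv
        rw [ExteriorAlgebra.ιMulti_succ_apply]
        have e := CliffordAlgebra.contractLeft_ι_mul (Q := (0 : QuadraticForm ℂ (σ → ℂ)))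
          (d := LinearMap.proj k) (v 0) (ExteriorAlgebra.ιMulti ℂ m (Matrix.vecTail v))
        rw [LinearMap.proj_apply, hv 0, zero_smul, zero_sub] at e
        refine e.trans ?_
        rw [neg_eq_zero]
        have e2 := ih (Matrix.vecTail v) (fun i => hv _)
        unfold contrOp at e2
        rw [e2, mul_zero]
    rw [ExteriorAlgebra.basis_apply]
    refine key _ _ fun i => ?_
    rw [Function.comp_apply, Pi.basisFun_apply, Pi.single_apply, if_neg]
    rintro rfl
    apply h
    have := (Set.powersetCard.mem_range_ofFinEmbEquiv_symm_iff_mem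
        (Set.powersetCard.prodEquiv.symm S).2 _).1 ⟨i, rfl⟩
    exact this

theorem exists_exterior_basis (σ : Type) [Fintype σ] [DecidableEq σ] :
    ∃ (b : Module.Basis (Finset σ) ℂ (ExteriorAlgebra ℂ (σ → ℂ))),
      (∀ k S, k ∉ S → ∃ u : ℤˣ, wedgeOp k (b S) = u • b (insert k S)) ∧
      (∀ k S, k ∉ S → contrOp k (b S) = 0) := by
  classical
  let _ : LinearOrder σ := linearOrderOfSTO WellOrderingRel
  convert exists_exterior_basis_of_linearOrder (σ := σ)

theorem exists_form_of_basis {I U : Type} [AddCommGroup U] [Module ℂ U]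
    (b : Module.Basis I ℂ U) (wt : I → ℝ) (hwt : ∀ i, 0 < wt i) :
    ∃ F : U →ₗ⋆[ℂ] U →ₗ[ℂ] ℂ, (∀ i, F (b i) (b i) = wt i) ∧
      (∀ i j, i ≠ j → F (b i) (b j) = 0) ∧
      (∀ v w, F w v = starRingEnd ℂ (F v w)) ∧ (∀ v, v ≠ 0 → 0 < (F v v).re) := by
  classical
  let g : U → U → ℂ := fun v w =>
    (b.repr v).sum fun i c => starRingEnd ℂ c * (wt i * b.repr w i)
  have hg : ∀ (s : Finset I) v w, (b.repr v).support ⊆ s →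
      g v w = ∑ i ∈ s, starRingEnd ℂ (b.repr v i) * (wt i * b.repr w i) := by
    intro s v w hs
    exact Finsupp.sum_of_support_subset _ hs _ (by simp)
  let F : U →ₗ⋆[ℂ] U →ₗ[ℂ] ℂ := LinearMap.mk₂'ₛₗ (starRingEnd ℂ) (RingHom.id ℂ) g
    (by
      intro v v' w
      change Finsupp.sum _ _ = _
      rw [map_add]
      exact Finsupp.sum_add_index' (by simp) (by intros; rw [map_add, add_mul]))
    (by
      intro c v w
      change Finsupp.sum _ _ = _
      rw [map_smul, Finsupp.sum_smul_index (by simp), smul_eq_mul]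
      change _ = _ * Finsupp.sum _ _
      rw [Finsupp.mul_sum]
      simp only [map_mul, mul_assoc])
    (by
      intro v w w'
      change Finsupp.sum _ _ = Finsupp.sum _ _ + Finsupp.sum _ _
      rw [← Finsupp.sum_add]
      simp only [map_add, Finsupp.add_apply, mul_add])
    (by
      intro c v w
      change Finsupp.sum _ _ = _ • Finsupp.sum _ _
      rw [smul_eq_mul, Finsupp.mul_sum]
      refine Finsupp.sum_congr fun i _ => ?_
      rw [map_smul, Finsupp.smul_apply, smul_eq_mul, RingHom.id_apply]
      ring)
  have hF : ∀ v w, F v w = g v w := fun _ _ => rfl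
  refine ⟨F, ?_, ?_, ?_, ?_⟩
  · intro i
    rw [hF, hg {i} _ _ (by rw [b.repr_self]; exact Finsupp.support_single_subset)]
    simp
  · intro i j hij
    rw [hF, hg {i} _ _ (by rw [b.repr_self]; exact Finsupp.support_single_subset)]
    simp [Finsupp.single_apply, hij.symm]
  · intro v w
    rw [hF, hF, hg ((b.repr v).support ∪ (b.repr w).support) _ _ Finset.subset_union_left,
      hg ((b.repr v).support ∪ (b.repr w).support) _ _ Finset.subset_union_right, map_sum]
    refine Finset.sum_congr rfl fun i _ => ?_
    simp only [map_mul, Complex.conj_conj, Complex.conj_ofReal]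
    ring
  · intro v hv
    rw [hF, hg _ v v subset_rfl, Complex.re_sum]
    refine Finset.sum_pos ?_ ?_
    · intro i hi
      have h1 : starRingEnd ℂ (b.repr v i) * (wt i * b.repr v i) =
          ((wt i * Complex.normSq (b.repr v i) : ℝ) : ℂ) := by
        rw [Complex.ofReal_mul, Complex.normSq_eq_conj_mul_self]
        ring
      rw [h1, Complex.ofReal_re]
      exact mul_pos (hwt i) (Complex.normSq_pos.2 (Finsupp.mem_support_iff.1 hi))
    · rw [Finsupp.support_nonempty_iff]
      simpa using hv

theorem form_adjoint_of_basis {I U : Type} [AddCommGroup U] [Module ℂ U]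
    (b : Module.Basis I ℂ U) (F : U →ₗ⋆[ℂ] U →ₗ[ℂ] ℂ) (A A' : Module.End ℂ U)
    (h : ∀ i j, F (A (b i)) (b j) = F (b i) (A' (b j))) (v w : U) :
    F (A v) w = F v (A' w) := by
  have h1 : ∀ i, F (A (b i)) = (F (b i)).comp A' := fun i => b.ext fun j => h i j
  have h2 : F.comp A = ((LinearMap.lcomp ℂ ℂ A').comp F : U →ₛₗ[starRingEnd ℂ] U →ₗ[ℂ] ℂ) :=
    b.ext fun i => h1 i
  exact congrArg (fun G : U →ₛₗ[starRingEnd ℂ] U →ₗ[ℂ] ℂ => G v w) h2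

section Fock

variable {κ : Type} [Fintype κ] [DecidableEq κ] (r : κ → ZMod 2)

set_option maxHeartbeats 800000 in
-- The monomial of exponent p gets squared norm ∏ p_k!, and the exterior basis is orthonormal. The
-- identity (p+1)! = (p+1) p! then makes multiplication by a variable adjoint to its partial
-- derivative.
theorem exists_fock_form :
    ∃ F : SuperSym r →ₗ⋆[ℂ] SuperSym r →ₗ[ℂ] ℂ,
      (∀ v w, F w v = starRingEnd ℂ (F v w)) ∧ (∀ v, v ≠ 0 → 0 < (F v v).re) ∧
      (∀ k v w, F (mulOp r k v) w = F v (derOp r k w)) := by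
  obtain ⟨b, hb1, hb2⟩ := exists_exterior_basis {k // r k ≠ 0}
  let B := (MvPolynomial.basisMonomials {k // r k = 0} ℂ).tensorProduct b
  obtain ⟨F, hF1, hF2, hF3, hF4⟩ := exists_form_of_basis B
    (fun i => ∏ k, ((i.1 k).factorial : ℝ))
    (fun i => Finset.prod_pos fun k _ => by exact_mod_cast Nat.factorial_pos _)
  have hB : ∀ p S, B (p, S) = MvPolynomial.monomial p 1 ⊗ₜ b S := fun p S => by
    rw [Module.Basis.tensorProduct_apply, MvPolynomial.coe_basisMonomials]
  refine ⟨F, hF3, hF4, fun k => form_adjoint_of_basis B F _ _ ?_⟩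
  rintro ⟨p, S⟩ ⟨q, T⟩
  by_cases hk : r k = 0
  · have e1 : mulOp r k (B (p, S)) = B (p + Finsupp.single ⟨k, hk⟩ 1, S) := by
      rw [hB, hB, mulOp_even r hk, MvPolynomial.X, MvPolynomial.monomial_mul, one_mul, add_comm]
    have e2 : derOp r k (B (q, T)) =
        (q ⟨k, hk⟩ : ℂ) • B (q - Finsupp.single ⟨k, hk⟩ 1, T) := by
      rw [hB, hB, derOp_even r hk, MvPolynomial.pderiv_monomial, one_mul, TensorProduct.smul_tmul',
        MvPolynomial.smul_monomial, smul_eq_mul, mul_one]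
    rw [e1, e2, map_smul, smul_eq_mul]
    by_cases h : p + Finsupp.single ⟨k, hk⟩ 1 = q ∧ S = T
    · obtain ⟨rfl, rfl⟩ := h
      rw [add_tsub_cancel_right, hF1, hF1]
      simp only [Finsupp.add_apply]
      rw [← Finset.mul_prod_erase Finset.univ _ (Finset.mem_univ (⟨k, hk⟩ : {k // r k = 0})),
        ← Finset.mul_prod_erase Finset.univ (fun i => ((p i).factorial : ℝ))
          (Finset.mem_univ (⟨k, hk⟩ : {k // r k = 0}))]
      have : ∏ x ∈ Finset.univ.erase (⟨k, hk⟩ : {k // r k = 0}),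
          (((p x + (Finsupp.single (⟨k, hk⟩ : {k // r k = 0}) 1 : _ →₀ ℕ) x).factorial : ℕ) : ℝ) =
          ∏ x ∈ Finset.univ.erase (⟨k, hk⟩ : {k // r k = 0}), ((p x).factorial : ℝ) := by
        refine Finset.prod_congr rfl fun x hx => ?_
        rw [Finsupp.single_eq_of_ne (Finset.ne_of_mem_erase hx), add_zero]
      rw [this, Finsupp.single_eq_same, Nat.factorial_succ]
      push_cast
      ring
    · rw [hF2 _ _ (by simpa using h)]
      by_cases hq : q ⟨k, hk⟩ = 0
      · rw [hq, Nat.cast_zero, zero_mul]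
      · rw [hF2, mul_zero]
        intro e
        rw [Prod.mk.injEq] at e
        refine h ⟨?_, e.2⟩
        rw [e.1]
        refine tsub_add_cancel_of_le ?_
        rw [Finsupp.single_le_iff]
        omega
  -- Contraction undoes the wedge with the same sign `u`, because `u` is its own inverse.
  · have hi : ∀ S, ⟨k, hk⟩ ∉ S → ∃ u : ℤˣ, wedgeOp ⟨k, hk⟩ (b S) = u • b (insert ⟨k, hk⟩ S) ∧
        contrOp ⟨k, hk⟩ (b (insert ⟨k, hk⟩ S)) = u • b S := by
      intro S hS
      obtain ⟨u, hu⟩ := hb1 ⟨k, hk⟩ S hS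
      refine ⟨u, hu, ?_⟩
      have h3 := contrOp_wedgeOp (⟨k, hk⟩ : {k // r k ≠ 0}) ⟨k, hk⟩ (b S)
      rw [hb2 _ S hS, if_pos rfl, one_smul, map_zero, sub_zero, hu] at h3
      rcases Int.units_eq_one_or u with rfl | rfl
      · simpa using h3
      · simp only [Units.neg_smul, one_smul, map_neg] at h3 ⊢
        rw [← h3, neg_neg]
    -- If S contains the index, `b S` is already, up to sign, a wedge with the same odd vector,
    -- whose square is 0.
    have hw : ∀ S, ⟨k, hk⟩ ∈ S → wedgeOp ⟨k, hk⟩ (b S) = 0 := by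
      intro S hS
      obtain ⟨u, hu, -⟩ := hi (S.erase ⟨k, hk⟩) (Finset.notMem_erase _ _)
      rw [Finset.insert_erase hS] at hu
      have h4 := wedgeOp_wedgeOp (⟨k, hk⟩ : {k // r k ≠ 0}) ⟨k, hk⟩ (b (S.erase ⟨k, hk⟩))
      rw [eq_neg_iff_add_eq_zero, ← two_smul ℂ, smul_eq_zero, hu] at h4
      have h5 := h4.resolve_left two_ne_zero
      rcases Int.units_eq_one_or u with rfl | rfl
      · simpa using h5
      · simpa only [Units.neg_smul, one_smul, map_neg, neg_eq_zero] using h5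
    have hL : ∀ (u : ℤˣ) S T, F (MvPolynomial.monomial p 1 ⊗ₜ (u • b S)) (B (q, T)) =
        ((u : ℤ) : ℂ) * F (B (p, S)) (B (q, T)) := by
      intro u S T
      rcases Int.units_eq_one_or u with rfl | rfl <;>
        simp [hB, Units.neg_smul, TensorProduct.tmul_neg]
    have hR : ∀ (u : ℤˣ) S T, F (B (p, S)) (MvPolynomial.monomial q 1 ⊗ₜ (u • b T)) =
        ((u : ℤ) : ℂ) * F (B (p, S)) (B (q, T)) := by
      intro u S T
      rcases Int.units_eq_one_or u with rfl | rfl <;>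
        simp [hB, Units.neg_smul, TensorProduct.tmul_neg]
    have hne : ∀ S T, S ≠ T → F (B (p, S)) (B (q, T)) = 0 := fun S T h =>
      hF2 _ _ (by simp [h])
    have e1 : mulOp r k (B (p, S)) = MvPolynomial.monomial p 1 ⊗ₜ wedgeOp ⟨k, hk⟩ (b S) := by
      rw [hB, mulOp_odd r hk]
    have e2 : derOp r k (B (q, T)) = MvPolynomial.monomial q 1 ⊗ₜ contrOp ⟨k, hk⟩ (b T) := by
      rw [hB, derOp_odd r hk]
    rw [e1, e2]
    by_cases hS : ⟨k, hk⟩ ∈ S <;> by_cases hT : ⟨k, hk⟩ ∈ T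
    · obtain ⟨u, -, hu⟩ := hi (T.erase ⟨k, hk⟩) (Finset.notMem_erase _ _)
      rw [Finset.insert_erase hT] at hu
      rw [hw S hS, TensorProduct.tmul_zero, map_zero, LinearMap.zero_apply, hu, hR, hne, mul_zero]
      rintro rfl
      exact Finset.notMem_erase _ _ hS
    · rw [hw S hS, hb2 _ T hT, TensorProduct.tmul_zero, TensorProduct.tmul_zero,
        LinearMap.map_zero, LinearMap.zero_apply, LinearMap.map_zero]
    · by_cases h : T = insert ⟨k, hk⟩ S
      · obtain ⟨u, hu1, hu2⟩ := hi S hS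
        rw [h, hu1, hu2, hL, hR]
        congr 1
        by_cases hpq : p = q
        · rw [hpq, hF1, hF1]
        · rw [hF2 _ _ (by simp [hpq]), hF2 _ _ (by simp [hpq])]
      · obtain ⟨u, hu, -⟩ := hi S hS
        obtain ⟨u', -, hu'⟩ := hi (T.erase ⟨k, hk⟩) (Finset.notMem_erase _ _)
        rw [Finset.insert_erase hT] at hu'
        rw [hu, hu', hL, hR, hne _ _ (Ne.symm h), hne, mul_zero, mul_zero]
        rintro rfl
        exact h (Finset.insert_erase hT).symm
    · obtain ⟨u, hu, -⟩ := hi S hS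
      rw [hu, hb2 _ T hT, hL, hne, mul_zero, TensorProduct.tmul_zero, map_zero]
      rintro rfl
      exact hT (Finset.mem_insert_self _ _)

end Fock

/-! ### Quadratic elements of a Weyl-Clifford superalgebra -/

section Natural

variable {κ : Type} [Fintype κ] [DecidableEq κ] {R : Type} [Ring R] [Algebra ℂ R]

/-- The canonical supercommutation relations for creation operators `m` and annihilation
operators `d` of parities `r`. -/
structure SuperCCR (r : κ → ZMod 2) (m d : κ → R) : Prop where
  mm : ∀ k l, m k * m l = sgn (r k * r l) • (m l * m k)
  dd : ∀ k l, d k * d l = sgn (r k * r l) • (d l * d k)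
  dm : ∀ k l, d k * m l = sgn (r k * r l) • (m l * d k) + if k = l then 1 else 0

theorem superCCR_superSym (r : κ → ZMod 2) : SuperCCR r (mulOp r) (derOp r) :=
  ⟨mulOp_mulOp r, derOp_derOp r, derOp_mulOp r⟩

/-- The quadratic element `∑ A_{kl} m_k d_l`. -/
def quad (m d : κ → R) : Matrix κ κ ℂ →ₗ[ℂ] R where
  toFun A := ∑ k, ∑ l, A k l • (m k * d l)
  map_add' A B := by
    simp only [Matrix.add_apply, add_smul, Finset.sum_add_distrib]
  map_smul' c A := by
    simp only [Matrix.smul_apply, smul_eq_mul, mul_smul, Finset.smul_sum, RingHom.id_apply]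

theorem quad_apply (m d : κ → R) (A : Matrix κ κ ℂ) :
    quad m d A = ∑ k, ∑ l, A k l • (m k * d l) := rfl

variable {r : κ → ZMod 2} {m d : κ → R}

/-- Passing `d p` through `m k * d l` costs the sign of `r p` against `r k + r l`, which equals `a`
wherever `A k l ≠ 0`. The Kronecker delta in `dm` leaves row `p` of `A`. -/
theorem SuperCCR.d_quad (h : SuperCCR r m d) {A : Matrix κ κ ℂ} {a : ZMod 2}
    (hA : A ∈ homPart r a) (p : κ) :
    d p * quad m d A = sgn (a * r p) • (quad m d A * d p) + ∑ l, A p l • d l := by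
  have h1 : ∀ k l, d p * (A k l • (m k * d l)) =
      sgn (a * r p) • (A k l • (m k * d l) * d p) + if p = k then A k l • d l else 0 := by
    intro k l
    rw [mul_smul_comm, ← mul_assoc, h.dm, add_mul, smul_add, smul_mul_assoc, mul_assoc,
      h.dd p l, mul_smul_comm, smul_mul_assoc, smul_smul, smul_smul, smul_smul, mul_assoc]
    congr 1
    · congr 1
      by_cases hkl : r k + r l = a
      · rw [← hkl, add_mul, sgn_add, mul_comm (r k), mul_comm (r l)]
        ring
      · rw [hA k l hkl]
        simp
      · rw [mul_assoc]
    · split_ifs <;> simp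
  rw [quad_apply]
  simp only [Finset.mul_sum, Finset.sum_mul, Finset.smul_sum, h1, Finset.sum_add_distrib]
  congr 1
  rw [Finset.sum_comm]
  simp

theorem SuperCCR.quad_m (h : SuperCCR r m d) {A : Matrix κ κ ℂ} {a : ZMod 2}
    (hA : A ∈ homPart r a) (p : κ) :
    quad m d A * m p = sgn (a * r p) • (m p * quad m d A) + ∑ k, A k p • m k := by
  have h1 : ∀ k l, A k l • (m k * d l) * m p =
      sgn (a * r p) • (m p * A k l • (m k * d l)) + if l = p then A k l • m k else 0 := by
    intro k l
    rw [smul_mul_assoc, mul_assoc, h.dm, mul_add, smul_add, mul_smul_comm, ← mul_assoc,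
      h.mm k p, mul_smul_comm, smul_mul_assoc, smul_smul, smul_smul, smul_smul, mul_assoc]
    congr 1
    · congr 1
      by_cases hkl : r k + r l = a
      · rw [← hkl, add_mul, sgn_add]
        ring
      · rw [hA k l hkl]
        simp
      · rw [mul_assoc]
    · split_ifs <;> simp
  rw [quad_apply]
  simp only [Finset.mul_sum, Finset.sum_mul, Finset.smul_sum, h1, Finset.sum_add_distrib]
  congr 1
  simp

theorem SuperCCR.quad_d (h : SuperCCR r m d) {A : Matrix κ κ ℂ} {a : ZMod 2}
    (hA : A ∈ homPart r a) (p : κ) :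
    quad m d A * d p = sgn (a * r p) • (d p * quad m d A - ∑ l, A p l • d l) := by
  rw [h.d_quad hA, add_sub_cancel_right, smul_smul, sgn_mul_self, one_smul]

/-- Supercommutation with `quad m d A` acts on the creation operators through the columns of `A` and
on the annihilation operators through its rows. Carrying it past each product `m p * d q` produces
exactly the supercommutator of the matrices. -/
theorem SuperCCR.quad_mul (h : SuperCCR r m d) {A B : Matrix κ κ ℂ} {a b : ZMod 2}
    (hA : A ∈ homPart r a) (hB : B ∈ homPart r b) :
    quad m d A * quad m d B =
      sgn (a * b) • (quad m d B * quad m d A) + quad m d (A * B - sgn (a * b) • (B * A)) := by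
  have e1 : quad m d (A * B) = ∑ p, ∑ q, B p q • ((∑ k, A k p • m k) * d q) := by
    simp only [quad_apply, Matrix.mul_apply, Finset.sum_smul, Finset.sum_mul, Finset.smul_sum,
      smul_mul_assoc, smul_smul]
    rw [Finset.sum_comm]
    conv_rhs => rw [Finset.sum_comm]
    refine Finset.sum_congr rfl fun l _ => ?_
    rw [Finset.sum_comm]
    simp only [mul_comm]
  have e2 : quad m d (B * A) = ∑ p, ∑ q, B p q • (m p * ∑ l, A q l • d l) := by
    simp only [quad_apply, Matrix.mul_apply, Finset.sum_smul, Finset.mul_sum, Finset.smul_sum,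
      mul_smul_comm, smul_smul]
    refine Finset.sum_congr rfl fun p _ => ?_
    rw [Finset.sum_comm]
  have e3 : ∀ p q, quad m d A * (B p q • (m p * d q)) =
      sgn (a * b) • (B p q • (m p * d q) * quad m d A) +
        (B p q • ((∑ k, A k p • m k) * d q) -
          sgn (a * b) • (B p q • (m p * ∑ l, A q l • d l))) := by
    intro p q
    rw [mul_smul_comm, ← mul_assoc, h.quad_m hA, add_mul, smul_mul_assoc, mul_assoc,
      h.quad_d hA, mul_smul_comm, smul_smul, mul_sub]
    by_cases hpq : r p + r q = b
    · rw [← hpq, mul_add, sgn_add, smul_mul_assoc, mul_assoc]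
      module
    · rw [hB p q hpq]
      simp
  rw [map_sub, map_smul, e1, e2, quad_apply m d B]
  simp only [Finset.mul_sum, Finset.sum_mul, Finset.smul_sum] at e3 ⊢
  simp only [e3, Finset.sum_add_distrib, Finset.sum_sub_distrib]

/-- This is normal ordering. The diagonal terms of the antinormal sum leave a constant, which is the
source of the shift by α. -/
theorem SuperCCR.sum_m_d_add_sum_d_m (h : SuperCCR r m d) (P Q : κ → κ → ℂ) :
    ∑ x, ∑ y, P x y • (m x * d y) + ∑ x, ∑ y, Q x y • (d y * m x) =
      quad m d (Matrix.of fun x y => P x y + Q x y * sgn (r x * r y)) + (∑ x, Q x x) • 1 := by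
  simp only [h.dm, smul_add, Finset.sum_add_distrib, quad_apply, Matrix.of_apply, add_smul,
    smul_smul]
  rw [← add_assoc]
  congr 1
  · congr 1
    refine Finset.sum_congr rfl fun x _ => Finset.sum_congr rfl fun y _ => ?_
    rw [mul_comm (r y)]
  · rw [Finset.sum_smul]
    refine Finset.sum_congr rfl fun x _ => ?_
    simp

end Natural

section Fock

variable {κ : Type} [Fintype κ] [DecidableEq κ] {r : κ → ZMod 2}

theorem naturalAction_vac (A : Matrix κ κ ℂ) : naturalAction r A (vac r) = 0 := by
  simp only [naturalAction, LinearMap.sum_apply, LinearMap.smul_apply, Module.End.mul_apply,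
    derOp_vac, map_zero, smul_zero, Finset.sum_const_zero]

theorem naturalAction_mem {A : Matrix κ κ ℂ} {a b : ZMod 2} (hA : A ∈ homPart r a)
    {v : SuperSym r} (hv : v ∈ superSymPart r b) :
    naturalAction r A v ∈ superSymPart r (a + b) := by
  rw [naturalAction, LinearMap.sum_apply]
  refine Submodule.sum_mem _ fun k _ => ?_
  rw [LinearMap.sum_apply]
  refine Submodule.sum_mem _ fun l _ => ?_
  rw [LinearMap.smul_apply, Module.End.mul_apply]
  by_cases hkl : r k + r l = a
  · refine Submodule.smul_mem _ _ ?_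
    rw [← hkl, add_assoc]
    exact mulOp_mem r k (derOp_mem r l hv)
  · rw [hA k l hkl, zero_smul]
    exact Submodule.zero_mem _

/-- As creation and annihilation operators are mutually adjoint, the adjoint of ∑ A_{kl} m_k d_l is
given by the conjugate transpose, without any parity signs. -/
theorem form_naturalAction {F : SuperSym r →ₗ⋆[ℂ] SuperSym r →ₗ[ℂ] ℂ}
    (h1 : ∀ v w, F w v = starRingEnd ℂ (F v w))
    (h2 : ∀ k v w, F (mulOp r k v) w = F v (derOp r k w)) (A : Matrix κ κ ℂ) (v w : SuperSym r) :
    F (naturalAction r A v) w = F v (naturalAction r A.conjTranspose w) := by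
  have h3 : ∀ k v w, F (derOp r k v) w = F v (mulOp r k w) := by
    intro k v w
    rw [h1, ← h2, ← h1]
  simp only [naturalAction, LinearMap.sum_apply, LinearMap.smul_apply, Module.End.mul_apply,
    map_sum, map_smul, LinearMap.map_smulₛₗ, h2, h3]
  rw [Finset.sum_comm]
  rfl

end Fock

/-! ### Coordinates on `spo(2n|1)` -/

/-- The involution `i ↦ i'` of the basis of `V` with `B(u_i, u_j) ≠ 0` iff `j = i'`. -/
def bar {n : ℕ} : IdxV n → IdxV n := Sum.map Fin.rev id

/-- The value of `B(u_i, u_{i'})`. -/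
def bsgn {n : ℕ} : IdxV n → ℂ := Sum.elim (fun i => if (i : ℕ) < n then 1 else -1) (fun _ => 1)

@[simp] theorem bar_bar {n : ℕ} (i : IdxV n) : bar (bar i) = i := by
  rcases i with i | i <;> simp [bar]

theorem bar_involutive (n : ℕ) : Function.Involutive (bar : IdxV n → IdxV n) := bar_bar

@[simp] theorem parV_bar {n : ℕ} (i : IdxV n) : parV n (bar i) = parV n i := by
  rcases i with i | i <;> rfl

theorem bsgn_mul_self {n : ℕ} (i : IdxV n) : bsgn i * bsgn i = 1 := by
  rcases i with i | i
  · simp only [bsgn, Sum.elim_inl]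
    split_ifs <;> norm_num
  · simp [bsgn]

/-- This records that B is skew on the even part of V and symmetric on the odd part. -/
theorem bsgn_bar {n : ℕ} (i : IdxV n) : bsgn (bar i) = -sgn (parV n i) * bsgn i := by
  rcases i with i | i
  · simp only [bsgn, bar, Sum.map_inl, Sum.elim_inl, parV, sgn_zero, Fin.val_rev]
    have := i.2
    by_cases h : (i : ℕ) < n
    · rw [if_pos h, if_neg (by omega)]
      norm_num
    · rw [if_neg h, if_pos (by omega)]
      norm_num
  · simp [bsgn, bar, parV, sgn_one]

theorem formV_apply {n : ℕ} (i j : IdxV n) : formV n i j = if j = bar i then bsgn i else 0 := by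
  rcases i with i | i <;> rcases j with j | j <;> simp [formV, bar, bsgn]

/-- The sign relating the two entries of an element of `spo(2n|1)`. -/
def tsgn {n : ℕ} (i j : IdxV n) : ℂ :=
  bsgn (bar i) * bsgn (bar j) * sgn (parV n i + parV n i * parV n j)

/-- The form pairs each basis vector with a single other one, so invariance links the entry (i, j)
only with (j', i'). The parity of an entry can be read off its indices, which merges the conditions
for even and odd matrices into one. -/
theorem mem_spo_iff {n : ℕ} (X : Matrix (IdxV n) (IdxV n) ℂ) :
    X ∈ (spo n).toSubmodule ↔ ∀ i j, X i j = -(tsgn i j * X (bar j) (bar i)) := by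
  have key : ∀ a (Y : Matrix (IdxV n) (IdxV n) ℂ), PreservesForm (parV n) (formV n) a Y ↔
      ∀ i j, Y (bar j) (bar i) * bsgn (bar j) +
        sgn (a * parV n i) * (bsgn (bar i) * Y i j) = 0 := by
    intro a Y
    -- At the entry (i', j) each of the two matrix products has a single nonzero term.
    have h : ∀ i j, (Y.transpose * formV n + Matrix.diagonal (fun i => sgn (a * parV n i)) *
        (formV n * Y)) (bar i) j = Y (bar j) (bar i) * bsgn (bar j) +
        sgn (a * parV n i) * (bsgn (bar i) * Y i j) := by
      intro i j
      rw [Matrix.add_apply, Matrix.diagonal_mul, Matrix.mul_apply, Matrix.mul_apply, parV_bar]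
      congr 1
      · rw [Finset.sum_eq_single (bar j)]
        · simp [formV_apply]
        · intro k _ hk
          rw [formV_apply, if_neg, mul_zero]
          rintro rfl
          simp at hk
        · simp
      · rw [Finset.sum_eq_single i]
        · simp [formV_apply]
        · intro k _ hk
          rw [formV_apply, if_neg, zero_mul]
          simpa using hk
        · simp
    unfold PreservesForm
    constructor
    · intro e i j
      rw [← h, e]
      rfl
    · intro e
      ext i j
      rw [← bar_bar i, h, e]
      rfl
  change (∀ a, PreservesForm _ _ a (parityComp (parV n) a X)) ↔ _
  simp only [key]
  constructor
  · intro h i j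
    have h1 := h (parV n i + parV n j) i j
    simp only [parityComp, LinearMap.coe_mk, AddHom.coe_mk, Matrix.of_apply, parV_bar,
      if_pos, add_comm (parV n j)] at h1
    rw [tsgn]
    have e : (parV n i + parV n j) * parV n i = parV n i + parV n i * parV n j := by
      generalize parV n i = x
      generalize parV n j = y
      revert x y
      decide
    rw [e] at h1
    have b1 := bsgn_mul_self (bar i)
    have b2 := sgn_mul_self (parV n i + parV n i * parV n j)
    linear_combination (sgn (parV n i + parV n i * parV n j) * bsgn (bar i)) * h1 -
      X i j * b1 - X i j * (bsgn (bar i)) ^ 2 * b2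
  · intro h a i j
    simp only [parityComp, LinearMap.coe_mk, AddHom.coe_mk, Matrix.of_apply, parV_bar,
      add_comm (parV n j)]
    split_ifs with ha
    · rw [h i j, tsgn, ← ha]
      have e : (parV n i + parV n j) * parV n i = parV n i + parV n i * parV n j := by
        generalize parV n i = x
        generalize parV n j = y
        revert x y
        decide
      rw [e]
      have b1 := bsgn_mul_self (bar i)
      have b2 := sgn_mul_self (parV n i + parV n i * parV n j)
      linear_combination (-X (bar j) (bar i) * bsgn (bar j)) * b2 -
        (X (bar j) (bar i) * bsgn (bar j)) * (sgn (parV n i + parV n i * parV n j)) ^ 2 * b1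
    · simp

/-! ### The oscillator representation in terms of creation and annihilation operators -/

/-- The action of `gl(V)` on `E = V ⊗ X'`. -/
def onE (n : ℕ) : Matrix (IdxV n) (IdxV n) ℂ →ₗ[ℂ] Matrix (IdxE n) (IdxE n) ℂ where
  toFun X := Matrix.of fun e f => if e.2 = f.2 then X e.1 f.1 else 0
  map_add' X Y := by
    ext e f
    simp only [Matrix.of_apply, Matrix.add_apply]
    split_ifs <;> simp
  map_smul' c X := by
    ext e f
    simp only [Matrix.of_apply, Matrix.smul_apply, RingHom.id_apply]
    split_ifs <;> simp

/-- The action of `gl(X')` on `E = V ⊗ X'`. -/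
def onE' (n : ℕ) : Matrix (Fin 2) (Fin 2) ℂ →ₗ[ℂ] Matrix (IdxE n) (IdxE n) ℂ where
  toFun A := Matrix.of fun e f =>
    if e.1 = f.1 then sgn ((parX e.2 + parX f.2) * parV n f.1) * A e.2 f.2 else 0
  map_add' X Y := by
    ext e f
    simp only [Matrix.of_apply, Matrix.add_apply]
    split_ifs <;> simp [mul_add]
  map_smul' c X := by
    ext e f
    simp only [Matrix.of_apply, Matrix.smul_apply, RingHom.id_apply]
    split_ifs <;> simp [mul_left_comm]

theorem onE_apply {n : ℕ} (X : Matrix (IdxV n) (IdxV n) ℂ) (e f : IdxE n) :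
    onE n X e f = if e.2 = f.2 then X e.1 f.1 else 0 := rfl

theorem onE'_apply {n : ℕ} (A : Matrix (Fin 2) (Fin 2) ℂ) (e f : IdxE n) :
    onE' n A e f = if e.1 = f.1 then sgn ((parX e.2 + parX f.2) * parV n f.1) * A e.2 f.2 else 0 :=
  rfl

theorem glVAction_eq (n : ℕ) (X : Matrix (IdxV n) (IdxV n) ℂ) :
    glVAction n X = quad (mulOp (parE n)) (derOp (parE n)) (onE n X) := rfl

/-- The involution on the basis of `E` induced by the form on `V`. -/
def barE {n : ℕ} (x : IdxE n) : IdxE n := (bar x.1, x.2)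

@[simp] theorem barE_barE {n : ℕ} (x : IdxE n) : barE (barE x) = x := by simp [barE]

theorem barE_involutive (n : ℕ) : Function.Involutive (barE : IdxE n → IdxE n) := barE_barE

/-- The coefficient of the annihilation operators in `ι(v ⊗ y)`, `y ∈ Y'`. -/
def nuE {n : ℕ} (x : IdxE n) : ℂ := sgn (parX x.2 * parV n x.1) * bsgn x.1 * sgn (parX x.2)

/-- The coefficient of `formEt`. -/
def gammaE {n : ℕ} : IdxEt n → ℂ
  | (i, Sum.inl a) => sgn (parX a * parV n i) * bsgn i
  | (i, Sum.inr a) => nuE (i, a)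

/-- The involution on the basis of `V ⊗ V'` induced by the form. -/
def barEt {n : ℕ} (e : IdxEt n) : IdxEt n := (bar e.1, e.2.swap)

theorem barEt_involutive (n : ℕ) : Function.Involutive (barEt : IdxEt n → IdxEt n) := by
  intro e
  simp [barEt]

theorem formEt_apply {n : ℕ} (e f : IdxEt n) :
    formEt n e f = if f = barEt e then gammaE e else 0 := by
  obtain ⟨i, c⟩ := e
  obtain ⟨j, c'⟩ := f
  simp only [formEt, Matrix.of_apply, formV_apply, barEt, Prod.mk.injEq]
  by_cases h : j = bar i
  · subst h
    rcases c with c | c <;> rcases c' with c' | c' <;> fin_cases c <;> fin_cases c' <;>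
      simp [formV', gammaE, nuE, parV', parX, sgn_zero, sgn_one]
  · simp [h]

theorem nuE_mul_self {n : ℕ} (x : IdxE n) : nuE x * nuE x = 1 := by
  have h1 := sgn_mul_self (parX x.2 * parV n x.1)
  have h2 := bsgn_mul_self x.1
  have h3 := sgn_mul_self (parX x.2)
  unfold nuE
  calc _ = (sgn (parX x.2 * parV n x.1) * sgn (parX x.2 * parV n x.1)) *
        (bsgn x.1 * bsgn x.1) * (sgn (parX x.2) * sgn (parX x.2)) := by ring
    _ = 1 := by rw [h1, h2, h3]; norm_num

theorem iotaOp_inr {n : ℕ} (x : IdxE n) :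
    iotaOp n (x.1, Sum.inr x.2) = nuE x • derOp (parE n) (barE x) := by
  rw [iotaOp, Finset.sum_eq_single (barE x)]
  · have h : (((barE x).1, Sum.inl (barE x).2) : IdxEt n) = barEt (x.1, Sum.inr x.2) := rfl
    rw [formEt_apply, if_pos h]
    rfl
  · intro e _ he
    rw [formEt_apply, if_neg, zero_smul]
    rintro h
    apply he
    rw [Prod.ext_iff] at h
    exact Prod.ext h.1 (Sum.inl_injective h.2)
  · simp

/-- The matrix `formEt n` is a signed permutation matrix, so its inverse is its transpose, and the
dual basis is the original basis moved by `barEt` with the signs `gammaE`. -/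
theorem omega_eq {n : ℕ} (T : Matrix (IdxEt n) (IdxEt n) ℂ) :
    omega n T = (1 / 2 : ℂ) • ∑ e, ∑ f, T e f • (gammaE (barEt f) •
      (iotaOp n e * iotaOp n (barEt f))) := by
  have hinv : (formEt n)⁻¹ = (formEt n).transpose :=
    Matrix.inv_eq_right_inv (formEt_mul_transpose n)
  rw [omega, hinv]
  congr 1
  refine Finset.sum_congr rfl fun e _ => ?_
  rw [← Equiv.sum_comp (barEt_involutive n).toPerm]
  refine Finset.sum_congr rfl fun f _ => ?_
  rw [smul_smul, Matrix.mul_apply, Finset.sum_eq_single f]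
  · rw [Matrix.transpose_apply, formEt_apply, if_pos]
    · rfl
    · exact (barEt_involutive n f).symm
  · intro g _ hg
    rw [Matrix.transpose_apply, formEt_apply, if_neg, mul_zero]
    rintro h
    exact hg (h.trans (barEt_involutive n f))
  · simp

/-- The coefficient of the creation operators in the dual basis of `V ⊗ Y'`. -/
def muE {n : ℕ} (x : IdxE n) : ℂ := sgn (parX x.2 * parV n x.1) * bsgn (bar x.1)

theorem sum_idxEt {n : ℕ} {M : Type} [AddCommMonoid M] (g : IdxEt n → M) :
    ∑ e, g e = (∑ x : IdxE n, g (x.1, Sum.inl x.2)) + ∑ x : IdxE n, g (x.1, Sum.inr x.2) := by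
  simp only [Fintype.sum_prod_type, Fintype.sum_sum_type, Finset.sum_add_distrib]

theorem dual_iotaOp_inl {n : ℕ} (y : IdxE n) :
    gammaE (barEt (y.1, Sum.inl y.2)) • iotaOp n (barEt (y.1, Sum.inl y.2)) =
      derOp (parE n) y := by
  have h : iotaOp n (barEt (y.1, Sum.inl y.2)) = nuE (barE y) • derOp (parE n) (barE (barE y)) :=
    iotaOp_inr (barE y)
  have h2 : gammaE (barEt (y.1, Sum.inl y.2)) = nuE (barE y) := rfl
  rw [h, h2, smul_smul, nuE_mul_self, one_smul, barE_barE]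

theorem dual_iotaOp_inr {n : ℕ} (y : IdxE n) :
    gammaE (barEt (y.1, Sum.inr y.2)) • iotaOp n (barEt (y.1, Sum.inr y.2)) =
      muE y • mulOp (parE n) (barE y) := by
  have h2 : gammaE (barEt (y.1, Sum.inr y.2)) =
    sgn (parX y.2 * parV n (bar y.1)) * bsgn (bar y.1) := rfl
  rw [h2, parV_bar]
  rfl

/-- The oscillator representation on matrices which are block diagonal for `V' = X' ⊕ Y'`. -/
theorem omega_blockDiag {n : ℕ} (T : Matrix (IdxEt n) (IdxEt n) ℂ)
    (h12 : ∀ x y : IdxE n, T (x.1, Sum.inl x.2) (y.1, Sum.inr y.2) = 0)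
    (h21 : ∀ x y : IdxE n, T (x.1, Sum.inr x.2) (y.1, Sum.inl y.2) = 0) :
    omega n T = quad (mulOp (parE n)) (derOp (parE n)) ((1 / 2 : ℂ) • Matrix.of fun x y : IdxE n =>
        T (x.1, Sum.inl x.2) (y.1, Sum.inl y.2) +
          T (bar y.1, Sum.inr y.2) (bar x.1, Sum.inr x.2) * (nuE (barE y) * muE (barE x)) *
            sgn (parE n x * parE n y)) +
      ((1 / 2 : ℂ) * ∑ x : IdxE n, T (bar x.1, Sum.inr x.2) (bar x.1, Sum.inr x.2) *
        (nuE (barE x) * muE (barE x))) • 1 := by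
  rw [omega_eq, map_smul, mul_smul, ← smul_add]
  congr 1
  simp only [sum_idxEt, h12, h21, zero_smul, Finset.sum_const_zero, add_zero, zero_add]
  have e1 : ∀ x y : IdxE n, gammaE (barEt (y.1, Sum.inl y.2)) • (iotaOp n (x.1, Sum.inl x.2) *
      iotaOp n (barEt (y.1, Sum.inl y.2))) = mulOp (parE n) x * derOp (parE n) y := by
    intro x y
    rw [← mul_smul_comm, dual_iotaOp_inl]
    rfl
  have e2 : ∀ x y : IdxE n, gammaE (barEt (y.1, Sum.inr y.2)) • (iotaOp n (x.1, Sum.inr x.2) *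
      iotaOp n (barEt (y.1, Sum.inr y.2))) =
      (nuE x * muE y) • (derOp (parE n) (barE x) * mulOp (parE n) (barE y)) := by
    intro x y
    rw [← mul_smul_comm, dual_iotaOp_inr, iotaOp_inr, mul_smul_comm, smul_mul_assoc, smul_smul,
      mul_comm (nuE x)]
  simp only [e1, e2]
  -- Exchanging the two summation indices and applying `barE` to both turns the `Y'` block into a
  -- sum of products `d y * m x`, ready for normal ordering.
  have e3 : ∑ x : IdxE n, ∑ y : IdxE n, T (x.1, Sum.inr x.2) (y.1, Sum.inr y.2) •
      ((nuE x * muE y) • (derOp (parE n) (barE x) * mulOp (parE n) (barE y))) =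
      ∑ x : IdxE n, ∑ y : IdxE n, (T (bar y.1, Sum.inr y.2) (bar x.1, Sum.inr x.2) *
        (nuE (barE y) * muE (barE x))) • (derOp (parE n) y * mulOp (parE n) x) := by
    rw [Finset.sum_comm, ← Equiv.sum_comp (barE_involutive n).toPerm]
    refine Finset.sum_congr rfl fun x _ => ?_
    rw [← Equiv.sum_comp (barE_involutive n).toPerm]
    refine Finset.sum_congr rfl fun y _ => ?_
    simp only [Function.Involutive.coe_toPerm, barE_barE, smul_smul]
    rfl
  rw [e3]
  exact (superCCR_superSym (parE n)).sum_m_d_add_sum_d_m _ _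

theorem nuE_mul_muE_self {n : ℕ} (x : IdxE n) :
    nuE (barE x) * muE (barE x) = -sgn (parE n x) := by
  have h1 := sgn_mul_self (parX x.2 * parV n x.1)
  have h2 := bsgn_mul_self x.1
  simp only [nuE, muE, barE, bar_bar, parV_bar, bsgn_bar, parE, sgn_add]
  linear_combination (-sgn (parX x.2) * sgn (parV n x.1) * bsgn x.1 ^ 2) * h1 -
    (sgn (parX x.2) * sgn (parV n x.1)) * h2

/-- X' has superdimension 0, so an operator coming from V has supertrace 0 on V ⊗ X'. -/
theorem sum_sgn_parE {n : ℕ} (g : IdxV n → ℂ) :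
    ∑ x : IdxE n, g x.1 * sgn (parE n x) = 0 := by
  simp [Fintype.sum_prod_type, Fin.sum_univ_two, parE, parX, sgn_add, sgn_zero, sgn_one]

/-- Invariance of B makes the `Y'` block contribute the same quadratic element as the `X'` block,
which absorbs the factor 1/2. The constant is a supertrace over V ⊗ X' and vanishes. -/
theorem spoAction_eq {n : ℕ} {X : Matrix (IdxV n) (IdxV n) ℂ} (hX : X ∈ (spo n).toSubmodule) :
    spoAction n X = glVAction n X := by
  rw [spoAction, omega_blockDiag, glVAction_eq]
  · have hc : ∑ x : IdxE n, actV n X (bar x.1, Sum.inr x.2) (bar x.1, Sum.inr x.2) *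
        (nuE (barE x) * muE (barE x)) = 0 := by
      simp only [actV, Matrix.of_apply, if_true, nuE_mul_muE_self, mul_neg, Finset.sum_neg_distrib]
      rw [sum_sgn_parE fun i => X (bar i) (bar i), neg_zero]
    rw [hc, mul_zero, zero_smul, add_zero]
    · congr 1
      ext x y
      rw [Matrix.smul_apply, Matrix.of_apply, onE_apply]
      simp only [actV, Matrix.of_apply, Sum.inl.injEq, Sum.inr.injEq, eq_comm (a := y.2)]
      split_ifs with h
      · rw [(mem_spo_iff X).1 hX x.1 y.1]
        obtain ⟨i, a⟩ := x
        obtain ⟨j, b⟩ := y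
        dsimp only at h ⊢
        subst h
        have key : nuE (barE (j, a)) * muE (barE (i, a)) * sgn (parE n (i, a) * parE n (j, a)) =
            -tsgn i j := by
          simp only [nuE, muE, barE, tsgn, bar_bar, parV_bar, bsgn_bar, parE, mul_add, add_mul,
            sgn_add]
          rcases zmod2_cases (parV n i) with hi | hi <;> rcases zmod2_cases (parV n j) with hj | hj
            <;> rcases zmod2_cases (parX a) with ha | ha <;>
            simp [hi, hj, ha, sgn_zero, sgn_one, mul_comm]
        rw [smul_eq_mul, mul_assoc (X (bar j) (bar i)), key]
        ring
      · simp
  · intro x y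
    simp [actV]
  · intro x y
    simp [actV]

/-! ### Relations between the actions -/

theorem onE_mem {n : ℕ} {X : Matrix (IdxV n) (IdxV n) ℂ} {a : ZMod 2}
    (hX : X ∈ homPart (parV n) a) : onE n X ∈ homPart (parE n) a := by
  intro x y h
  rw [onE_apply]
  split_ifs with hxy
  · refine hX _ _ fun e => h ?_
    rw [← e, parE, parE, hxy, add_add_add_comm, CharTwo.add_self_eq_zero, add_zero]
  · rfl

theorem onE'_mem {n : ℕ} {A : Matrix (Fin 2) (Fin 2) ℂ} {a : ZMod 2}
    (hA : A ∈ homPart parX a) : onE' n A ∈ homPart (parE n) a := by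
  intro x y h
  rw [onE'_apply]
  split_ifs with hxy
  · rw [hA, mul_zero]
    refine fun e => h ?_
    rw [← e, parE, parE, hxy, add_add_add_comm, CharTwo.add_self_eq_zero, zero_add]
  · rfl

theorem onE_mul {n : ℕ} (X Y : Matrix (IdxV n) (IdxV n) ℂ) :
    onE n X * onE n Y = onE n (X * Y) := by
  ext x y
  simp only [Matrix.mul_apply, onE_apply, Fintype.sum_prod_type]
  split_ifs with h
  · refine Finset.sum_congr rfl fun i _ => ?_
    rw [Finset.sum_eq_single x.2] <;> simp +contextual [h, eq_comm]
  · refine Finset.sum_eq_zero fun i _ => Finset.sum_eq_zero fun c _ => ?_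
    by_cases hc : c = y.2
    · rw [if_neg (fun e => h (e.trans hc)), zero_mul]
    · rw [if_neg hc, mul_zero]

theorem onE'_mul {n : ℕ} (A B : Matrix (Fin 2) (Fin 2) ℂ) :
    onE' n A * onE' n B = onE' n (A * B) := by
  ext ⟨i, a⟩ ⟨j, b⟩
  simp only [Matrix.mul_apply, onE'_apply, Fintype.sum_prod_type]
  rw [Finset.sum_eq_single i]
  · by_cases h : i = j
    · subst h
      simp only [if_true]
      rw [Finset.mul_sum]
      refine Finset.sum_congr rfl fun c _ => ?_
      have : sgn ((parX a + parX b) * parV n i) =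
          sgn ((parX a + parX c) * parV n i) * sgn ((parX c + parX b) * parV n i) := by
        rw [← sgn_add]
        congr 1
        generalize parX a = x
        generalize parX b = y
        generalize parX c = z
        generalize parV n i = w
        revert x y z w
        decide
      rw [this]
      ring
    · simp [h]
  · intro k _ hk
    simp [Ne.symm hk]
  · simp

/-- The Koszul sign in `onE'`, paid for moving A past a vector of V, is what makes the two actions
supercommute. -/
theorem onE_mul_onE' {n : ℕ} {X : Matrix (IdxV n) (IdxV n) ℂ} {A : Matrix (Fin 2) (Fin 2) ℂ}
    {x a : ZMod 2} (hX : X ∈ homPart (parV n) x) (hA : A ∈ homPart parX a) :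
    onE n X * onE' n A = sgn (x * a) • (onE' n A * onE n X) := by
  ext ⟨i, c⟩ ⟨j, d⟩
  have h1 : (onE n X * onE' n A) (i, c) (j, d) = sgn ((parX c + parX d) * parV n j) *
      (X i j * A c d) := by
    simp only [Matrix.mul_apply, onE_apply, onE'_apply, Fintype.sum_prod_type]
    rw [Finset.sum_eq_single j, Finset.sum_eq_single c]
    · simp
      ring
    · intro k _ hk
      simp [Ne.symm hk]
    · simp
    · intro k _ hk
      simp [hk]
    · simp
  have h2 : (onE' n A * onE n X) (i, c) (j, d) = sgn ((parX c + parX d) * parV n i) *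
      (X i j * A c d) := by
    simp only [Matrix.mul_apply, onE_apply, onE'_apply, Fintype.sum_prod_type]
    rw [Finset.sum_eq_single i, Finset.sum_eq_single d]
    · simp
      ring
    · intro k _ hk
      simp [hk]
    · simp
    · intro k _ hk
      simp [Ne.symm hk]
    · simp
  rw [Matrix.smul_apply, h1, h2, smul_eq_mul]
  by_cases e1 : parV n i + parV n j = x
  · by_cases e2 : parX c + parX d = a
    · rw [← e1, e2, add_mul, sgn_add, mul_comm (parV n i), mul_comm (parV n j)]
      linear_combination (-sgn (a * parV n j) * (X i j * A c d)) * sgn_mul_self (a * parV n i)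
    · simp [hA _ _ e2]
  · simp [hX _ _ e1]

theorem onE_conjTranspose {n : ℕ} (X : Matrix (IdxV n) (IdxV n) ℂ) :
    (onE n X).conjTranspose = onE n X.conjTranspose := by
  ext x y
  simp only [Matrix.conjTranspose_apply, onE_apply, eq_comm (a := y.2)]
  split_ifs <;> simp

theorem star_sgn (a : ZMod 2) : star (sgn a) = sgn a := by
  unfold sgn
  split_ifs <;> simp

theorem onE'_conjTranspose {n : ℕ} (A : Matrix (Fin 2) (Fin 2) ℂ) :
    (onE' n A).conjTranspose = onE' n A.conjTranspose := by
  ext x y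
  simp only [Matrix.conjTranspose_apply, onE'_apply, eq_comm (a := y.1)]
  split_ifs with h
  · rw [star_mul', star_sgn, h, add_comm]
  · simp

/-- The action of `gl(X')` on `S(E)` by superderivations. -/
def glXAction (n : ℕ) (A : Matrix (Fin 2) (Fin 2) ℂ) : Module.End ℂ (SE n) :=
  quad (mulOp (parE n)) (derOp (parE n)) (onE' n A)

theorem glVAction_mul {n : ℕ} {X Y : Matrix (IdxV n) (IdxV n) ℂ} {x y : ZMod 2}
    (hX : X ∈ homPart (parV n) x) (hY : Y ∈ homPart (parV n) y) :
    glVAction n X * glVAction n Y = sgn (x * y) • (glVAction n Y * glVAction n X) +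
      glVAction n (X * Y - sgn (x * y) • (Y * X)) := by
  simp only [glVAction_eq]
  rw [(superCCR_superSym (parE n)).quad_mul (onE_mem hX) (onE_mem hY), onE_mul, onE_mul,
    map_sub (onE n), map_smul (onE n)]

theorem glXAction_mul {n : ℕ} {A B : Matrix (Fin 2) (Fin 2) ℂ} {a b : ZMod 2}
    (hA : A ∈ homPart parX a) (hB : B ∈ homPart parX b) :
    glXAction n A * glXAction n B = sgn (a * b) • (glXAction n B * glXAction n A) +
      glXAction n (A * B - sgn (a * b) • (B * A)) := by
  simp only [glXAction]
  rw [(superCCR_superSym (parE n)).quad_mul (onE'_mem hA) (onE'_mem hB), onE'_mul, onE'_mul,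
    map_sub (onE' n), map_smul (onE' n)]

theorem glVAction_mul_glXAction {n : ℕ} {X : Matrix (IdxV n) (IdxV n) ℂ}
    {A : Matrix (Fin 2) (Fin 2) ℂ} {x a : ZMod 2} (hX : X ∈ homPart (parV n) x)
    (hA : A ∈ homPart parX a) :
    glVAction n X * glXAction n A = sgn (x * a) • (glXAction n A * glVAction n X) := by
  simp only [glVAction_eq, glXAction]
  rw [(superCCR_superSym (parE n)).quad_mul (onE_mem hX) (onE'_mem hA), onE_mul_onE' hX hA,
    sub_self, map_zero, add_zero]

/-- The constant left by normal ordering is half the superdimension 2n - 1 of V times the supertrace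
of A. -/
theorem gl11Action_eq {n : ℕ} (A : Matrix (Fin 2) (Fin 2) ℂ) :
    gl11Action n A = glXAction n A + (alpha n * (A 0 0 - A 1 1)) • 1 := by
  rw [gl11Action, omega_blockDiag, glXAction]
  · congr 1
    · congr 1
      ext ⟨i, a⟩ ⟨j, b⟩
      rw [Matrix.smul_apply, Matrix.of_apply, onE'_apply]
      simp only [actV', Matrix.of_apply, (bar_involutive n).injective.eq_iff, eq_comm (a := j)]
      split_ifs with h
      · subst h
        have key : sgn ((parX b + parX a) * parV n i) * glToOsp A (Sum.inr b) (Sum.inr a) *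
            (nuE (barE (i, b)) * muE (barE (i, a))) * sgn (parE n (i, a) * parE n (i, b)) =
            sgn ((parX a + parX b) * parV n i) * A a b := by
          have hb := bsgn_mul_self i
          simp only [nuE, muE, barE, bar_bar, parV_bar, bsgn_bar, parE, mul_add, add_mul, sgn_add]
          rcases zmod2_cases (parV n i) with hi | hi <;> fin_cases a <;> fin_cases b <;>
            simp [hi, parX, sgn_zero, sgn_one, glToOsp, hb]
        simp only [parV', Sum.elim_inl, Sum.elim_inr, parV_bar] at key ⊢
        rw [key, smul_eq_mul]
        simp only [glToOsp, LinearMap.coe_mk, AddHom.coe_mk, Matrix.fromBlocks_apply₁₁]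
        ring
      · simp
    · congr 1
      have h2 : ∀ x : ZMod 2, (x + x) = 0 := by decide
      simp only [actV', Matrix.of_apply, if_true, nuE_mul_muE_self, h2, zero_mul, sgn_zero,
        one_mul, Fintype.sum_prod_type, Fin.sum_univ_two, parE, sgn_add, glToOsp,
        LinearMap.coe_mk, AddHom.coe_mk, Matrix.fromBlocks_apply₂₂]
      simp [parX, parV, sgn_zero, sgn_one, alpha]
      ring
  · intro x y
    simp [actV', glToOsp]
  · intro x y
    simp [actV', glToOsp]

/-! ### Harmonic tensors -/

/-- The operators spanning the action of `n'⁺`. -/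
def lapOp (n : ℕ) (a b : Fin 2) : Module.End ℂ (SE n) :=
  ∑ i : IdxV n, (sgn (parX a * parV n i) * bsgn i) •
    (derOp (parE n) (bar i, b) * derOp (parE n) (i, a))

/-- An element of n'⁺ only has the block from X' to Y'. Both factors in each term of `omega` are
then annihilation operators, and collecting them by their indices in X' gives the `lapOp n a b`. -/
theorem mem_harmonicTensors {n : ℕ} {v : SE n} (h : ∀ a b, lapOp n a b v = 0) :
    v ∈ harmonicTensors n := by
  rw [harmonicTensors, Submodule.mem_iInf]
  intro T
  rw [Submodule.mem_iInf]
  rintro ⟨-, h11, h12, h22⟩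
  rw [LinearMap.mem_ker]
  have z11 : ∀ a b, T (Sum.inl a) (Sum.inl b) = 0 := fun a b => congrFun (congrFun h11 a) b
  have z12 : ∀ a b, T (Sum.inl a) (Sum.inr b) = 0 := fun a b => congrFun (congrFun h12 a) b
  have z22 : ∀ a b, T (Sum.inr a) (Sum.inr b) = 0 := fun a b => congrFun (congrFun h22 a) b
  have key : omega n (actV' n T) = (1 / 2 : ℂ) • ∑ a, ∑ b,
      (T (Sum.inr b) (Sum.inl a) * sgn (parX b)) • lapOp n a b := by
    rw [omega_eq]
    congr 1
    have e1 : ∀ x y : IdxE n, gammaE (barEt (y.1, Sum.inl y.2)) •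
        (iotaOp n (x.1, Sum.inr x.2) * iotaOp n (barEt (y.1, Sum.inl y.2))) =
        nuE x • (derOp (parE n) (barE x) * derOp (parE n) y) := by
      intro x y
      rw [← mul_smul_comm, dual_iotaOp_inl, iotaOp_inr, smul_mul_assoc]
    simp only [sum_idxEt, e1]
    simp only [actV', Matrix.of_apply, z11, z12, z22, mul_zero, ite_self, zero_smul,
      Finset.sum_const_zero, zero_add, add_zero]
    simp only [Fintype.sum_prod_type, lapOp, Finset.smul_sum, smul_smul]
    have e2 : ∀ (i : IdxV n) (b : Fin 2), (∑ j : IdxV n, ∑ a : Fin 2, ((if i = j then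
        sgn ((parV' (Sum.inr b) + parV' (Sum.inl a)) * parV n j) * T (Sum.inr b) (Sum.inl a)
        else 0) * nuE (i, b)) • (derOp (parE n) (barE (i, b)) * derOp (parE n) (j, a))) =
        ∑ a : Fin 2, (T (Sum.inr b) (Sum.inl a) * sgn (parX b) *
          (sgn (parX a * parV n i) * bsgn i)) •
          (derOp (parE n) (bar i, b) * derOp (parE n) (i, a)) := by
      intro i b
      rw [Finset.sum_eq_single i]
      · refine Finset.sum_congr rfl fun a _ => ?_
        rw [if_pos rfl]
        congr 1
        have h1 := sgn_mul_self (parX b * parV n i)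
        simp only [parV', Sum.elim_inl, Sum.elim_inr, nuE, add_mul, sgn_add]
        linear_combination (T (Sum.inr b) (Sum.inl a) * sgn (parX b) *
          (sgn (parX a * parV n i) * bsgn i)) * h1
      · intro j _ hj
        simp [Ne.symm hj]
      · simp
    simp only [e2]
    rw [Finset.sum_comm]
    conv_rhs => rw [Finset.sum_comm]
    refine Finset.sum_congr rfl fun b _ => ?_
    rw [Finset.sum_comm]
  rw [key, LinearMap.smul_apply, LinearMap.sum_apply]
  simp [h]

/-! ### Commutation of the Laplacians with gl(X') and spo(V). -/

theorem SuperCCR.d_d_quad {κ R : Type} [Fintype κ] [DecidableEq κ] [Ring R] [Algebra ℂ R]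
    {r : κ → ZMod 2} {m d : κ → R} (h : SuperCCR r m d) {A : Matrix κ κ ℂ} {a : ZMod 2}
    (hA : A ∈ homPart r a) (p q : κ) :
    d p * d q * quad m d A = sgn (a * (r p + r q)) • (quad m d A * (d p * d q)) +
      (∑ l, (sgn (a * r q) * A p l) • (d l * d q) + ∑ l, A q l • (d p * d l)) := by
  rw [mul_assoc, h.d_quad hA, mul_add, mul_smul_comm, ← mul_assoc, h.d_quad hA, add_mul,
    smul_mul_assoc, smul_add, smul_smul, mul_add a, sgn_add, mul_comm (sgn (a * r p)), mul_assoc,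
    Finset.mul_sum, Finset.sum_mul, Finset.smul_sum, add_assoc]
  simp only [smul_mul_assoc, mul_smul_comm, smul_smul]

theorem sum_onE'_smul {n : ℕ} {M : Type} [AddCommMonoid M] [Module ℂ M]
    (A : Matrix (Fin 2) (Fin 2) ℂ) (i : IdxV n) (a : Fin 2) (g : IdxE n → M) :
    ∑ l, onE' n A (i, a) l • g l =
      ∑ c, (sgn ((parX a + parX c) * parV n i) * A a c) • g (i, c) := by
  rw [Fintype.sum_prod_type, Finset.sum_eq_single i]
  · simp [onE'_apply]
  · intro j _ hj
    simp [onE'_apply, Ne.symm hj]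
  · simp

theorem sum_onE_smul {n : ℕ} {M : Type} [AddCommMonoid M] [Module ℂ M]
    (X : Matrix (IdxV n) (IdxV n) ℂ) (i : IdxV n) (a : Fin 2) (g : IdxE n → M) :
    ∑ l, onE n X (i, a) l • g l = ∑ j, X i j • g (j, a) := by
  rw [Fintype.sum_prod_type]
  refine Finset.sum_congr rfl fun j _ => ?_
  rw [Finset.sum_eq_single a]
  · simp [onE_apply]
  · intro c _ hc
    simp [onE_apply, Ne.symm hc]
  · simp

theorem parE_bar_add {n : ℕ} (i : IdxV n) (a b : Fin 2) :
    parE n (bar i, b) + parE n (i, a) = parX a + parX b := by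
  simp only [parE, parV_bar]
  generalize parV n i = x
  generalize parX a = y
  generalize parX b = z
  revert x y z
  decide

/-- The operators spanning the action of `n'⁺`, in terms of annihilation operators `d`. -/
def lap {n : ℕ} {R : Type} [Ring R] [Algebra ℂ R] (d : IdxE n → R) (a b : Fin 2) : R :=
  ∑ i : IdxV n, (sgn (parX a * parV n i) * bsgn i) • (d (bar i, b) * d (i, a))

/-- The Laplacians span a module over gl(X'), so a raised vector is harmonic as soon as the original
one is. -/
theorem SuperCCR.lap_mul_quad_onE' {n : ℕ} {R : Type} [Ring R] [Algebra ℂ R] {m d : IdxE n → R}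
    (h : SuperCCR (parE n) m d) {A : Matrix (Fin 2) (Fin 2) ℂ} {x : ZMod 2}
    (hA : A ∈ homPart parX x) (a b : Fin 2) :
    lap d a b * quad m d (onE' n A) = sgn (x * (parX a + parX b)) • (quad m d (onE' n A) * lap d a b) +
      (∑ c, (sgn (x * parX a) * A b c) • lap d a c + ∑ c, A a c • lap d c b) := by
  have h1 : ∀ i : IdxV n, (sgn (parX a * parV n i) * bsgn i) •
      (d (bar i, b) * d (i, a)) * quad m d (onE' n A) =
      sgn (x * (parX a + parX b)) • (quad m d (onE' n A) * (sgn (parX a * parV n i) * bsgn i) •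
        (d (bar i, b) * d (i, a))) +
      (∑ c, (sgn (x * parX a) * A b c) • (sgn (parX a * parV n i) * bsgn i) •
        (d (bar i, c) * d (i, a)) +
      ∑ c, A a c • (sgn (parX c * parV n i) * bsgn i) •
        (d (bar i, b) * d (i, c))) := by
    intro i
    rw [smul_mul_assoc, h.d_d_quad (onE'_mem hA),
      parE_bar_add, smul_add, smul_comm (sgn (parX a * parV n i) * bsgn i), mul_smul_comm]
    congr 1
    have e1 : ∀ l, (sgn (x * parE n (i, a)) * onE' n A (bar i, b) l) •
        (d l * d (i, a)) = onE' n A (bar i, b) l •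
        (sgn (x * parE n (i, a)) • (d l * d (i, a))) := by
      intro l
      rw [smul_smul, mul_comm]
    simp only [e1]
    rw [sum_onE'_smul, sum_onE'_smul, smul_add, Finset.smul_sum, Finset.smul_sum]
    congr 1
    · refine Finset.sum_congr rfl fun c _ => ?_
      simp only [smul_smul]
      congr 1
      by_cases hbc : parX b + parX c = x
      · rw [← hbc, parV_bar]
        have h2 := sgn_mul_self ((parX b + parX c) * parV n i)
        simp only [parE, mul_add (parX b + parX c), sgn_add ((parX b + parX c) * parV n i)]
        linear_combination (sgn (parX a * parV n i) * bsgn i * A b c *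
          sgn ((parX b + parX c) * parX a)) * h2
      · rw [hA _ _ hbc]
        simp
    · refine Finset.sum_congr rfl fun c _ => ?_
      simp only [smul_smul]
      congr 1
      have h2 := sgn_mul_self (parX a * parV n i)
      rw [add_mul, sgn_add]
      linear_combination (sgn (parX c * parV n i) * bsgn i * A a c) * h2
  simp only [lap, Finset.sum_mul, h1, Finset.mul_sum, Finset.smul_sum, Finset.sum_add_distrib]
  congr 1
  congr 1
  · rw [Finset.sum_comm]
  · rw [Finset.sum_comm]

/-- The Laplacians contract the V-indices with the invariant form B, so the two terms in which X
hits one of the annihilation operators cancel. -/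
theorem SuperCCR.lap_mul_quad_onE {n : ℕ} {R : Type} [Ring R] [Algebra ℂ R] {m d : IdxE n → R}
    (h : SuperCCR (parE n) m d) {X : Matrix (IdxV n) (IdxV n) ℂ} {x : ZMod 2}
    (hX : X ∈ homPart (parV n) x) (hX' : X ∈ (spo n).toSubmodule) (a b : Fin 2) :
    lap d a b * quad m d (onE n X) =
      sgn (x * (parX a + parX b)) • (quad m d (onE n X) * lap d a b) := by
  have h1 : ∀ i : IdxV n, (sgn (parX a * parV n i) * bsgn i) •
      (d (bar i, b) * d (i, a)) * quad m d (onE n X) =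
      sgn (x * (parX a + parX b)) • (quad m d (onE n X) * (sgn (parX a * parV n i) * bsgn i) •
        (d (bar i, b) * d (i, a))) +
      (∑ j, (sgn (parX a * parV n i) * bsgn i * sgn (x * parE n (i, a)) * X (bar i) j) •
        (d (j, b) * d (i, a)) +
      ∑ j, (sgn (parX a * parV n i) * bsgn i * X i j) •
        (d (bar i, b) * d (j, a))) := by
    intro i
    rw [smul_mul_assoc, h.d_d_quad (onE_mem hX),
      parE_bar_add, smul_add, smul_comm (sgn (parX a * parV n i) * bsgn i), mul_smul_comm]
    congr 1
    have e1 : ∀ l, (sgn (x * parE n (i, a)) * onE n X (bar i, b) l) •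
        (d l * d (i, a)) = onE n X (bar i, b) l •
        (sgn (x * parE n (i, a)) • (d l * d (i, a))) := by
      intro l
      rw [smul_smul, mul_comm]
    simp only [e1]
    rw [sum_onE_smul, sum_onE_smul, smul_add, Finset.smul_sum, Finset.smul_sum]
    congr 1
    · refine Finset.sum_congr rfl fun c _ => ?_
      simp only [smul_smul]
      congr 1
      ring
    · simp only [smul_smul]
  simp only [lap, Finset.sum_mul, h1, Finset.mul_sum, Finset.smul_sum, Finset.sum_add_distrib]
  refine (congrArg _ ?_).trans (add_zero _)
  -- After this reindexing both sums carry the same operators, and their coefficients cancel entry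
  -- by entry by `mem_spo_iff`.
  rw [Finset.sum_comm, ← Equiv.sum_comp (bar_involutive n).toPerm,
    ← Finset.sum_add_distrib]
  refine Finset.sum_eq_zero fun i _ => ?_
  rw [← Finset.sum_add_distrib]
  refine Finset.sum_eq_zero fun j _ => ?_
  rw [Function.Involutive.coe_toPerm, ← add_smul]
  convert zero_smul ℂ _
  rw [(mem_spo_iff X).1 hX' i j]
  by_cases hij : parV n i + parV n j = x
  · rw [← hij]
    have hi := bsgn_mul_self i
    simp only [tsgn, bsgn_bar, parE, mul_add, add_mul, sgn_add]
    rcases zmod2_cases (parV n i) with e1 | e1 <;> rcases zmod2_cases (parV n j) with e2 | e2 <;>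
      rcases zmod2_cases (parX a) with e3 | e3 <;>
      simp only [e1, e2, e3, sgn_zero, sgn_one, mul_zero, mul_one, one_mul] <;>
      first
        | linear_combination (bsgn j * X (bar j) (bar i)) * hi
        | linear_combination (-bsgn j * X (bar j) (bar i)) * hi
  · have : X (bar j) (bar i) = 0 := hX _ _ (by rwa [parV_bar, parV_bar, add_comm])
    rw [this]
    simp

theorem lapOp_mul_glXAction {n : ℕ} {A : Matrix (Fin 2) (Fin 2) ℂ} {x : ZMod 2}
    (hA : A ∈ homPart parX x) (a b : Fin 2) :
    lapOp n a b * glXAction n A = sgn (x * (parX a + parX b)) • (glXAction n A * lapOp n a b) +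
      (∑ c, (sgn (x * parX a) * A b c) • lapOp n a c + ∑ c, A a c • lapOp n c b) :=
  (superCCR_superSym (parE n)).lap_mul_quad_onE' hA a b

theorem lapOp_mul_glVAction {n : ℕ} {X : Matrix (IdxV n) (IdxV n) ℂ} {x : ZMod 2}
    (hX : X ∈ homPart (parV n) x) (hX' : X ∈ (spo n).toSubmodule) (a b : Fin 2) :
    lapOp n a b * glVAction n X =
      sgn (x * (parX a + parX b)) • (glVAction n X * lapOp n a b) :=
  (superCCR_superSym (parE n)).lap_mul_quad_onE hX hX' a b

/-! ### Cyclic submodules and highest weight vectors -/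

section Cyclic

variable {U : Type} [AddCommGroup U] [Module ℂ U]

/-- The smallest subspace containing `g` which is invariant under the operators in `low`. -/
def cyc (low : Set (Module.End ℂ U)) (g : U) : Submodule ℂ U :=
  sInf {N | g ∈ N ∧ ∀ Y ∈ low, ∀ v ∈ N, Y v ∈ N}

variable {low : Set (Module.End ℂ U)} {g : U}

theorem self_mem_cyc : g ∈ cyc low g := Submodule.mem_sInf.2 fun _ h => h.1

theorem apply_mem_cyc {Y : Module.End ℂ U} (hY : Y ∈ low) {v : U} (hv : v ∈ cyc low g) :
    Y v ∈ cyc low g :=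
  Submodule.mem_sInf.2 fun N h => h.2 Y hY v (Submodule.mem_sInf.1 hv N h)

theorem cyc_le {N : Submodule ℂ U} (h1 : g ∈ N) (h2 : ∀ Y ∈ low, ∀ v ∈ N, Y v ∈ N) :
    cyc low g ≤ N := sInf_le ⟨h1, h2⟩

/-- The relations X Y = c Y X + Z let every operator of the algebra be moved to the right past the
lowering operators until it meets the generator. The induction runs over the vectors `v` of the
cyclic space that all of `hom` sends back into it. -/
theorem cyc_invariant {hom : Set (Module.End ℂ U)}
    (h1 : ∀ X ∈ hom, ∀ Y ∈ low, ∃ c : ℂ, ∃ Z ∈ Submodule.span ℂ hom, X * Y = c • (Y * X) + Z)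
    (h2 : ∀ X ∈ hom, X g ∈ cyc low g) {X : Module.End ℂ U} (hX : X ∈ Submodule.span ℂ hom)
    {v : U} (hv : v ∈ cyc low g) : X v ∈ cyc low g := by
  have hspan : ∀ w, (∀ X ∈ hom, X w ∈ cyc low g) → ∀ X ∈ Submodule.span ℂ hom,
      X w ∈ cyc low g := by
    intro w hw X hX
    have : Submodule.span ℂ hom ≤ (cyc low g).comap (LinearMap.applyₗ w) :=
      Submodule.span_le.2 hw
    exact this hX
  let N : Submodule ℂ U :=
    { carrier := {v | v ∈ cyc low g ∧ ∀ X ∈ hom, X v ∈ cyc low g}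
      add_mem' := fun ha hb => ⟨Submodule.add_mem _ ha.1 hb.1, fun X hX => by
        rw [map_add]
        exact Submodule.add_mem _ (ha.2 X hX) (hb.2 X hX)⟩
      zero_mem' := ⟨Submodule.zero_mem _, fun X _ => by
        rw [map_zero]
        exact Submodule.zero_mem _⟩
      smul_mem' := fun c _ ha => ⟨Submodule.smul_mem _ c ha.1, fun X hX => by
        rw [map_smul]
        exact Submodule.smul_mem _ c (ha.2 X hX)⟩ }
  have hN : cyc low g ≤ N := by
    refine cyc_le ⟨self_mem_cyc, h2⟩ fun Y hY v hv => ⟨apply_mem_cyc hY hv.1, fun X hX => ?_⟩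
    obtain ⟨c, Z, hZ, e⟩ := h1 X hX Y hY
    have : X (Y v) = c • Y (X v) + Z v := by
      rw [← Module.End.mul_apply, e]
      rfl
    rw [this]
    exact Submodule.add_mem _ (Submodule.smul_mem _ _ (apply_mem_cyc hY (hv.2 X hX)))
      (hspan v hv.2 Z hZ)
  exact hspan v (hN hv).2 X hX

theorem cyc_le_span_sup : cyc low g ≤ Submodule.span ℂ {g} ⊔ ⨆ Y ∈ low, (cyc low g).map Y := by
  have hle : Submodule.span ℂ {g} ⊔ ⨆ Y ∈ low, (cyc low g).map Y ≤ cyc low g := by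
    refine sup_le ((Submodule.span_singleton_le_iff_mem _ _).2 self_mem_cyc)
      (iSup₂_le fun Y hY => ?_)
    rintro _ ⟨v, hv, rfl⟩
    exact apply_mem_cyc hY hv
  refine cyc_le (Submodule.mem_sup_left (Submodule.mem_span_singleton_self g))
    fun Y hY v hv => Submodule.mem_sup_right ?_
  exact Submodule.mem_iSup_of_mem Y (Submodule.mem_iSup_of_mem hY ⟨v, hle hv, rfl⟩)

/-- The sum of the eigenspaces for the integers less than `t`. -/
def lowerPart (K : Module.End ℂ U) (t : ℤ) : Submodule ℂ U :=
  ⨆ s ∈ {s : ℂ | ∃ m : ℤ, m < t ∧ s = m}, K.eigenspace s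

theorem mem_lowerPart {K : Module.End ℂ U} {t m : ℤ} (h : m < t) {v : U}
    (hv : K v = (m : ℂ) • v) : v ∈ lowerPart K t :=
  Submodule.mem_iSup_of_mem (m : ℂ) (Submodule.mem_iSup_of_mem ⟨m, h, rfl⟩
    (Module.End.mem_eigenspace_iff.2 hv))

theorem disjoint_lowerPart (K : Module.End ℂ U) {t m : ℤ} (h : t ≤ m) :
    Disjoint (K.eigenspace (m : ℂ)) (lowerPart K t) := by
  refine (Module.End.eigenspaces_iSupIndep K).disjoint_biSup ?_
  rintro ⟨m', h', e⟩
  have : m = m' := by exact_mod_cast e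
  omega

theorem cyc_le_span_sup_lowerPart {K : Module.End ℂ U} {t : ℤ} (hg : K g = (t : ℂ) • g)
    (hlow : ∀ Y ∈ low, ∃ s : ℤ, 0 < s ∧ ∀ v, K (Y v) = Y (K v) - (s : ℂ) • Y v) :
    cyc low g ≤ Submodule.span ℂ {g} ⊔ lowerPart K t := by
  refine cyc_le (Submodule.mem_sup_left (Submodule.mem_span_singleton_self g)) ?_
  intro Y hY v hv
  obtain ⟨s, hs, e⟩ := hlow Y hY
  refine Submodule.mem_sup_right ?_
  have key : ∀ (m : ℤ) (v : U), m ≤ t → K v = (m : ℂ) • v → Y v ∈ lowerPart K t := by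
    intro m v hm hv
    refine mem_lowerPart (m := m - s) (by omega) ?_
    rw [e, hv, map_smul, ← sub_smul]
    push_cast
    rfl
  have h2 : Submodule.span ℂ {g} ⊔ lowerPart K t ≤ (lowerPart K t).comap Y := by
    refine sup_le ((Submodule.span_singleton_le_iff_mem _ _).2 (key t g le_rfl hg)) ?_
    refine iSup₂_le fun s hs v hv => ?_
    obtain ⟨m, hm, rfl⟩ := hs
    exact key m v hm.le (Module.End.mem_eigenspace_iff.1 hv)
  exact h2 hv

/-- Lowering operators strictly decrease the eigenvalue of `K`, so the top eigenvalue `t` occurs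
only on the line of `g`. Independence of the eigenspaces excludes larger eigenvalues. -/
theorem lt_or_mem_span_of_mem_cyc {K : Module.End ℂ U} {t : ℤ} (hg : K g = (t : ℂ) • g)
    (hlow : ∀ Y ∈ low, ∃ s : ℤ, 0 < s ∧ ∀ v, K (Y v) = Y (K v) - (s : ℂ) • Y v)
    {v : U} (hv : v ∈ cyc low g) (hv0 : v ≠ 0) {m : ℤ} (hm : K v = (m : ℂ) • v) :
    m < t ∨ m = t ∧ v ∈ Submodule.span ℂ {g} := by
  have h := cyc_le_span_sup_lowerPart hg hlow hv
  rcases lt_trichotomy m t with hmt | hmt | hmt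
  · exact Or.inl hmt
  · refine Or.inr ⟨hmt, ?_⟩
    obtain ⟨a, ha, l, hl, rfl⟩ := Submodule.mem_sup.1 h
    have ha' : K a = (t : ℂ) • a := by
      obtain ⟨c, rfl⟩ := Submodule.mem_span_singleton.1 ha
      rw [map_smul, hg, smul_comm]
    have hl' : l ∈ K.eigenspace (t : ℂ) := by
      rw [Module.End.mem_eigenspace_iff]
      rw [map_add, ha', hmt, smul_add, add_right_inj] at hm
      exact hm
    have hl0 := (Submodule.disjoint_def.1 (disjoint_lowerPart K le_rfl)) l hl' hl
    rw [hl0, add_zero]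
    exact ha
  · exfalso
    have h2 : Submodule.span ℂ {g} ⊔ lowerPart K t ≤ lowerPart K m := by
      refine sup_le ((Submodule.span_singleton_le_iff_mem _ _).2 (mem_lowerPart hmt hg)) ?_
      refine iSup₂_le fun s hs v hv => ?_
      obtain ⟨m', hm', rfl⟩ := hs
      exact mem_lowerPart (hm'.trans hmt) (Module.End.mem_eigenspace_iff.1 hv)
    exact hv0 (Submodule.disjoint_def.1 (disjoint_lowerPart K le_rfl) v
      (Module.End.mem_eigenspace_iff.2 hm) (h2 h))

/-! ### Weight vectors -/

variable {ι : Type} (H : ι → Module.End ℂ U)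

/-- The space of vectors of integral weight `μ` for the operators `H`. -/
def weightSpace (μ : ι → ℤ) : Submodule ℂ U where
  carrier := {v | ∀ i, H i v = (μ i : ℂ) • v}
  add_mem' := fun ha hb i => by rw [map_add, ha i, hb i, smul_add]
  zero_mem' := fun i => by rw [map_zero, smul_zero]
  smul_mem' := fun c v hv i => by rw [map_smul, hv i, smul_comm]

variable {H}

/-- Write a nonzero vector of N as a sum of weight vectors with the fewest terms. If two weights μ,
ν differ at i, then H_i - μ_i and H_i - ν_i preserve N and each removes a term. They cannot both
kill the vector, since their difference is a nonzero scalar. -/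
theorem exists_weight_vector {N : Submodule ℂ U} (hN : ∀ i, ∀ v ∈ N, H i v ∈ N)
    (hle : N ≤ ⨆ μ, weightSpace H μ) (hne : N ≠ ⊥) :
    ∃ μ, ∃ v ∈ N, v ≠ 0 ∧ v ∈ weightSpace H μ := by
  classical
  have key : ∀ (k : ℕ) (s : Finset (ι → ℤ)) (x : (ι → ℤ) → U), s.card ≤ k →
      (∀ μ, x μ ∈ weightSpace H μ) → ∑ μ ∈ s, x μ ∈ N → ∑ μ ∈ s, x μ ≠ 0 →
      ∃ μ, ∃ v ∈ N, v ≠ 0 ∧ v ∈ weightSpace H μ := by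
    intro k
    induction k with
    | zero =>
      intro s x hs _ _ h0
      rw [Nat.le_zero, Finset.card_eq_zero] at hs
      rw [hs, Finset.sum_empty] at h0
      exact absurd rfl h0
    | succ k ih =>
      intro s x hs hx hmem h0
      by_cases hcard : s.card ≤ 1
      · obtain ⟨μ, hμ⟩ : ∃ μ, s = {μ} := by
          rw [← Finset.card_eq_one]
          refine le_antisymm hcard (Nat.one_le_iff_ne_zero.2 fun e => h0 ?_)
          rw [Finset.card_eq_zero.1 e, Finset.sum_empty]
        rw [hμ, Finset.sum_singleton] at hmem h0
        exact ⟨μ, x μ, hmem, h0, hx μ⟩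
      · obtain ⟨μ, hμ, ν, hν, hne⟩ := Finset.one_lt_card.1 (not_le.1 hcard)
        obtain ⟨i, hi⟩ := Function.ne_iff.1 hne
        have step : ∀ μ ∈ s, (H i (∑ ν ∈ s, x ν) - (μ i : ℂ) • ∑ ν ∈ s, x ν) ≠ 0 →
            ∃ μ, ∃ v ∈ N, v ≠ 0 ∧ v ∈ weightSpace H μ := by
          intro μ hμ hz
          have e : H i (∑ ν ∈ s, x ν) - (μ i : ℂ) • ∑ ν ∈ s, x ν =
              ∑ ν ∈ s.erase μ, ((ν i : ℂ) - μ i) • x ν := by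
            rw [map_sum, Finset.smul_sum, ← Finset.sum_sub_distrib, ← Finset.add_sum_erase s _ hμ,
              hx μ i, sub_self, zero_add]
            refine Finset.sum_congr rfl fun ν _ => ?_
            rw [hx ν i, sub_smul]
          have hmem' := N.sub_mem (hN i _ hmem) (N.smul_mem (μ i : ℂ) hmem)
          rw [e] at hz hmem'
          refine ih (s.erase μ) (fun ν => ((ν i : ℂ) - μ i) • x ν) ?_
            (fun ν => Submodule.smul_mem _ _ (hx ν)) hmem' hz
          rw [Finset.card_erase_of_mem hμ]
          omega
        by_cases h1 : H i (∑ ν ∈ s, x ν) - (μ i : ℂ) • ∑ ν ∈ s, x ν = 0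
        · by_cases h2 : H i (∑ ν ∈ s, x ν) - (ν i : ℂ) • ∑ ν ∈ s, x ν = 0
          · exfalso
            rw [sub_eq_zero] at h1 h2
            rw [h1, ← sub_eq_zero, ← sub_smul, smul_eq_zero] at h2
            refine h0 (h2.resolve_left fun e => hi ?_)
            rw [sub_eq_zero] at e
            exact_mod_cast e
          · exact step ν hν h2
        · exact step μ hμ h1
  obtain ⟨v, hv, hv0⟩ := Submodule.exists_mem_ne_zero_of_ne_bot hne
  obtain ⟨f, hf, hsum⟩ := (Submodule.mem_iSup_iff_exists_finsupp _ _).1 (hle hv)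
  refine key f.support.card f.support f le_rfl hf ?_ ?_
  · rw [Finsupp.sum] at hsum
    rwa [hsum]
  · rw [Finsupp.sum] at hsum
    rwa [hsum]

theorem exists_highest_vector {N : Submodule ℂ U} (hN : ∀ i, ∀ v ∈ N, H i v ∈ N)
    (hle : N ≤ ⨆ μ, weightSpace H μ) (hne : N ≠ ⊥) (ht : (ι → ℤ) → ℤ) (B : ℤ)
    (hB : ∀ μ, ∀ v ∈ N, v ≠ 0 → v ∈ weightSpace H μ → ht μ ≤ B) :
    ∃ μ, ∃ v ∈ N, v ≠ 0 ∧ v ∈ weightSpace H μ ∧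
      ∀ ν, ∀ w ∈ N, w ∈ weightSpace H ν → ht μ < ht ν → w = 0 := by
  obtain ⟨μ, v, hv, hv0, hμ⟩ := exists_weight_vector hN hle hne
  obtain ⟨t, ⟨μ, v, hv, hv0, hμ, rfl⟩, hmax⟩ := Int.exists_greatest_of_bdd
    (P := fun t => ∃ μ, ∃ v ∈ N, v ≠ 0 ∧ v ∈ weightSpace H μ ∧ ht μ = t)
    ⟨B, by
      rintro _ ⟨μ, v, hv, hv0, hμ, rfl⟩
      exact hB μ v hv hv0 hμ⟩ ⟨_, μ, v, hv, hv0, hμ, rfl⟩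
  refine ⟨μ, v, hv, hv0, hμ, fun ν w hw hν hlt => ?_⟩
  by_contra hw0
  exact absurd (hmax _ ⟨ν, w, hw, hw0, hν, rfl⟩) (not_le.2 hlt)

theorem cyc_le_iSup_weightSpace {μ : ι → ℤ} (hg : g ∈ weightSpace H μ)
    (hlow : ∀ Y ∈ low, ∃ δ : ι → ℤ, ∀ i v, H i (Y v) = Y (H i v) + (δ i : ℂ) • Y v) :
    cyc low g ≤ ⨆ μ, weightSpace H μ := by
  refine cyc_le (Submodule.mem_iSup_of_mem μ hg) ?_
  intro Y hY
  obtain ⟨δ, hδ⟩ := hlow Y hY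
  have : (⨆ μ, weightSpace H μ) ≤ (⨆ μ, weightSpace H μ).comap Y := by
    refine iSup_le fun ν v hv => ?_
    refine Submodule.mem_iSup_of_mem (fun i => ν i + δ i) fun i => ?_
    rw [hδ, hv i, map_smul, ← add_smul]
    push_cast
    rfl
  exact fun v hv => this hv

/-- In a cyclic module with a positive definite form for which the adjoints of the lowering
operators raise the eigenvalues of `K`, every nonzero invariant subspace contains the generator. -/
theorem mem_of_unitary {K : Module.End ℂ U} {t : ℤ} (hg : K g = (t : ℂ) • g)
    (hlow : ∀ Y ∈ low, ∃ s : ℤ, 0 < s ∧ ∀ v, K (Y v) = Y (K v) - (s : ℂ) • Y v)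
    {F : U →ₗ⋆[ℂ] U →ₗ[ℂ] ℂ} (hF : ∀ v, v ≠ 0 → 0 < (F v v).re)
    (hK : ∀ v w, F (K v) w = F v (K w)) {N : Submodule ℂ U} (hle : N ≤ cyc low g) (hne : N ≠ ⊥)
    (hNK : ∀ v ∈ N, K v ∈ N)
    (hadj : ∀ Y ∈ low, ∃ Y' : Module.End ℂ U, (∀ v w, F (Y v) w = F v (Y' w)) ∧
      (∀ v ∈ N, Y' v ∈ N) ∧ ∃ s : ℤ, 0 < s ∧ ∀ v, K (Y' v) = Y' (K v) + (s : ℂ) • Y' v) :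
    g ∈ N := by
  have hgw : g ∈ weightSpace (fun _ : Unit => K) (fun _ => t) := fun _ => hg
  have hlow' : ∀ Y ∈ low, ∃ δ : Unit → ℤ, ∀ i v, (fun _ : Unit => K) i (Y v) =
      Y ((fun _ : Unit => K) i v) + (δ i : ℂ) • Y v := by
    intro Y hY
    obtain ⟨s, -, e⟩ := hlow Y hY
    refine ⟨fun _ => -s, fun _ v => ?_⟩
    dsimp only
    rw [e, Int.cast_neg, neg_smul, sub_eq_add_neg]
  obtain ⟨μ, v, hv, hv0, hμ, hmax⟩ := exists_highest_vector (H := fun _ : Unit => K) (N := N)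
    (fun _ => hNK) (hle.trans (cyc_le_iSup_weightSpace hgw hlow')) hne (fun μ => μ ()) t
    (by
      intro μ v hv hv0 hμ
      rcases lt_or_mem_span_of_mem_cyc hg hlow (hle hv) hv0 (hμ ()) with h | h
      · exact h.le
      · exact h.1.le)
  rcases lt_or_mem_span_of_mem_cyc hg hlow (hle hv) hv0 (hμ ()) with h | h
  · exfalso
    -- A top vector `v` of N with eigenvalue below `t` is orthogonal to `g`, because `K` is
    -- self-adjoint, and to every image of a lowering operator `Y`, because the adjoint `Y'` raises
    -- `v` and hence kills it. So `v` is orthogonal to the whole cyclic space, itself included.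
    have h1 : Submodule.span ℂ {g} ⊔ (⨆ Y ∈ low, (cyc low g).map Y) ≤
        LinearMap.ker (F.flip v) := by
      refine sup_le ((Submodule.span_singleton_le_iff_mem _ _).2 ?_) (iSup₂_le fun Y hY => ?_)
      · rw [LinearMap.mem_ker, LinearMap.flip_apply]
        have h2 := hK g v
        have hμ' : K v = (μ () : ℂ) • v := hμ ()
        rw [hg, hμ', LinearMap.map_smulₛₗ, map_smul, LinearMap.smul_apply, smul_eq_mul,
          smul_eq_mul, map_intCast] at h2
        have h3 : ((t : ℂ) - μ ()) * F g v = 0 := by linear_combination h2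
        refine (mul_eq_zero.1 h3).resolve_left fun e => ?_
        rw [sub_eq_zero] at e
        have : t = μ () := by exact_mod_cast e
        omega
      · rintro _ ⟨w, -, rfl⟩
        rw [LinearMap.mem_ker, LinearMap.flip_apply]
        obtain ⟨Y', hY', hNY, s, hs, e⟩ := hadj Y hY
        rw [hY', hmax (fun i => μ i + s) (Y' v) (hNY v hv) _ (by omega), map_zero]
        intro i
        have hμ' : K v = (μ i : ℂ) • v := hμ i
        rw [e, hμ', map_smul, ← add_smul]
        push_cast
        rfl
    have h2 := h1 (cyc_le_span_sup (hle hv))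
    rw [LinearMap.mem_ker, LinearMap.flip_apply] at h2
    have := hF v hv0
    rw [h2] at this
    simp at this
  · obtain ⟨c, rfl⟩ := Submodule.mem_span_singleton.1 h.2
    have hc : c ≠ 0 := by
      rintro rfl
      simp at hv0
    have := N.smul_mem c⁻¹ hv
    rwa [smul_smul, inv_mul_cancel₀ hc, one_smul] at this

end Cyclic

/-! ### The Casimir element of `spo(2n|1)` -/

section Structure

variable {n : ℕ}

/-! ### The anti-involution of gl(V) and the spanning set of spo(2n|1). -/

theorem tsgn_mul_self (i j : IdxV n) : tsgn i j * tsgn i j = 1 := by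
  have h1 := bsgn_mul_self (bar i)
  have h2 := bsgn_mul_self (bar j)
  have h3 := sgn_mul_self (parV n i + parV n i * parV n j)
  unfold tsgn
  calc _ = (bsgn (bar i) * bsgn (bar i)) * (bsgn (bar j) * bsgn (bar j)) *
      (sgn (parV n i + parV n i * parV n j) * sgn (parV n i + parV n i * parV n j)) := by ring
    _ = 1 := by rw [h1, h2, h3]; norm_num

/-- The anti-involution of `gl(V)` given by the form, up to sign. -/
def tau (n : ℕ) : Matrix (IdxV n) (IdxV n) ℂ →ₗ[ℂ] Matrix (IdxV n) (IdxV n) ℂ where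
  toFun X := Matrix.of fun i j => tsgn i j * X (bar j) (bar i)
  map_add' X Y := by
    ext i j
    simp [mul_add]
  map_smul' c X := by
    ext i j
    simp [mul_left_comm]

theorem tau_apply (X : Matrix (IdxV n) (IdxV n) ℂ) (i j : IdxV n) :
    tau n X i j = tsgn i j * X (bar j) (bar i) := rfl

theorem mem_spo_iff_tau (X : Matrix (IdxV n) (IdxV n) ℂ) :
    X ∈ (spo n).toSubmodule ↔ tau n X = -X := by
  rw [mem_spo_iff]
  constructor
  · intro h
    ext i j
    rw [tau_apply, Matrix.neg_apply, h i j, neg_neg]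
  · intro h i j
    rw [← tau_apply, h, Matrix.neg_apply, neg_neg]

theorem tsgn_bar (i j : IdxV n) : tsgn (bar j) (bar i) = tsgn i j := by
  simp only [tsgn, parV_bar, bar_bar, bsgn_bar]
  rcases zmod2_cases (parV n i) with h1 | h1 <;> rcases zmod2_cases (parV n j) with h2 | h2 <;>
    simp [h1, h2, sgn_zero, sgn_one, mul_comm]

theorem tau_tau (X : Matrix (IdxV n) (IdxV n) ℂ) : tau n (tau n X) = X := by
  ext i j
  rw [tau_apply, tau_apply, tsgn_bar, bar_bar, bar_bar, ← mul_assoc, tsgn_mul_self, one_mul]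

theorem tau_mul {a b : ZMod 2} {X Y : Matrix (IdxV n) (IdxV n) ℂ} (hX : X ∈ homPart (parV n) a)
    (hY : Y ∈ homPart (parV n) b) : tau n (X * Y) = sgn (a * b) • (tau n Y * tau n X) := by
  ext i j
  rw [tau_apply, Matrix.mul_apply, Matrix.smul_apply, Matrix.mul_apply, smul_eq_mul,
    Finset.mul_sum, Finset.mul_sum, ← Equiv.sum_comp (bar_involutive n).toPerm]
  refine Finset.sum_congr rfl fun k _ => ?_
  simp only [Function.Involutive.coe_toPerm, tau_apply]
  by_cases h1 : parV n (bar j) + parV n (bar k) = a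
  · by_cases h2 : parV n (bar k) + parV n (bar i) = b
    · have key : tsgn i j = sgn (a * b) * (tsgn i k * tsgn k j) := by
        rw [← h1, ← h2]
        have h3 := bsgn_mul_self (bar k)
        simp only [tsgn, parV_bar]
        rcases zmod2_cases (parV n i) with h1 | h1 <;>
          rcases zmod2_cases (parV n j) with h2 | h2 <;>
          rcases zmod2_cases (parV n k) with h4 | h4 <;>
          simp only [h1, h2, h4, sgn_zero, sgn_one, add_zero, zero_add, mul_zero,
            mul_one, CharTwo.add_self_eq_zero] <;>
          first
          | linear_combination -(bsgn (bar i) * bsgn (bar j)) * h3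
          | linear_combination (bsgn (bar i) * bsgn (bar j)) * h3
      rw [key]
      ring
    · rw [hY _ _ h2]
      ring
  · rw [hX _ _ h1]
    ring

theorem tau_mem {a : ZMod 2} {X : Matrix (IdxV n) (IdxV n) ℂ} (hX : X ∈ homPart (parV n) a) :
    tau n X ∈ homPart (parV n) a := by
  intro i j h
  rw [tau_apply, hX, mul_zero]
  rwa [parV_bar, parV_bar, add_comm]

/-- The projection of `gl(V)` onto `spo(V)`, up to the factor `2`. -/
def toSpo (n : ℕ) : Matrix (IdxV n) (IdxV n) ℂ →ₗ[ℂ] Matrix (IdxV n) (IdxV n) ℂ :=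
  LinearMap.id - tau n

theorem toSpo_apply (X : Matrix (IdxV n) (IdxV n) ℂ) : toSpo n X = X - tau n X := rfl

theorem toSpo_mem (X : Matrix (IdxV n) (IdxV n) ℂ) : toSpo n X ∈ (spo n).toSubmodule := by
  rw [mem_spo_iff_tau, toSpo_apply, map_sub, tau_tau, neg_sub]

theorem toSpo_mem_homPart {a : ZMod 2} {X : Matrix (IdxV n) (IdxV n) ℂ}
    (hX : X ∈ homPart (parV n) a) : toSpo n X ∈ homPart (parV n) a :=
  Submodule.sub_mem _ hX (tau_mem hX)

theorem toSpo_of_mem {X : Matrix (IdxV n) (IdxV n) ℂ} (hX : X ∈ (spo n).toSubmodule) :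
    toSpo n X = (2 : ℂ) • X := by
  rw [toSpo_apply, (mem_spo_iff_tau X).1 hX, two_smul, sub_neg_eq_add]

/-- The map `toSpo` is equivariant under spo(2n|1): `tau` is a super anti-automorphism, equal to -1
on spo(2n|1). Brackets with the `spoGen i j` can therefore be computed on elementary matrices. -/
theorem superBracket_toSpo {a b : ZMod 2} {X Y : Matrix (IdxV n) (IdxV n) ℂ}
    (hX : X ∈ homPart (parV n) a) (hX' : X ∈ (spo n).toSubmodule)
    (hY : Y ∈ homPart (parV n) b) :
    X * toSpo n Y - sgn (a * b) • (toSpo n Y * X) =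
      toSpo n (X * Y) - sgn (a * b) • toSpo n (Y * X) := by
  rw [mem_spo_iff_tau] at hX'
  simp only [toSpo_apply, tau_mul hX hY, tau_mul hY hX, hX', mul_sub, sub_mul, mul_neg, neg_mul,
    smul_sub, smul_neg, smul_smul, mul_comm b a, sgn_mul_self, one_smul]
  abel

/-- The standard spanning set of `spo(2n|1)`. -/
def spoGen (i j : IdxV n) : Matrix (IdxV n) (IdxV n) ℂ := toSpo n (Matrix.single i j 1)

theorem single_mem_homPart (i j : IdxV n) :
    Matrix.single i j (1 : ℂ) ∈ homPart (parV n) (parV n i + parV n j) := by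
  intro k l h
  rw [Matrix.single_apply, if_neg]
  rintro ⟨rfl, rfl⟩
  exact h rfl

theorem spoGen_mem (i j : IdxV n) : spoGen i j ∈ (spo n).toSubmodule := toSpo_mem _

theorem spoGen_mem_homPart (i j : IdxV n) :
    spoGen i j ∈ homPart (parV n) (parV n i + parV n j) :=
  toSpo_mem_homPart (single_mem_homPart i j)

theorem spoGen_apply (i j k l : IdxV n) : spoGen i j k l =
    (if i = k ∧ j = l then 1 else 0) - tsgn k l * if i = bar l ∧ j = bar k then 1 else 0 := by
  rw [spoGen, toSpo_apply, Matrix.sub_apply, tau_apply, Matrix.single_apply, Matrix.single_apply]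

theorem toSpo_eq_sum (X : Matrix (IdxV n) (IdxV n) ℂ) :
    toSpo n X = ∑ i, ∑ j, X i j • spoGen i j := by
  conv_lhs => rw [Matrix.matrix_eq_sum_single X]
  simp only [map_sum, spoGen, ← map_smul, Matrix.smul_single, smul_eq_mul, mul_one]

theorem eq_sum_spoGen {X : Matrix (IdxV n) (IdxV n) ℂ} (hX : X ∈ (spo n).toSubmodule) :
    X = ∑ i, ∑ j, (X i j / 2) • spoGen i j := by
  calc X = (1 / 2 : ℂ) • toSpo n X := by
        rw [toSpo_of_mem hX, smul_smul]
        norm_num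
    _ = _ := by
        simp only [toSpo_eq_sum, Finset.smul_sum, smul_smul]
        refine Finset.sum_congr rfl fun i _ => Finset.sum_congr rfl fun j _ => ?_
        congr 1
        ring

theorem superBracket_spoGen {a : ZMod 2} {X : Matrix (IdxV n) (IdxV n) ℂ}
    (hX : X ∈ homPart (parV n) a) (hX' : X ∈ (spo n).toSubmodule) (i j : IdxV n) :
    X * spoGen i j - sgn (a * (parV n i + parV n j)) • (spoGen i j * X) =
      ∑ k, X k i • spoGen k j - sgn (a * (parV n i + parV n j)) • ∑ k, X j k • spoGen i k := by
  rw [spoGen, superBracket_toSpo hX hX' (single_mem_homPart i j), toSpo_eq_sum, toSpo_eq_sum]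
  congr 1
  · refine Finset.sum_congr rfl fun k _ => ?_
    rw [Finset.sum_eq_single j]
    · simp
    · intro l _ hl
      simp [Matrix.mul_apply, hl.symm]
    · simp
  · congr 1
    rw [Finset.sum_eq_single i]
    · refine Finset.sum_congr rfl fun l _ => ?_
      simp
    · intro k _ hk
      refine Finset.sum_eq_zero fun l _ => ?_
      simp [Matrix.mul_apply, hk.symm]
    · simp

end Structure

/-! ### The quadratic Casimir element. -/

section Casimir

variable {n : ℕ} {R : Type} [Ring R] [Algebra ℂ R]

/-- A linear map from `gl(V)` which turns supercommutators into supercommutators. -/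
def IsSuperHom (φ : Matrix (IdxV n) (IdxV n) ℂ →ₗ[ℂ] R) : Prop :=
  ∀ (x y : ZMod 2) (X Y : Matrix (IdxV n) (IdxV n) ℂ), X ∈ homPart (parV n) x →
    Y ∈ homPart (parV n) y →
    φ X * φ Y = sgn (x * y) • (φ Y * φ X) + φ (X * Y - sgn (x * y) • (Y * X))

variable {φ : Matrix (IdxV n) (IdxV n) ℂ →ₗ[ℂ] R}

theorem IsSuperHom.mul_spoGen (h : IsSuperHom φ) {a : ZMod 2} {X : Matrix (IdxV n) (IdxV n) ℂ}
    (hX : X ∈ homPart (parV n) a) (hX' : X ∈ (spo n).toSubmodule) (i j : IdxV n) :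
    φ X * φ (spoGen i j) = sgn (a * (parV n i + parV n j)) • (φ (spoGen i j) * φ X) +
      (∑ k, X k i • φ (spoGen k j) -
        sgn (a * (parV n i + parV n j)) • ∑ k, X j k • φ (spoGen i k)) := by
  rw [h _ _ _ _ hX (spoGen_mem_homPart i j), superBracket_spoGen hX hX']
  simp only [map_sub, map_smul, map_sum]

/-- The Casimir element of `spo(2n|1)`. -/
def casimir (φ : Matrix (IdxV n) (IdxV n) ℂ →ₗ[ℂ] R) : R :=
  ∑ i, ∑ j, sgn (parV n j) • (φ (spoGen i j) * φ (spoGen j i))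

/-- Supercommuting X with both factors of each term produces four triple sums, which cancel in pairs
after their indices are renamed. The sign `sgn (parV n j)` is the one for which this works: it makes
the contraction a supertrace. -/
theorem IsSuperHom.mul_casimir (h : IsSuperHom φ) {a : ZMod 2} {X : Matrix (IdxV n) (IdxV n) ℂ}
    (hX : X ∈ homPart (parV n) a) (hX' : X ∈ (spo n).toSubmodule) :
    φ X * casimir φ = casimir φ * φ X := by
  have h1 : ∀ i j, φ X * (sgn (parV n j) • (φ (spoGen i j) * φ (spoGen j i))) =
      sgn (parV n j) • (φ (spoGen i j) * φ (spoGen j i)) * φ X +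
      (∑ k, (sgn (parV n j) * X k i) • (φ (spoGen k j) * φ (spoGen j i)) -
       ∑ k, (sgn (parV n j) * X i k) • (φ (spoGen i j) * φ (spoGen j k)) +
       (∑ k, (sgn (parV n j) * sgn (a * (parV n i + parV n j)) * X k j) •
          (φ (spoGen i j) * φ (spoGen k i)) -
       ∑ k, (sgn (parV n j) * sgn (a * (parV n i + parV n j)) * X j k) •
          (φ (spoGen i k) * φ (spoGen j i)))) := by
    intro i j
    rw [mul_smul_comm, ← mul_assoc, h.mul_spoGen hX hX', add_mul, smul_mul_assoc, mul_assoc,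
      h.mul_spoGen hX hX' j i, add_comm (parV n j) (parV n i)]
    have hs := sgn_mul_self (a * (parV n i + parV n j))
    generalize sgn (a * (parV n i + parV n j)) = s at *
    simp only [mul_add, mul_sub, sub_mul, smul_add, smul_sub, mul_smul_comm, smul_mul_assoc,
      smul_smul, Finset.mul_sum, Finset.sum_mul, Finset.smul_sum, ← mul_assoc]
    have hs2 : sgn (parV n j) * s * s = sgn (parV n j) := by
      rw [mul_assoc, hs, mul_one]
    simp only [hs2]
    abel
  simp only [casimir, Finset.mul_sum, Finset.sum_mul, h1, Finset.sum_add_distrib,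
    Finset.sum_sub_distrib]
  rw [add_eq_left]
  have e1 : ∑ i, ∑ j, ∑ k, (sgn (parV n j) * X k i) • (φ (spoGen k j) * φ (spoGen j i)) =
      ∑ i, ∑ j, ∑ k, (sgn (parV n j) * X i k) • (φ (spoGen i j) * φ (spoGen j k)) := by
    rw [Finset.sum_comm]
    conv_rhs => rw [Finset.sum_comm]
    exact Finset.sum_congr rfl fun j _ => Finset.sum_comm
  have e2 : ∑ i, ∑ j, ∑ k, (sgn (parV n j) * sgn (a * (parV n i + parV n j)) * X k j) •
          (φ (spoGen i j) * φ (spoGen k i)) =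
      ∑ i, ∑ j, ∑ k, (sgn (parV n j) * sgn (a * (parV n i + parV n j)) * X j k) •
          (φ (spoGen i k) * φ (spoGen j i)) := by
    refine Finset.sum_congr rfl fun i _ => ?_
    rw [Finset.sum_comm]
    refine Finset.sum_congr rfl fun j _ => Finset.sum_congr rfl fun k _ => ?_
    congr 1
    by_cases hjk : parV n j + parV n k = a
    · congr 1
      rw [← hjk]
      rcases zmod2_cases (parV n i) with h1 | h1 <;>
        rcases zmod2_cases (parV n j) with h2 | h2 <;>
        rcases zmod2_cases (parV n k) with h4 | h4 <;>
        simp [h1, h2, h4, sgn_zero, sgn_one, CharTwo.add_self_eq_zero]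
    · rw [hX j k hjk, mul_zero, mul_zero]
  rw [e1, e2, sub_self, sub_self, add_zero]

/-- The multiplicity of the root of `spoGen i j`. -/
def rootMult (i j : IdxV n) : ℂ := if j = bar i then 2 else 1

theorem IsSuperHom.spoGen_mul_spoGen (h : IsSuperHom φ) {i j : IdxV n} (hij : i ≠ j) :
    φ (spoGen i j) * φ (spoGen j i) =
      sgn (parV n i + parV n j) • (φ (spoGen j i) * φ (spoGen i j)) +
        rootMult i j • (φ (spoGen i i) - sgn (parV n i + parV n j) • φ (spoGen j j)) := by
  rw [h.mul_spoGen (spoGen_mem_homPart i j) (spoGen_mem i j)]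
  have hs : (parV n i + parV n j) * (parV n j + parV n i) = parV n i + parV n j := by
    generalize parV n i = x
    generalize parV n j = y
    revert x y
    decide
  rw [hs, smul_sub]
  -- This is the long root case. The vector u_{2n+1} is its own partner, so `i` is even, and the two
  -- terms of `spoGen i j` coincide and add up, which doubles the bracket.
  have key : j = bar i → parV n i = 0 ∧ tsgn i (bar i) = -1 := by
    intro e
    have hi : parV n i = 0 := by
      rcases i with i | i
      · rfl
      · exact absurd e.symm hij
    refine ⟨hi, ?_⟩
    have := bsgn_mul_self i
    rw [tsgn, bar_bar, bsgn_bar, parV_bar, hi]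
    simp [sgn_zero, this]
  have e1 : ∑ k, spoGen i j k j • φ (spoGen k i) = rootMult i j • φ (spoGen i i) := by
    rw [Finset.sum_eq_single i]
    · congr 1
      rw [spoGen_apply, rootMult]
      by_cases e : j = bar i
      · rw [if_pos ⟨rfl, rfl⟩, if_pos ⟨by rw [e, bar_bar], e⟩, if_pos e, e, (key e).2]
        norm_num
      · rw [if_pos ⟨rfl, rfl⟩, if_neg (fun hh => e hh.2), if_neg e]
        norm_num
    · intro k _ hk
      rw [spoGen_apply, if_neg (fun hh => hk hh.1.symm), if_neg, mul_zero, sub_zero, zero_smul]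
      rintro ⟨e1, e2⟩
      apply hk
      rw [e1, e2, bar_bar]
    · simp
  have e2 : ∑ k, spoGen i j i k • φ (spoGen j k) = rootMult i j • φ (spoGen j j) := by
    rw [Finset.sum_eq_single j]
    · congr 1
      rw [spoGen_apply, rootMult]
      by_cases e : j = bar i
      · rw [if_pos ⟨rfl, rfl⟩, if_pos ⟨by rw [e, bar_bar], e⟩, if_pos e, e, (key e).2]
        norm_num
      · rw [if_pos ⟨rfl, rfl⟩, if_neg (fun hh => e hh.2), if_neg e]
        norm_num
    · intro k _ hk
      rw [spoGen_apply, if_neg (fun hh => hk hh.2.symm), if_neg, mul_zero, sub_zero, zero_smul]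
      rintro ⟨e1, e2⟩
      apply hk
      rw [e2, e1, bar_bar]
    · simp
  rw [e1, e2, smul_comm (rootMult i j)]

theorem spoGen_self (i : IdxV n) : spoGen i i = Matrix.diagonal fun k =>
    (if k = i then 1 else 0) - if k = bar i then 1 else 0 := by
  ext k l
  rw [spoGen_apply]
  by_cases hkl : k = l
  · subst hkl
    rw [Matrix.diagonal_apply_eq]
    have ht : tsgn k k = 1 := by
      have h1 := bsgn_mul_self (bar k)
      have h2 : parV n k + parV n k * parV n k = 0 := by
        generalize parV n k = x
        revert x
        decide
      rw [tsgn, h1, h2, sgn_zero, one_mul]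
    have e : i = bar k ↔ k = bar i := by
      constructor <;> rintro rfl <;> simp
    simp only [and_self, ht, one_mul, e, eq_comm (a := i)]
  · rw [Matrix.diagonal_apply_ne _ hkl, if_neg, if_neg]
    · simp
    · rintro ⟨rfl, h2⟩
      exact hkl ((bar_involutive n).injective h2).symm
    · rintro ⟨rfl, h2⟩
      exact hkl h2

theorem IsSuperHom.cartan_mul_spoGen (h : IsSuperHom φ) {d : IdxV n → ℂ}
    (hd : ∀ i, d (bar i) = -d i) (i j : IdxV n) :
    φ (Matrix.diagonal d) * φ (spoGen i j) = φ (spoGen i j) * φ (Matrix.diagonal d) +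
      (d i - d j) • φ (spoGen i j) := by
  have h1 : Matrix.diagonal d ∈ homPart (parV n) 0 := by
    intro k l hkl
    refine Matrix.diagonal_apply_ne _ ?_
    rintro rfl
    exact hkl (CharTwo.add_self_eq_zero _)
  have h2 : Matrix.diagonal d ∈ (spo n).toSubmodule := by
    rw [mem_spo_iff_tau]
    ext k l
    rw [tau_apply, Matrix.neg_apply]
    by_cases hkl : k = l
    · subst hkl
      have ht : tsgn k k = 1 := by
        have h1 := bsgn_mul_self (bar k)
        have h2 : parV n k + parV n k * parV n k = 0 := by
          generalize parV n k = x
          revert x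
          decide
        rw [tsgn, h1, h2, sgn_zero, one_mul]
      rw [ht, one_mul, Matrix.diagonal_apply_eq, Matrix.diagonal_apply_eq, hd]
    · rw [Matrix.diagonal_apply_ne _ hkl, Matrix.diagonal_apply_ne, mul_zero, neg_zero]
      exact fun e => hkl ((bar_involutive n).injective e).symm
  rw [h.mul_spoGen h1 h2, zero_mul, sgn_zero, one_smul, one_smul, sub_smul]
  congr 2
  · rw [Finset.sum_eq_single i]
    · rw [Matrix.diagonal_apply_eq]
    · intro k _ hk
      rw [Matrix.diagonal_apply_ne _ hk, zero_smul]
    · simp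
  · rw [Finset.sum_eq_single j]
    · rw [Matrix.diagonal_apply_eq]
    · intro k _ hk
      rw [Matrix.diagonal_apply_ne _ hk.symm, zero_smul]
    · simp

end Casimir

/-! ### Highest weight modules of `spo(2n|1)` -/

/-- The position of a basis vector in the ordered basis `u_1, …, u_n, u_{2n+1}, u_{n+1}, …`. -/
def pos {n : ℕ} : IdxV n → ℕ := Sum.elim (fun i => if (i : ℕ) < n then i else i + 1) (fun _ => n)

theorem pos_inl {n : ℕ} (i : Fin (2 * n)) :
    pos (Sum.inl i : IdxV n) = if (i : ℕ) < n then (i : ℕ) else i + 1 := rfl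

theorem pos_inr {n : ℕ} (i : Unit) : pos (Sum.inr i : IdxV n) = n := rfl

theorem pos_injective (n : ℕ) : Function.Injective (pos : IdxV n → ℕ) := by
  rintro (i | i) (j | j) h
  · simp only [pos_inl] at h
    congr 1
    apply Fin.ext
    split_ifs at h <;> omega
  · simp only [pos_inl, pos_inr] at h
    split_ifs at h <;> omega
  · simp only [pos_inl, pos_inr] at h
    split_ifs at h <;> omega
  · rfl

theorem pos_add_pos_bar {n : ℕ} (i : IdxV n) : pos i + pos (bar i) = 2 * n := by
  rcases i with i | i
  · have := i.2
    simp only [bar, Sum.map_inl, pos_inl, Fin.val_rev]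
    split_ifs <;> omega
  · simp only [bar, Sum.map_inr, pos_inr]
    omega

theorem pos_inl_lt {n : ℕ} {i j : Fin (2 * n)} :
    pos (Sum.inl i : IdxV n) < pos (Sum.inl j : IdxV n) ↔ i < j := by
  simp only [pos_inl, Fin.lt_def]
  split_ifs <;> omega

theorem pos_inl_lt_inr {n : ℕ} {i : Fin (2 * n)} {u : Unit} :
    pos (Sum.inl i : IdxV n) < pos (Sum.inr u : IdxV n) ↔ (i : ℕ) < n := by
  simp only [pos_inl, pos_inr]
  split_ifs <;> omega

theorem pos_inr_lt_inl {n : ℕ} {i : Fin (2 * n)} {u : Unit} :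
    pos (Sum.inr u : IdxV n) < pos (Sum.inl i : IdxV n) ↔ n ≤ (i : ℕ) := by
  simp only [pos_inl, pos_inr]
  split_ifs <;> omega

theorem sum_idxV {n : ℕ} {M : Type} [AddCommMonoid M] (f : IdxV n → M) :
    ∑ i, f i = ∑ i, f (Sum.inl i) + f (Sum.inr ()) := by
  simp [Fintype.sum_sum_type]

/-- Half the sum of the positive even roots minus half the sum of the positive odd roots, doubled
and as a function on the basis of `V`. -/
def twoRho {n : ℕ} : IdxV n → ℤ := Sum.elim (fun i => 2 * n - 1 - 2 * (i : ℕ)) (fun _ => 0)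

section HighestWeight

variable {n : ℕ} {U : Type} [AddCommGroup U] [Module ℂ U]

/-- The set of lowering operators. -/
def spoLow (φ : Matrix (IdxV n) (IdxV n) ℂ →ₗ[ℂ] Module.End ℂ U) : Set (Module.End ℂ U) :=
  {Y | ∃ i j : IdxV n, pos j < pos i ∧ Y = φ (spoGen i j)}

/-- `g` is a highest weight vector of weight `μ`, considered as an odd function on the basis of
`V`. -/
structure IsHW (φ : Matrix (IdxV n) (IdxV n) ℂ →ₗ[ℂ] Module.End ℂ U) (μ : IdxV n → ℤ) (g : U) :
    Prop where
  ne_zero : g ≠ 0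
  weight : ∀ i, φ (spoGen i i) g = (μ i : ℂ) • g
  upper : ∀ i j : IdxV n, pos i < pos j → φ (spoGen i j) g = 0

/-- The operator `∑ c_i (E_{i,i} - E_{i',i'})`. -/
def cartanOp (φ : Matrix (IdxV n) (IdxV n) ℂ →ₗ[ℂ] Module.End ℂ U) (c : IdxV n → ℤ) :
    Module.End ℂ U := ∑ i, (c i : ℂ) • φ (spoGen i i)

variable {φ : Matrix (IdxV n) (IdxV n) ℂ →ₗ[ℂ] Module.End ℂ U} {μ : IdxV n → ℤ} {g : U}

theorem cartanOp_eq {c : IdxV n → ℤ} (hc : ∀ i, c (bar i) = -c i) :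
    cartanOp φ c = φ (Matrix.diagonal fun i => 2 * (c i : ℂ)) := by
  rw [cartanOp]
  simp only [← map_smul, ← map_sum]
  congr 1
  ext k l
  rw [Matrix.sum_apply]
  simp only [Matrix.smul_apply, spoGen_self]
  by_cases hkl : k = l
  · subst hkl
    have e : ∀ i, (k = bar i) ↔ (i = bar k) := by
      intro i
      constructor <;> rintro rfl <;> simp
    simp only [Matrix.diagonal_apply_eq, smul_eq_mul, mul_sub, mul_ite, mul_one, mul_zero,
      Finset.sum_sub_distrib, Finset.sum_ite_eq, Finset.mem_univ, if_true, e,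
      Finset.sum_ite_eq', hc]
    push_cast
    ring
  · simp [Matrix.diagonal_apply_ne _ hkl]

theorem cartanOp_apply (hμ : ∀ i, φ (spoGen i i) g = (μ i : ℂ) • g) (c : IdxV n → ℤ) :
    cartanOp φ c g = ((∑ i, c i * μ i : ℤ) : ℂ) • g := by
  simp only [cartanOp, LinearMap.sum_apply, LinearMap.smul_apply, hμ, smul_smul]
  rw [← Finset.sum_smul]
  push_cast
  rfl

theorem IsSuperHom.cartanOp_apply_spoGen (h : IsSuperHom φ) {c : IdxV n → ℤ}
    (hc : ∀ i, c (bar i) = -c i) (i j : IdxV n) (v : U) :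
    cartanOp φ c (φ (spoGen i j) v) = φ (spoGen i j) (cartanOp φ c v) +
      ((2 * (c i - c j) : ℤ) : ℂ) • φ (spoGen i j) v := by
  rw [cartanOp_eq hc, ← Module.End.mul_apply, h.cartan_mul_spoGen]
  · rw [LinearMap.add_apply, Module.End.mul_apply, LinearMap.smul_apply]
    congr 2
    push_cast
    ring
  · intro i
    rw [hc]
    push_cast
    ring

theorem IsHW.weight_bar (hg : IsHW φ μ g) (i : IdxV n) : μ (bar i) = -μ i := by
  have h : spoGen (bar i) (bar i) = -spoGen i i := by
    rw [spoGen_self, spoGen_self, Matrix.diagonal_neg]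
    congr 1
    funext k
    rw [bar_bar]
    exact (neg_sub _ _).symm
  have h2 := hg.weight (bar i)
  rw [h, map_neg, LinearMap.neg_apply, hg.weight, ← neg_smul] at h2
  have h3 := smul_left_injective ℂ hg.ne_zero h2
  have h4 : -μ i = μ (bar i) := by exact_mod_cast h3
  exact h4.symm

theorem IsHW.weight_inr (hg : IsHW φ μ g) (i : Unit) : μ (Sum.inr i) = 0 := by
  have := hg.weight_bar (Sum.inr i)
  have e : bar (Sum.inr i : IdxV n) = Sum.inr i := rfl
  rw [e] at this
  omega

theorem IsHW.apply_apply (h : IsSuperHom φ) (hg : IsHW φ μ g) {i j : IdxV n}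
    (hij : pos i < pos j) : φ (spoGen i j) (φ (spoGen j i) g) =
      (rootMult i j * (μ i - sgn (parV n i + parV n j) * μ j)) • g := by
  have hne : i ≠ j := by
    rintro rfl
    exact lt_irrefl _ hij
  rw [← Module.End.mul_apply, h.spoGen_mul_spoGen hne]
  simp only [LinearMap.add_apply, LinearMap.smul_apply, Module.End.mul_apply, hg.upper i j hij,
    map_zero, smul_zero, zero_add, LinearMap.sub_apply, hg.weight, smul_smul, ← sub_smul]

/-- The index i is the smaller one in N - 1 - i pairs and the larger one in i pairs. -/
theorem sum_lt_sub {N : ℕ} (m : Fin N → ℂ) :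
    ∑ i, ∑ j, (if i < j then m i - m j else 0) = ∑ i : Fin N, m i * (N - 1 - 2 * (i : ℕ)) := by
  have h1 : ∀ i j, (if i < j then m i - m j else 0) =
      (if i < j then m i else 0) - if i < j then m j else 0 := by
    intro i j
    split_ifs <;> simp
  simp only [h1, Finset.sum_sub_distrib]
  rw [Finset.sum_comm (f := fun i j => if i < j then m j else 0), ← Finset.sum_sub_distrib]
  refine Finset.sum_congr rfl fun i _ => ?_
  have e1 : (Finset.univ.filter fun j => i < j) = Finset.Ioi i := by ext; simp
  have e2 : (Finset.univ.filter fun j => j < i) = Finset.Iio i := by ext; simp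
  rw [← Finset.sum_filter, ← Finset.sum_filter, Finset.sum_const, Finset.sum_const, e1, e2,
    Fin.card_Ioi, Fin.card_Iio, nsmul_eq_mul, nsmul_eq_mul]
  have := i.2
  rw [Nat.cast_sub (by omega), Nat.cast_sub (by omega)]
  push_cast
  ring

/-- Only terms whose right factor does not raise survive. The diagonal terms give ∑ μ_i², and the
others are commutators that assemble into 2ρ. -/
theorem IsHW.casimir_apply (h : IsSuperHom φ) (hg : IsHW φ μ g) :
    casimir φ g = ((∑ i, μ i * (μ i + twoRho i) : ℤ) : ℂ) • g := by
  have h1 : ∀ i j : IdxV n, (sgn (parV n j) • (φ (spoGen i j) * φ (spoGen j i))) g =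
      ((if i = j then sgn (parV n j) * ((μ i : ℂ) * μ i) else 0) +
      if pos i < pos j then sgn (parV n j) *
        (rootMult i j * (μ i - sgn (parV n i + parV n j) * μ j)) else 0) • g := by
    intro i j
    rw [LinearMap.smul_apply, Module.End.mul_apply]
    rcases lt_trichotomy (pos i) (pos j) with hij | hij | hij
    · rw [hg.apply_apply h hij, if_neg, if_pos hij, zero_add, smul_smul]
      rintro rfl
      exact lt_irrefl _ hij
    · have := pos_injective n hij
      subst this
      rw [if_pos rfl, if_neg (lt_irrefl _), add_zero, hg.weight, map_smul, hg.weight, smul_smul,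
        smul_smul, mul_assoc]
    · rw [hg.upper j i hij, map_zero, smul_zero, if_neg, if_neg hij.not_gt, add_zero, zero_smul]
      rintro rfl
      exact lt_irrefl _ hij
  simp only [casimir, LinearMap.sum_apply, h1, ← Finset.sum_smul]
  congr 1
  have hz : (μ (Sum.inr ()) : ℂ) = 0 := by rw [hg.weight_inr]; simp
  have hm : ∀ i : Fin (2 * n), (μ (Sum.inl i.rev) : ℂ) = -μ (Sum.inl i) := by
    intro i
    have : μ (Sum.inl i.rev) = -μ (Sum.inl i) := hg.weight_bar (Sum.inl i)
    rw [this]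
    simp
  simp only [Finset.sum_add_distrib, Finset.sum_ite_eq, Finset.mem_univ, if_true,
    sum_idxV, hz, pos_inl_lt, pos_inl_lt_inr, pos_inr_lt_inl, lt_irrefl, if_false]
  -- The even pairs give ∑_{i<j} (μ_i - μ_j), and each long root contributes an extra 2 μ_i.
  have s1 : ∀ i j : Fin (2 * n), (if i < j then sgn (parV n (Sum.inl j)) *
      (rootMult (Sum.inl i) (Sum.inl j) * ((μ (Sum.inl i) : ℂ) -
        sgn (parV n (Sum.inl i) + parV n (Sum.inl j)) * μ (Sum.inl j))) else 0) =
      (if i < j then (μ (Sum.inl i) : ℂ) - μ (Sum.inl j) else 0) +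
        if j = i.rev then (if (i : ℕ) < n then 2 * (μ (Sum.inl i) : ℂ) else 0) else 0 := by
    intro i j
    have e1 : (Sum.inl j : IdxV n) = bar (Sum.inl i) ↔ j = i.rev := by simp [bar]
    have e3 : parV n (Sum.inl i) = 0 := rfl
    have e4 : parV n (Sum.inl j) = 0 := rfl
    rw [rootMult, e3, e4, add_zero, sgn_zero]
    simp only [e1]
    by_cases hj : j = i.rev
    · subst hj
      have e2 : i < i.rev ↔ (i : ℕ) < n := by
        rw [Fin.lt_def, Fin.val_rev]
        omega
      simp only [e2, if_true, hm]
      split_ifs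
      · ring
      · ring
    · simp only [if_neg hj, add_zero, one_mul]
  -- The pairs with u_{2n+1} enter with a minus sign. Counted from both sides (`s2` and `s3`), they
  -- cancel the extra contribution of the long roots, which leaves the coefficient 2n - 1 - 2i of
  -- `twoRho`.
  have s2 : ∀ i : Fin (2 * n), (if (i : ℕ) < n then
      sgn (parV n (Sum.inr ())) * (rootMult (Sum.inl i) (Sum.inr ()) * ((μ (Sum.inl i) : ℂ) -
        sgn (parV n (Sum.inl i) + parV n (Sum.inr ())) * 0)) else 0) =
      -(if (i : ℕ) < n then (μ (Sum.inl i) : ℂ) else 0) := by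
    intro i
    have e : rootMult (Sum.inl i) (Sum.inr () : IdxV n) = 1 := if_neg (by simp [bar])
    have e2 : parV n (Sum.inr ()) = 1 := rfl
    rw [e, e2, sgn_one]
    by_cases hi : (i : ℕ) < n
    · rw [if_pos hi, if_pos hi]
      ring
    · rw [if_neg hi, if_neg hi, neg_zero]
  have s3 : ∑ j : Fin (2 * n), (if n ≤ (j : ℕ) then
      sgn (parV n (Sum.inl j)) * (rootMult (Sum.inr ()) (Sum.inl j) * (0 -
        sgn (parV n (Sum.inr ()) + parV n (Sum.inl j)) * (μ (Sum.inl j) : ℂ))) else 0) =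
      ∑ i : Fin (2 * n), -(if (i : ℕ) < n then (μ (Sum.inl i) : ℂ) else 0) := by
    rw [← Equiv.sum_comp Fin.revPerm]
    refine Finset.sum_congr rfl fun i _ => ?_
    rw [Fin.revPerm_apply, hm]
    have e : rootMult (Sum.inr ()) (Sum.inl i.rev : IdxV n) = 1 := if_neg (by simp [bar])
    have e2 : parV n (Sum.inr ()) = 1 := rfl
    have e3 : parV n (Sum.inl i.rev) = 0 := rfl
    rw [e, e2, e3, sgn_zero, add_zero, sgn_one, Fin.val_rev]
    have := i.2
    by_cases hi : (i : ℕ) < n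
    · rw [if_pos hi, if_pos (by omega)]
      ring
    · rw [if_neg hi, if_neg (by omega), neg_zero]
  simp only [s2, s3, s1, Finset.sum_add_distrib, Finset.sum_ite_eq', Finset.mem_univ, if_true,
    sum_lt_sub]
  have e0 : ∀ j : Fin (2 * n), sgn (parV n (Sum.inl j)) = 1 := fun _ => sgn_zero
  simp only [e0, hg.weight_inr, twoRho, Sum.elim_inl, Finset.sum_neg_distrib]
  have e5 : ∑ i : Fin (2 * n), (if (i : ℕ) < n then 2 * (μ (Sum.inl i) : ℂ) else 0) =
      (∑ i : Fin (2 * n), if (i : ℕ) < n then (μ (Sum.inl i) : ℂ) else 0) +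
        ∑ i : Fin (2 * n), if (i : ℕ) < n then (μ (Sum.inl i) : ℂ) else 0 := by
    rw [← Finset.sum_add_distrib]
    refine Finset.sum_congr rfl fun i _ => ?_
    split_ifs
    · rw [two_mul]
    · rw [add_zero]
  rw [e5]
  push_cast
  simp only [mul_add, Finset.sum_add_distrib, one_mul, mul_zero, zero_mul, add_zero]
  abel

theorem IsSuperHom.casimir_apply_of_mem_cyc (h : IsSuperHom φ) {c : ℂ}
    (hg : casimir φ g = c • g) {v : U} (hv : v ∈ cyc (spoLow φ) g) : casimir φ v = c • v := by
  have : cyc (spoLow φ) g ≤ LinearMap.eqLocus (casimir φ) (c • LinearMap.id) := by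
    refine cyc_le hg ?_
    rintro _ ⟨i, j, -, rfl⟩ v hv
    rw [LinearMap.mem_eqLocus, LinearMap.smul_apply, LinearMap.id_apply] at hv ⊢
    rw [← Module.End.mul_apply, ← h.mul_casimir (spoGen_mem_homPart i j) (spoGen_mem i j),
      Module.End.mul_apply, hv, map_smul]
  exact this hv

theorem IsSuperHom.apply_mem_cyc_of_mem_spo (h : IsSuperHom φ) (hg : IsHW φ μ g)
    {X : Matrix (IdxV n) (IdxV n) ℂ} (hX : X ∈ (spo n).toSubmodule) {v : U}
    (hv : v ∈ cyc (spoLow φ) g) : φ X v ∈ cyc (spoLow φ) g := by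
  have hgen : ∀ i j, φ (spoGen i j) ∈
      Submodule.span ℂ (Set.range fun x : IdxV n × IdxV n => φ (spoGen x.1 x.2)) :=
    fun i j => Submodule.subset_span ⟨(i, j), rfl⟩
  refine cyc_invariant (hom := Set.range fun x : IdxV n × IdxV n => φ (spoGen x.1 x.2))
    (g := g) ?_ ?_ ?_ hv
  · rintro _ ⟨⟨i, j⟩, rfl⟩ Y ⟨k, l, -, rfl⟩
    refine ⟨_, _, ?_, h.mul_spoGen (spoGen_mem_homPart i j) (spoGen_mem i j) k l⟩
    exact Submodule.sub_mem _ (Submodule.sum_mem _ fun _ _ => Submodule.smul_mem _ _ (hgen _ _))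
      (Submodule.smul_mem _ _ (Submodule.sum_mem _ fun _ _ => Submodule.smul_mem _ _ (hgen _ _)))
  · rintro _ ⟨⟨i, j⟩, rfl⟩
    rcases lt_trichotomy (pos i) (pos j) with hij | hij | hij
    · dsimp only
      rw [hg.upper i j hij]
      exact Submodule.zero_mem _
    · have := pos_injective n hij
      subst this
      dsimp only
      rw [hg.weight]
      exact Submodule.smul_mem _ _ self_mem_cyc
    · have hlow : φ (spoGen i j) ∈ spoLow φ := ⟨i, j, hij, rfl⟩
      exact apply_mem_cyc hlow self_mem_cyc
  · rw [eq_sum_spoGen hX]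
    simp only [map_sum, map_smul]
    exact Submodule.sum_mem _ fun _ _ => Submodule.sum_mem _ fun _ _ =>
      Submodule.smul_mem _ _ (hgen _ _)

/-! ### Unitarity over sp(2n), dominance and irreducibility. -/

variable {F : U →ₗ⋆[ℂ] U →ₗ[ℂ] ℂ}

/-- The indices are even because the odd part of spo(2n|1) is not stable under conjugate
transposition: the Fock form is contravariant only for sp(2n). -/
theorem spoGen_conjTranspose (i j : Fin (2 * n)) :
    (spoGen (Sum.inl i) (Sum.inl j) : Matrix (IdxV n) (IdxV n) ℂ).conjTranspose =
      spoGen (Sum.inl j) (Sum.inl i) := by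
  ext k l
  rw [Matrix.conjTranspose_apply, spoGen_apply, spoGen_apply]
  have e1 : (Sum.inl i = l ∧ Sum.inl j = k) ↔ (Sum.inl j = k ∧ Sum.inl i = l) := and_comm
  have e2 : (Sum.inl i = bar k ∧ Sum.inl j = bar l) ↔ (Sum.inl j = bar l ∧ Sum.inl i = bar k) :=
    and_comm
  simp only [e1, e2]
  have e3 : (Sum.inl j = bar l ∧ Sum.inl i = bar k) → star (tsgn l k) = tsgn k l := by
    rintro ⟨h1, h2⟩
    have hk : parV n k = 0 := by
      rw [← parV_bar, ← h2]
      rfl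
    have hl : parV n l = 0 := by
      rw [← parV_bar, ← h1]
      rfl
    have hb : ∀ x : IdxV n, star (bsgn x) = bsgn x := by
      rintro (x | x)
      · simp only [bsgn, Sum.elim_inl]
        split_ifs <;> simp
      · simp [bsgn]
    rw [tsgn, tsgn, hk, hl, star_mul', star_mul', hb, hb, star_sgn,
      mul_comm (bsgn (bar l))]
  rw [star_sub, star_mul']
  split_ifs with h1 h2 h2
  · rw [e3 h2]
    simp
  · simp
  · rw [e3 h2]
    simp
  · simp

/-- The norm of the lowered vector equals a positive multiple of (μ_i - μ_j) times the norm of `g`,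
and norms are nonnegative. -/
theorem IsHW.dominant (h : IsSuperHom φ) (hg : IsHW φ μ g) (hF : ∀ v, v ≠ 0 → 0 < (F v v).re)
    (hadj : ∀ X v w, F (φ X v) w = F v (φ X.conjTranspose w)) {i j : Fin (2 * n)} (hij : i < j) :
    μ (Sum.inl j) ≤ μ (Sum.inl i) := by
  have h1 := hg.apply_apply h (pos_inl_lt.2 hij)
  have h2 := hadj (spoGen (Sum.inl j) (Sum.inl i)) g (φ (spoGen (Sum.inl j) (Sum.inl i)) g)
  rw [spoGen_conjTranspose, h1, map_smul, smul_eq_mul] at h2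
  have h3 : 0 ≤ (F (φ (spoGen (Sum.inl j) (Sum.inl i)) g)
      (φ (spoGen (Sum.inl j) (Sum.inl i)) g)).re := by
    by_cases h0 : φ (spoGen (Sum.inl j) (Sum.inl i)) g = 0
    · rw [h0, map_zero]
      exact le_rfl
    · exact (hF _ h0).le
  have e3 : sgn (parV n (Sum.inl i) + parV n (Sum.inl j)) = 1 := by
    have : parV n (Sum.inl i) + parV n (Sum.inl j) = 0 := add_zero 0
    rw [this, sgn_zero]
  obtain ⟨r, hr, hr'⟩ : ∃ r : ℝ, 0 < r ∧ rootMult (Sum.inl i) (Sum.inl j : IdxV n) = r := by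
    unfold rootMult
    split_ifs
    · exact ⟨2, by norm_num, by simp⟩
    · exact ⟨1, by norm_num, by simp⟩
  rw [h2, e3, hr', one_mul] at h3
  have e4 : ((r : ℂ) * ((μ (Sum.inl i) : ℂ) - μ (Sum.inl j)) * F g g).re =
      r * ((μ (Sum.inl i) : ℝ) - μ (Sum.inl j)) * (F g g).re := by
    have : (r : ℂ) * ((μ (Sum.inl i) : ℂ) - μ (Sum.inl j)) =
        ((r * ((μ (Sum.inl i) : ℝ) - μ (Sum.inl j)) : ℝ) : ℂ) := by push_cast; rfl
    rw [this, Complex.re_ofReal_mul]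
  rw [e4] at h3
  have h5 := nonneg_of_mul_nonneg_left h3 (hF g hg.ne_zero)
  have h6 := nonneg_of_mul_nonneg_right h5 hr
  have h7 : (μ (Sum.inl j) : ℝ) ≤ μ (Sum.inl i) := by linarith
  exact_mod_cast h7

theorem IsHW.pos_low (h : IsSuperHom φ) (hg : IsHW φ μ g) (hF : ∀ v, v ≠ 0 → 0 < (F v v).re)
    (hadj : ∀ X v w, F (φ X v) w = F v (φ X.conjTranspose w)) {i : Fin (2 * n)}
    (hi : (i : ℕ) < n) : 0 ≤ μ (Sum.inl i) := by
  have h1 : i < i.rev := by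
    rw [Fin.lt_def, Fin.val_rev]
    omega
  have h2 := hg.dominant h hF hadj h1
  have h3 : μ (Sum.inl i.rev) = -μ (Sum.inl i) := hg.weight_bar (Sum.inl i)
  omega

theorem twoRho_bar (i : IdxV n) : (twoRho (bar i) : ℤ) = -twoRho i := by
  rcases i with i | i
  · have := i.2
    simp only [twoRho, bar, Sum.map_inl, Sum.elim_inl, Fin.val_rev]
    omega
  · rfl

/-- Both weights are dominant, and 2ρ = (2n-1, …, 3, 1) is strictly decreasing with positive
entries, so μ + ν + 2ρ is positive on every positive root, the odd ones included. -/
theorem IsHW.strictAnti (h : IsSuperHom φ) {ν : IdxV n → ℤ} {v : U} (hg : IsHW φ μ g)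
    (hv : IsHW φ ν v) (hF : ∀ v, v ≠ 0 → 0 < (F v v).re)
    (hadj : ∀ X v w, F (φ X v) w = F v (φ X.conjTranspose w)) {i j : IdxV n}
    (hij : pos i < pos j) : μ j + ν j + twoRho j < μ i + ν i + twoRho i := by
  have hi : ∀ i : Fin (2 * n), n ≤ (i : ℕ) → μ (Sum.inl i) ≤ 0 ∧ ν (Sum.inl i) ≤ 0 := by
    intro i hi
    have h1 : μ (Sum.inl i.rev) = -μ (Sum.inl i) := hg.weight_bar (Sum.inl i)
    have h2 : ν (Sum.inl i.rev) = -ν (Sum.inl i) := hv.weight_bar (Sum.inl i)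
    have hlt : ((i.rev : Fin (2 * n)) : ℕ) < n := by
      rw [Fin.val_rev]
      omega
    have h3 := hg.pos_low h hF hadj hlt
    have h4 := hv.pos_low h hF hadj hlt
    omega
  rcases i with i | i <;> rcases j with j | j
  · rw [pos_inl_lt] at hij
    have h1 := hg.dominant h hF hadj hij
    have h2 := hv.dominant h hF hadj hij
    rw [Fin.lt_def] at hij
    simp only [twoRho, Sum.elim_inl]
    omega
  · rw [hg.weight_inr, hv.weight_inr]
    rw [pos_inl, pos_inr] at hij
    have hi : (i : ℕ) < n := by
      split_ifs at hij <;> omega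
    have h1 := hg.pos_low h hF hadj hi
    have h2 := hv.pos_low h hF hadj hi
    simp only [twoRho, Sum.elim_inl, Sum.elim_inr]
    omega
  · rw [hg.weight_inr, hv.weight_inr]
    rw [pos_inl, pos_inr] at hij
    have hj : n ≤ (j : ℕ) := by
      split_ifs at hij <;> omega
    have h1 := hi j hj
    simp only [twoRho, Sum.elim_inl, Sum.elim_inr]
    omega
  · exact absurd hij (lt_irrefl _)

theorem IsSuperHom.cartanOp_lower (h : IsSuperHom φ) {c : IdxV n → ℤ}
    (hc : ∀ i, c (bar i) = -c i) (hc' : ∀ i j, pos i < pos j → c j < c i) :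
    ∀ Y ∈ spoLow φ, ∃ s : ℤ, 0 < s ∧ ∀ v, cartanOp φ c (Y v) =
      Y (cartanOp φ c v) - (s : ℂ) • Y v := by
  rintro _ ⟨i, j, hij, rfl⟩
  refine ⟨2 * (c j - c i), by have := hc' j i hij; omega, fun v => ?_⟩
  rw [h.cartanOp_apply_spoGen hc, sub_eq_add_neg (φ (spoGen i j) (cartanOp φ c v)), ← neg_smul]
  congr 2
  push_cast
  ring

/-- A cyclic highest weight module on which `sp(2n)` acts unitarily is irreducible. -/
theorem IsHW.eq_cyc_of_ne_bot (h : IsSuperHom φ) (hg : IsHW φ μ g)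
    (hF : ∀ v, v ≠ 0 → 0 < (F v v).re) (hadj : ∀ X v w, F (φ X v) w = F v (φ X.conjTranspose w))
    {N : Submodule ℂ U} (hle : N ≤ cyc (spoLow φ) g) (hne : N ≠ ⊥)
    (hN : ∀ X ∈ (spo n).toSubmodule, ∀ v ∈ N, φ X v ∈ N) : N = cyc (spoLow φ) g := by
  -- An odd function decreasing strictly along the ordered basis; its pairing with weights serves as
  -- the height.
  set p : IdxV n → ℤ := fun i => n - pos i with hp
  have hpb : ∀ i, p (bar i) = -p i := by
    intro i
    have := pos_add_pos_bar i
    simp only [hp]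
    omega
  have hpa : ∀ i j, pos i < pos j → p j < p i := by
    intro i j hij
    simp only [hp]
    omega
  have hcyc : cyc (spoLow φ) g ≤ ⨆ μ, weightSpace (fun i => φ (spoGen i i)) μ := by
    refine cyc_le_iSup_weightSpace (μ := μ) hg.weight ?_
    rintro _ ⟨i, j, -, rfl⟩
    refine ⟨fun k => ((if i = k then 1 else 0) - if i = bar k then 1 else 0) -
      ((if j = k then 1 else 0) - if j = bar k then 1 else 0), fun k v => ?_⟩
    dsimp only
    rw [← Module.End.mul_apply, spoGen_self k, h.cartan_mul_spoGen]
    · rw [LinearMap.add_apply, Module.End.mul_apply, LinearMap.smul_apply]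
      congr 2
      push_cast
      rfl
    · intro l
      have e1 : bar l = bar k ↔ l = k := (bar_involutive n).injective.eq_iff
      have e2 : bar l = k ↔ l = bar k := by
        constructor <;> rintro rfl <;> simp
      rw [neg_sub]
      simp only [e1, e2]
  obtain ⟨ν, v, hv, hv0, hν, hmax⟩ := exists_highest_vector
    (H := fun i => φ (spoGen i i)) (N := N) (fun i => hN _ (spoGen_mem i i)) (hle.trans hcyc) hne
    (fun ν => ∑ i, p i * ν i) (∑ i, p i * μ i) (by
      intro ν v hv hv0 hν
      rcases lt_or_mem_span_of_mem_cyc (cartanOp_apply hg.weight p)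
        (h.cartanOp_lower hpb hpa) (hle hv) hv0 (cartanOp_apply hν p) with h1 | h1
      · exact h1.le
      · exact h1.1.le)
  -- A nonzero raised vector would lie in N and have larger height. Its weight is not written out:
  -- it is read off from the line that the vector spans.
  have hvHW : IsHW φ ν v := by
    refine ⟨hv0, hν, fun i j hij => ?_⟩
    by_contra hw0
    have hw := hN _ (spoGen_mem i j) v hv
    have hk := h.cartanOp_apply_spoGen hpb i j v
    obtain ⟨ν', u, hu, hu0, hν'⟩ := exists_weight_vector (H := fun i => φ (spoGen i i))
      (N := Submodule.span ℂ {φ (spoGen i j) v}) (by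
        intro k w hw
        obtain ⟨c, rfl⟩ := Submodule.mem_span_singleton.1 hw
        rw [map_smul]
        refine Submodule.smul_mem _ _ ?_
        have e := h.cartan_mul_spoGen (d := fun l =>
          ((if l = k then 1 else 0) - if l = bar k then 1 else 0 : ℂ)) (by
            intro l
            have e1 : bar l = bar k ↔ l = k := (bar_involutive n).injective.eq_iff
            have e2 : bar l = k ↔ l = bar k := by
              constructor <;> rintro rfl <;> simp
            rw [neg_sub]
            simp only [e1, e2]) i j
        rw [← spoGen_self] at e
        rw [← Module.End.mul_apply, e, LinearMap.add_apply, Module.End.mul_apply, hν k, map_smul,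
          LinearMap.smul_apply, ← add_smul]
        exact Submodule.smul_mem _ _ (Submodule.mem_span_singleton_self _))
      ((Submodule.span_singleton_le_iff_mem _ _).2 (hcyc (hle hw)))
      (by rwa [Ne, Submodule.span_singleton_eq_bot])
    obtain ⟨c, rfl⟩ := Submodule.mem_span_singleton.1 hu
    refine hu0 (hmax ν' _ (N.smul_mem c hw) hν' ?_)
    have h1 := cartanOp_apply hν' p
    rw [map_smul, hk, cartanOp_apply hν p, map_smul, ← add_smul, smul_comm] at h1
    have h2 := smul_left_injective ℂ hu0 h1
    have h3 : ∑ i, p i * ν i + 2 * (p i - p j) = ∑ i, p i * ν' i := by exact_mod_cast h2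
    have := hpa i j hij
    omega
  have hcas : (∑ i, ν i * (ν i + twoRho i) : ℤ) = ∑ i, μ i * (μ i + twoRho i) := by
    have h1 := h.casimir_apply_of_mem_cyc (hg.casimir_apply h) (hle hv)
    rw [hvHW.casimir_apply h] at h1
    have h2 := smul_left_injective ℂ hv0 h1
    exact_mod_cast h2
  -- Equality of the Casimir values says that μ and ν pair equally with c = μ + ν + 2ρ. Since c
  -- decreases strictly along the basis, lowering operators strictly lower the eigenvalue of
  -- `cartanOp φ c`, whose top value occurs only on the line of `g`.
  set c : IdxV n → ℤ := fun i => μ i + ν i + twoRho i with hc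
  have heq : ∑ i, c i * ν i = ∑ i, c i * μ i := by
    have h1 : ∀ i, c i * ν i = ν i * (ν i + twoRho i) + μ i * ν i := fun i => by
      simp only [hc]
      ring
    have h2 : ∀ i, c i * μ i = μ i * (μ i + twoRho i) + μ i * ν i := fun i => by
      simp only [hc]
      ring
    simp only [h1, h2, Finset.sum_add_distrib, hcas]
  rcases lt_or_mem_span_of_mem_cyc (cartanOp_apply hg.weight c)
    (h.cartanOp_lower (fun i => by
      simp only [hc, hg.weight_bar, hvHW.weight_bar, twoRho_bar]
      ring) fun i j hij => hg.strictAnti h hvHW hF hadj hij)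
    (hle hv) hv0 (cartanOp_apply hν c) with h1 | h1
  · exact absurd heq h1.ne
  · obtain ⟨b, rfl⟩ := Submodule.mem_span_singleton.1 h1.2
    have hb : b ≠ 0 := by
      rintro rfl
      simp at hv0
    have hgN := N.smul_mem b⁻¹ hv
    rw [smul_smul, inv_mul_cancel₀ hb, one_smul] at hgN
    refine le_antisymm hle (cyc_le hgN ?_)
    rintro _ ⟨i, j, -, rfl⟩
    exact hN _ (spoGen_mem i j)

end HighestWeight

/-! ### The joint highest weight vectors -/

/-- The basis vector at position `p ≤ n`. -/
def atPos (n p : ℕ) : IdxV n := if h : p < n then Sum.inl ⟨p, by omega⟩ else Sum.inr ()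

theorem pos_atPos {n p : ℕ} (hp : p ≤ n) : pos (atPos n p) = p := by
  unfold atPos
  split_ifs with h
  · rw [pos_inl, if_pos h]
  · rw [pos_inr]
    omega

theorem parV_of_pos_lt {n : ℕ} {i : IdxV n} (h : pos i < n) : parV n i = 0 := by
  rcases i with i | i
  · rfl
  · rw [pos_inr] at h
    omega

theorem eq_atPos {n p : ℕ} (hp : p ≤ n) {i : IdxV n} (h : pos i = p) : i = atPos n p :=
  pos_injective n (h.trans (pos_atPos hp).symm)

section FockVectors

variable {n : ℕ} {U : Type} [AddCommGroup U] [Module ℂ U] (m d : IdxE n → Module.End ℂ U) (v₀ : U)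

/-- The product of the `u_i ⊗ w_1` over the first `p` positions. -/
def wedgeVec : ℕ → U
  | 0 => v₀
  | p + 1 => m (atPos n p, 1) (wedgeVec p)

/-- The product of `(u_1 ⊗ v_1)^e` and a vector. -/
def powVec (w : U) : ℕ → U
  | 0 => w
  | e + 1 => m (atPos n 0, 0) (powVec w e)

variable {m d v₀}

theorem SuperCCR.d_m_of_ne (h : SuperCCR (parE n) m d) {x y : IdxE n} (hxy : x ≠ y) (v : U) :
    d x (m y v) = sgn (parE n x * parE n y) • m y (d x v) := by
  rw [← Module.End.mul_apply, h.dm, if_neg hxy, add_zero]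
  rfl

theorem SuperCCR.d_m_self (h : SuperCCR (parE n) m d) (x : IdxE n) (v : U) :
    d x (m x v) = sgn (parE n x * parE n x) • m x (d x v) + v := by
  rw [← Module.End.mul_apply, h.dm, if_pos rfl]
  rfl

theorem SuperCCR.m_m (h : SuperCCR (parE n) m d) (x y : IdxE n) (v : U) :
    m x (m y v) = sgn (parE n x * parE n y) • m y (m x v) := by
  rw [← Module.End.mul_apply, h.mm]
  rfl

theorem SuperCCR.d_wedgeVec (h : SuperCCR (parE n) m d) (hv : ∀ x, d x v₀ = 0) {x : IdxE n} :
    ∀ p : ℕ, (∀ q < p, x ≠ (atPos n q, 1)) → d x (wedgeVec m v₀ p) = 0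
  | 0, _ => hv x
  | p + 1, hx => by
    rw [wedgeVec, h.d_m_of_ne (hx p p.lt_succ_self),
      SuperCCR.d_wedgeVec h hv p fun q hq => hx q (Nat.lt_succ_of_lt hq), map_zero, smul_zero]

theorem SuperCCR.d_powVec (h : SuperCCR (parE n) m d)
    {x : IdxE n} (hx : x ≠ (atPos n 0, 0)) {w : U} (hw : d x w = 0) :
    ∀ e : ℕ, d x (powVec m w e) = 0
  | 0 => hw
  | e + 1 => by rw [powVec, h.d_m_of_ne hx, SuperCCR.d_powVec h hx hw e, map_zero, smul_zero]

/-- Differentiating by the last factor strips it off, because that derivative kills the earlier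
factors. The argument does not depend on the parity of the factor. -/
theorem SuperCCR.wedgeVec_ne_zero (h : SuperCCR (parE n) m d)
    (hv : ∀ x, d x v₀ = 0) (hv0 : v₀ ≠ 0) :
    ∀ p : ℕ, p ≤ n + 1 → wedgeVec m v₀ p ≠ 0
  | 0, _ => hv0
  | p + 1, hp => by
    intro h0
    have h1 := congrArg (d (atPos n p, 1)) h0
    rw [wedgeVec, h.d_m_self, h.d_wedgeVec hv p, map_zero, smul_zero, zero_add, map_zero] at h1
    · exact SuperCCR.wedgeVec_ne_zero h hv hv0 p (by omega) h1
    · intro q hq e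
      have h2 := congrArg (fun x => pos x.1) e
      dsimp only at h2
      rw [pos_atPos (by omega), pos_atPos (by omega)] at h2
      omega

theorem parE_atPos_zero (hn : 1 ≤ n) : parE n (atPos n 0, 0) = 0 := by
  have : parV n (atPos n 0) = 0 := parV_of_pos_lt (by rw [pos_atPos (by omega)]; omega)
  rw [parE, this]
  rfl

theorem SuperCCR.d_powVec_self (h : SuperCCR (parE n) m d)
    (hn : 1 ≤ n) {w : U} (hw : d (atPos n 0, 0) w = 0) :
    ∀ e : ℕ, d (atPos n 0, 0) (powVec m w (e + 1)) = ((e : ℂ) + 1) • powVec m w e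
  | 0 => by
    have e1 : powVec m w (0 + 1) = m (atPos n 0, 0) w := rfl
    have e2 : powVec m w 0 = w := rfl
    rw [e1, e2, h.d_m_self, hw, map_zero, smul_zero, zero_add, Nat.cast_zero, zero_add,
      one_smul]
  | e + 1 => by
    have e1 : m (atPos n 0, 0) (powVec m w e) = powVec m w (e + 1) := rfl
    rw [powVec, h.d_m_self, SuperCCR.d_powVec_self h hn hw e, parE_atPos_zero hn, zero_mul, sgn_zero,
      one_smul, map_smul, e1, Nat.cast_succ, add_smul ((e : ℂ) + 1) (1 : ℂ), one_smul]

theorem SuperCCR.powVec_ne_zero (h : SuperCCR (parE n) m d)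
    (hn : 1 ≤ n) {w : U} (hw : d (atPos n 0, 0) w = 0) (hw0 : w ≠ 0) :
    ∀ e : ℕ, powVec m w e ≠ 0
  | 0 => hw0
  | e + 1 => by
    intro h0
    have h1 := congrArg (d (atPos n 0, 0)) h0
    rw [h.d_powVec_self hn hw, map_zero] at h1
    exact SuperCCR.powVec_ne_zero h hn hw hw0 e
      ((smul_eq_zero.1 h1).resolve_left (by exact_mod_cast e.succ_ne_zero))

/-- Before position n the generators u_i ⊗ w_1 are odd, so a repeated factor gives 0. At position n
the generator u_{2n+1} ⊗ w_1 is even, whence the strict bound. -/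
theorem SuperCCR.m_wedgeVec (h : SuperCCR (parE n) m d) {i : IdxV n} (hi : pos i < n) :
    ∀ p : ℕ, pos i < p → p ≤ n + 1 → m (i, 1) (wedgeVec m v₀ p) = 0
  | 0, hp, _ => absurd hp (by omega)
  | p + 1, hp, hp' => by
    by_cases hip : pos i = p
    · have e := eq_atPos (by omega) hip
      have e2 : parE n (i, 1) = 1 := by
        rw [parE, parV_of_pos_lt hi]
        rfl
      rw [wedgeVec, ← e]
      have h1 := h.m_m (i, 1) (i, 1) (wedgeVec m v₀ p)
      rw [e2, mul_one, sgn_one, neg_one_smul, eq_neg_iff_add_eq_zero, ← two_smul ℂ] at h1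
      exact (smul_eq_zero.1 h1).resolve_left two_ne_zero
    · rw [wedgeVec, h.m_m, SuperCCR.m_wedgeVec h hi p (by omega) (by omega), map_zero, smul_zero]

/-- The joint highest weight vector `(u_1 ⊗ v_1)^e ∏_{p ≤ k} (u_p ⊗ w_1)`. -/
def jointVec (m : IdxE n → Module.End ℂ U) (v₀ : U) (e k : ℕ) : U :=
  powVec m (wedgeVec m v₀ (k + 1)) e

theorem SuperCCR.quad_onE_m (h : SuperCCR (parE n) m d)
    {x : ZMod 2} {X : Matrix (IdxV n) (IdxV n) ℂ}
    (hX : X ∈ homPart (parV n) x) (j : IdxV n) (a : Fin 2) (v : U) :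
    quad m d (onE n X) (m (j, a) v) = sgn (x * parE n (j, a)) • m (j, a) (quad m d (onE n X) v) +
      ∑ i, X i j • m (i, a) v := by
  rw [← Module.End.mul_apply, h.quad_m (onE_mem hX), LinearMap.add_apply, LinearMap.smul_apply,
    Module.End.mul_apply, LinearMap.sum_apply, Fintype.sum_prod_type]
  congr 1
  refine Finset.sum_congr rfl fun i _ => ?_
  rw [Finset.sum_eq_single a]
  · simp [onE_apply]
  · intro b _ hb
    simp [onE_apply, hb]
  · simp

theorem SuperCCR.quad_onE'_m (h : SuperCCR (parE n) m d) {x : ZMod 2} {A : Matrix (Fin 2) (Fin 2) ℂ}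
    (hA : A ∈ homPart parX x) (j : IdxV n) (a : Fin 2) (v : U) :
    quad m d (onE' n A) (m (j, a) v) =
      sgn (x * parE n (j, a)) • m (j, a) (quad m d (onE' n A) v) +
      ∑ b, (sgn ((parX b + parX a) * parV n j) * A b a) • m (j, b) v := by
  rw [← Module.End.mul_apply, h.quad_m (onE'_mem hA), LinearMap.add_apply, LinearMap.smul_apply,
    Module.End.mul_apply, LinearMap.sum_apply, Fintype.sum_prod_type, Finset.sum_comm]
  congr 1
  refine Finset.sum_congr rfl fun b _ => ?_
  rw [Finset.sum_eq_single j]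
  · simp [onE'_apply]
  · intro i _ hi
    simp [onE'_apply, hi]
  · simp

theorem quad_vac (hv : ∀ x, d x v₀ = 0) (A : Matrix (IdxE n) (IdxE n) ℂ) : quad m d A v₀ = 0 := by
  simp [quad_apply, LinearMap.sum_apply, hv]

theorem diagonal_mem_homPart {ι : Type} [Fintype ι] [DecidableEq ι] (p : ι → ZMod 2) (t : ι → ℂ) :
    Matrix.diagonal t ∈ homPart p 0 := by
  intro i j hij
  refine Matrix.diagonal_apply_ne _ ?_
  rintro rfl
  exact hij (CharTwo.add_self_eq_zero _)

/-- The elementary matrix replaces the factor at the position of j by the one at the smaller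
position of i, which already occurs and is odd. -/
theorem SuperCCR.raise_wedgeVec (h : SuperCCR (parE n) m d)
    (hv : ∀ x, d x v₀ = 0) {i j : IdxV n} (hij : pos i < pos j) :
    ∀ p : ℕ, p ≤ n + 1 → quad m d (onE n (Matrix.single i j 1)) (wedgeVec m v₀ p) = 0
  | 0, _ => quad_vac hv _
  | p + 1, hp => by
    rw [wedgeVec, h.quad_onE_m (single_mem_homPart i j),
      SuperCCR.raise_wedgeVec h hv hij p (by omega), map_zero, smul_zero, zero_add]
    refine Finset.sum_eq_zero fun k _ => ?_
    rw [Matrix.single_apply]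
    split_ifs with hk
    · obtain ⟨rfl, rfl⟩ := hk
      rw [pos_atPos (by omega)] at hij
      rw [h.m_wedgeVec (by omega) p hij (by omega), smul_zero]
    · rw [zero_smul]

/-- The further factors u_1 ⊗ v_1 sit at the first position, so nothing can raise them. -/
theorem SuperCCR.raise_jointVec (h : SuperCCR (parE n) m d)
    (hv : ∀ x, d x v₀ = 0) {k : ℕ} (hk : k ≤ n) {i j : IdxV n}
    (hij : pos i < pos j) :
    ∀ e : ℕ, quad m d (onE n (Matrix.single i j 1)) (jointVec m v₀ e k) = 0
  | 0 => h.raise_wedgeVec hv hij _ (by omega)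
  | e + 1 => by
    have ih := SuperCCR.raise_jointVec h hv hk hij e
    rw [jointVec] at ih ⊢
    rw [powVec, h.quad_onE_m (single_mem_homPart i j), ih, map_zero, smul_zero, zero_add]
    refine Finset.sum_eq_zero fun k _ => ?_
    rw [Matrix.single_apply, if_neg, zero_smul]
    rintro ⟨-, rfl⟩
    rw [pos_atPos (by omega)] at hij
    omega

theorem SuperCCR.diagonal_m (h : SuperCCR (parE n) m d)
    (t : IdxV n → ℂ) (i : IdxV n) (a : Fin 2) (v : U) :
    quad m d (onE n (Matrix.diagonal t)) (m (i, a) v) =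
      m (i, a) (quad m d (onE n (Matrix.diagonal t)) v) + t i • m (i, a) v := by
  rw [h.quad_onE_m (diagonal_mem_homPart _ _), zero_mul, sgn_zero, one_smul,
    Finset.sum_eq_single i, Matrix.diagonal_apply_eq]
  · intro j _ hj
    rw [Matrix.diagonal_apply_ne _ hj, zero_smul]
  · simp

theorem SuperCCR.diagonal_wedgeVec (h : SuperCCR (parE n) m d)
    (hv : ∀ x, d x v₀ = 0) (t : IdxV n → ℂ) :
    ∀ p : ℕ, quad m d (onE n (Matrix.diagonal t)) (wedgeVec m v₀ p) =
      (∑ q ∈ Finset.range p, t (atPos n q)) • wedgeVec m v₀ p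
  | 0 => by
    rw [Finset.sum_range_zero, zero_smul]
    exact quad_vac hv _
  | p + 1 => by
    rw [wedgeVec, h.diagonal_m, SuperCCR.diagonal_wedgeVec h hv t p, map_smul, ← add_smul,
      Finset.sum_range_succ]

/-- The weight of `jointVec`. -/
def jointWeight (n e k : ℕ) (i : IdxV n) : ℤ :=
  (if pos i ≤ k then 1 else 0) + if pos i = 0 then (e : ℤ) else 0

theorem sum_jointWeight {k : ℕ} (hk : k ≤ n) (e : ℕ) (t : IdxV n → ℂ) :
    ∑ i, (jointWeight n e k i : ℂ) * t i =
      ∑ q ∈ Finset.range (k + 1), t (atPos n q) + e * t (atPos n 0) := by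
  simp only [jointWeight, Int.cast_add, add_mul, Finset.sum_add_distrib]
  congr 1
  · have h1 : ∀ i : IdxV n, ((if pos i ≤ k then 1 else 0 : ℤ) : ℂ) * t i =
        if pos i ≤ k then t i else 0 := by
      intro i
      split_ifs <;> simp
    simp only [h1]
    rw [← Finset.sum_filter]
    refine Finset.sum_bij (fun i _ => pos i) ?_ ?_ ?_ ?_
    · intro i hi
      rw [Finset.mem_filter] at hi
      rw [Finset.mem_range]
      omega
    · intro i _ j _ hij
      exact pos_injective n hij
    · intro q hq
      rw [Finset.mem_range] at hq
      refine ⟨atPos n q, ?_, pos_atPos (by omega)⟩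
      rw [Finset.mem_filter, pos_atPos (by omega)]
      exact ⟨Finset.mem_univ _, by omega⟩
    · intro i hi
      rw [Finset.mem_filter] at hi
      rw [← eq_atPos (hi.2.trans hk) rfl]
  · rw [Finset.sum_eq_single (atPos n 0)]
    · rw [pos_atPos (by omega), if_pos rfl]
      push_cast
      rfl
    · intro i _ hi
      rw [if_neg fun e => hi (eq_atPos (by omega) e)]
      simp
    · simp

theorem SuperCCR.diagonal_jointVec (h : SuperCCR (parE n) m d)
    (hv : ∀ x, d x v₀ = 0) (t : IdxV n → ℂ) (e : ℕ) {k : ℕ}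
    (hk : k ≤ n) : quad m d (onE n (Matrix.diagonal t)) (jointVec m v₀ e k) =
      (∑ i, (jointWeight n e k i : ℂ) * t i) • jointVec m v₀ e k := by
  rw [sum_jointWeight hk]
  induction e with
  | zero =>
    rw [Nat.cast_zero, zero_mul, add_zero]
    exact h.diagonal_wedgeVec hv t (k + 1)
  | succ e ih =>
    rw [jointVec] at ih ⊢
    rw [powVec, h.diagonal_m, ih, map_smul, ← add_smul]
    congr 1
    push_cast
    ring

theorem SuperCCR.diagonal'_m (h : SuperCCR (parE n) m d)
    (t : Fin 2 → ℂ) (i : IdxV n) (a : Fin 2) (v : U) :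
    quad m d (onE' n (Matrix.diagonal t)) (m (i, a) v) =
      m (i, a) (quad m d (onE' n (Matrix.diagonal t)) v) + t a • m (i, a) v := by
  rw [h.quad_onE'_m (diagonal_mem_homPart _ _), zero_mul, sgn_zero, one_smul,
    Finset.sum_eq_single a, Matrix.diagonal_apply_eq, CharTwo.add_self_eq_zero, zero_mul, sgn_zero,
    one_mul]
  · intro b _ hb
    rw [Matrix.diagonal_apply_ne _ hb, mul_zero, zero_smul]
  · simp

theorem SuperCCR.diagonal'_jointVec (h : SuperCCR (parE n) m d)
    (hv : ∀ x, d x v₀ = 0) (t : Fin 2 → ℂ) (e k : ℕ) :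
    quad m d (onE' n (Matrix.diagonal t)) (jointVec m v₀ e k) =
      (e * t 0 + (k + 1) * t 1) • jointVec m v₀ e k := by
  have h1 : ∀ p : ℕ, quad m d (onE' n (Matrix.diagonal t)) (wedgeVec m v₀ p) =
      (p * t 1) • wedgeVec m v₀ p := by
    intro p
    induction p with
    | zero =>
      rw [Nat.cast_zero, zero_mul, zero_smul]
      exact quad_vac hv _
    | succ p ih =>
      rw [wedgeVec, h.diagonal'_m, ih, map_smul, ← add_smul]
      congr 1
      push_cast
      ring
  induction e with
  | zero =>
    rw [Nat.cast_zero, zero_mul, zero_add]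
    have := h1 (k + 1)
    push_cast at this
    exact this
  | succ e ih =>
    rw [jointVec] at ih ⊢
    rw [powVec, h.diagonal'_m, ih, map_smul, ← add_smul]
    congr 1
    push_cast
    ring

theorem single_mem_homPart_parX (a b : Fin 2) :
    Matrix.single a b (1 : ℂ) ∈ homPart parX (parX a + parX b) := by
  intro k l h
  rw [Matrix.single_apply, if_neg]
  rintro ⟨rfl, rfl⟩
  exact h rfl

/-- The operator turns one factor u_1 ⊗ v_1 into u_1 ⊗ w_1, an odd factor already present. Hence
`jointVec` is a lowest weight vector for gl(1|1); the highest one is obtained by raising it. -/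
theorem SuperCCR.lower'_jointVec (h : SuperCCR (parE n) m d)
    (hn : 1 ≤ n) (hv : ∀ x, d x v₀ = 0) (e : ℕ) {k : ℕ}
    (hk : k ≤ n) : quad m d (onE' n (Matrix.single 1 0 1)) (jointVec m v₀ e k) = 0 := by
  have h1 : ∀ p : ℕ, quad m d (onE' n (Matrix.single 1 0 1)) (wedgeVec m v₀ p) = 0 := by
    intro p
    induction p with
    | zero => exact quad_vac hv _
    | succ p ih =>
      rw [wedgeVec, h.quad_onE'_m (single_mem_homPart_parX 1 0), ih, map_zero, smul_zero, zero_add]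
      simp
  have h0 : pos (atPos n 0) = 0 := pos_atPos (by omega)
  have h2 : ∀ e : ℕ, m (atPos n 0, 1) (powVec m (wedgeVec m v₀ (k + 1)) e) = 0 := by
    intro e
    induction e with
    | zero => exact h.m_wedgeVec (by omega) (k + 1) (by omega) (by omega)
    | succ e ih => rw [powVec, h.m_m, ih, map_zero, smul_zero]
  induction e with
  | zero => exact h1 (k + 1)
  | succ e ih =>
    rw [jointVec] at ih ⊢
    rw [powVec, h.quad_onE'_m (single_mem_homPart_parX 1 0), ih, map_zero, smul_zero, zero_add,
      Fin.sum_univ_two, h2 e]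
    simp

theorem SuperCCR.d_d_comm_zero (h : SuperCCR (parE n) m d)
    {x y : IdxE n} {v : U} (hx : d x v = 0) : d x (d y v) = 0 := by
  rw [← Module.End.mul_apply, h.dd, LinearMap.smul_apply, Module.End.mul_apply, hx, map_zero,
    smul_zero]

theorem SuperCCR.d_jointVec (h : SuperCCR (parE n) m d)
    (hv : ∀ x, d x v₀ = 0) (e : ℕ) {k : ℕ} {x : IdxE n}
    (h1 : ∀ q ≤ k, x ≠ (atPos n q, 1)) (h2 : x ≠ (atPos n 0, 0)) :
    d x (jointVec m v₀ e k) = 0 :=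
  h.d_powVec h2 (h.d_wedgeVec hv _ fun q hq => h1 q (by omega)) e

theorem SuperCCR.jointVec_ne_zero (h : SuperCCR (parE n) m d)
    (hn : 1 ≤ n) (hv : ∀ x, d x v₀ = 0) (hv0 : v₀ ≠ 0) (e : ℕ)
    {k : ℕ} (hk : k ≤ n) : jointVec m v₀ e k ≠ 0 := by
  refine h.powVec_ne_zero hn (h.d_wedgeVec hv _ ?_) (h.wedgeVec_ne_zero hv hv0 _ (by omega)) e
  intro q _ hq
  have := congrArg Prod.snd hq
  simp at this

/-- The positions of u_i and its partner add up to 2n, while only positions up to k ≤ n occur in the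
vector. Both derivatives can matter only for u_{2n+1} at position n, and that generator occurs
linearly. -/
theorem SuperCCR.d_d_jointVec (h : SuperCCR (parE n) m d)
    (hn : 1 ≤ n) (hv : ∀ x, d x v₀ = 0) (e : ℕ) {k : ℕ} (hk : k ≤ n)
    (i : IdxV n) (a b : Fin 2) : d (bar i, b) (d (i, a) (jointVec m v₀ e k)) = 0 := by
  have key : ∀ (i : IdxV n) (a : Fin 2), (¬ ∃ q ≤ k, ((i, a) : IdxE n) = (atPos n q, 1)) →
      ((i, a) : IdxE n) ≠ (atPos n 0, 0) → d (i, a) (jointVec m v₀ e k) = 0 := by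
    intro i a h1 h2
    exact h.d_jointVec hv e (fun q hq e => h1 ⟨q, hq, e⟩) h2
  have hp := pos_add_pos_bar i
  have hfac : ∀ (i : IdxV n) (a : Fin 2), d (i, a) (jointVec m v₀ e k) ≠ 0 →
      pos i ≤ k ∧ (0 < pos i → a = 1) := by
    intro i a h0
    by_cases h1 : ∃ q ≤ k, ((i, a) : IdxE n) = (atPos n q, 1)
    · obtain ⟨q, hq, e⟩ := h1
      rw [Prod.mk.injEq] at e
      rw [e.1, pos_atPos (by omega)]
      exact ⟨hq, fun _ => e.2⟩
    · by_cases h2 : ((i, a) : IdxE n) = (atPos n 0, 0)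
      · rw [Prod.mk.injEq] at h2
        rw [h2.1, pos_atPos (by omega)]
        exact ⟨by omega, fun h => absurd h (lt_irrefl _)⟩
      · exact absurd (key i a h1 h2) h0
  by_cases h1 : d (i, a) (jointVec m v₀ e k) = 0
  · rw [h1, map_zero]
  by_cases h2 : d (bar i, b) (jointVec m v₀ e k) = 0
  · exact h.d_d_comm_zero h2
  have f1 := hfac i a h1
  have f2 := hfac (bar i) b h2
  have hi : pos i = n := by omega
  have hk' : k = n := by omega
  have ei : i = atPos n n := eq_atPos le_rfl hi
  have ebi : bar i = atPos n n := eq_atPos le_rfl (by omega)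
  rw [f1.2 (by omega), f2.2 (by omega), ei, ← ei, ebi, ei, hk']
  have hne : ((atPos n n, 1) : IdxE n) ≠ (atPos n 0, 0) := by simp
  -- The generator u_{2n+1} ⊗ w_1 is even, so it does not square to 0; the second derivative
  -- vanishes because the generator occurs only to the first power.
  have h3 : d (atPos n n, 1) (d (atPos n n, 1) (wedgeVec m v₀ (n + 1))) = 0 := by
    have h4 : d (atPos n n, 1) (wedgeVec m v₀ n) = 0 := by
      refine h.d_wedgeVec hv n fun q hq e => ?_
      have := congrArg (fun x => pos x.1) e
      dsimp only at this
      rw [pos_atPos le_rfl, pos_atPos (by omega)] at this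
      omega
    rw [wedgeVec, h.d_m_self, h4, map_zero, smul_zero, zero_add, h4]
  clear h1 h2 key hfac
  rw [jointVec]
  induction e with
  | zero => exact h3
  | succ e ih =>
    rw [powVec, h.d_m_of_ne hne, map_smul, h.d_m_of_ne hne, ih, map_zero, smul_zero, smul_zero]

end FockVectors

/-! ### Isomorphisms of highest weight modules -/

section Iso

variable {n : ℕ} {U : Type} [AddCommGroup U] [Module ℂ U]
  {φ : Matrix (IdxV n) (IdxV n) ℂ →ₗ[ℂ] Module.End ℂ U} {μ : IdxV n → ℤ} {g g' : U}

/-- Two copies of a representation. -/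
def doubleRep (φ : Matrix (IdxV n) (IdxV n) ℂ →ₗ[ℂ] Module.End ℂ U) :
    Matrix (IdxV n) (IdxV n) ℂ →ₗ[ℂ] Module.End ℂ (U × U) where
  toFun X := (φ X).prodMap (φ X)
  map_add' X Y := by
    rw [map_add]
    rfl
  map_smul' c X := by
    rw [map_smul]
    rfl

theorem doubleRep_apply (X : Matrix (IdxV n) (IdxV n) ℂ) (x : U × U) :
    doubleRep φ X x = (φ X x.1, φ X x.2) := rfl

theorem IsSuperHom.doubleRep (h : IsSuperHom φ) : IsSuperHom (doubleRep φ) := by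
  intro x y X Y hX hY
  have key := h x y X Y hX hY
  refine LinearMap.ext fun v => ?_
  refine Prod.ext ?_ ?_
  · exact LinearMap.congr_fun key v.1
  · exact LinearMap.congr_fun key v.2

theorem IsHW.doubleRep (hg : IsHW φ μ g) (hg' : IsHW φ μ g') :
    IsHW (doubleRep φ) μ (g, g') := by
  refine ⟨fun e => hg.ne_zero (congrArg Prod.fst e), fun i => ?_, fun i j hij => ?_⟩
  · rw [doubleRep_apply, hg.weight, hg'.weight]
    rfl
  · rw [doubleRep_apply, hg.upper i j hij, hg'.upper i j hij]
    rfl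

/-- The orthogonal sum of two copies of a form. -/
def doubleForm (F : U →ₗ⋆[ℂ] U →ₗ[ℂ] ℂ) : U × U →ₗ⋆[ℂ] U × U →ₗ[ℂ] ℂ :=
  LinearMap.mk₂'ₛₗ (starRingEnd ℂ) (RingHom.id ℂ) (fun v w => F v.1 w.1 + F v.2 w.2)
    (fun a b c => by
      simp only [Prod.fst_add, Prod.snd_add, map_add, LinearMap.add_apply]
      abel)
    (fun c a b => by
      simp only [Prod.smul_fst, Prod.smul_snd, LinearMap.map_smulₛₗ, LinearMap.smul_apply,
        smul_add])
    (fun a b c => by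
      simp only [Prod.fst_add, Prod.snd_add, map_add]
      abel)
    (fun c a b => by
      simp only [Prod.smul_fst, Prod.smul_snd, map_smul, smul_add, RingHom.id_apply])

theorem doubleForm_apply (F : U →ₗ⋆[ℂ] U →ₗ[ℂ] ℂ) (v w : U × U) :
    doubleForm F v w = F v.1 w.1 + F v.2 w.2 := rfl

theorem doubleForm_pos {F : U →ₗ⋆[ℂ] U →ₗ[ℂ] ℂ} (hF : ∀ v, v ≠ 0 → 0 < (F v v).re) (v : U × U)
    (hv : v ≠ 0) : 0 < (doubleForm F v v).re := by
  have h0 : ∀ v, 0 ≤ (F v v).re := by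
    intro v
    by_cases hv : v = 0
    · rw [hv, map_zero]
      exact le_rfl
    · exact (hF v hv).le
  rw [doubleForm_apply, Complex.add_re]
  by_cases h1 : v.1 = 0
  · have h2 : v.2 ≠ 0 := fun h2 => hv (Prod.ext h1 h2)
    exact add_pos_of_nonneg_of_pos (h0 _) (hF _ h2)
  · exact add_pos_of_pos_of_nonneg (hF _ h1) (h0 _)

theorem map_cyc {U' : Type} [AddCommGroup U'] [Module ℂ U'] {low : Set (Module.End ℂ U)}
    {low' : Set (Module.End ℂ U')} (p : U →ₗ[ℂ] U') (h1 : ∀ Y' ∈ low', ∃ Y ∈ low,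
      ∀ v, p (Y v) = Y' (p v)) (h2 : ∀ Y ∈ low, ∃ Y' ∈ low', ∀ v, p (Y v) = Y' (p v)) :
    (cyc low g).map p = cyc low' (p g) := by
  refine le_antisymm (Submodule.map_le_iff_le_comap.2 (cyc_le self_mem_cyc ?_))
    (cyc_le ⟨g, self_mem_cyc, rfl⟩ ?_)
  · intro Y hY v hv
    obtain ⟨Y', hY', e⟩ := h2 Y hY
    rw [Submodule.mem_comap, e]
    exact apply_mem_cyc hY' hv
  · rintro Y' hY' _ ⟨v, hv, rfl⟩
    obtain ⟨Y, hY, e⟩ := h1 Y' hY'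
    exact ⟨Y v, apply_mem_cyc hY hv, e v⟩

/-- Highest weight modules of the same highest weight are isomorphic. -/
theorem IsHW.exists_iso (h : IsSuperHom φ) (hg : IsHW φ μ g) (hg' : IsHW φ μ g')
    {F : U →ₗ⋆[ℂ] U →ₗ[ℂ] ℂ} (hF : ∀ v, v ≠ 0 → 0 < (F v v).re)
    (hadj : ∀ X v w, F (φ X v) w = F v (φ X.conjTranspose w)) :
    ∃ T : cyc (spoLow φ) g →ₗ[ℂ] U, T ⟨g, self_mem_cyc⟩ = g' ∧ (∀ v, T v ∈ cyc (spoLow φ) g') ∧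
      Function.Injective T ∧ ∀ Q : Module.End ℂ U,
        (∀ x ∈ cyc (spoLow (SpoHowe.doubleRep φ)) (g, g'),
          (Q x.1, Q x.2) ∈ cyc (spoLow (SpoHowe.doubleRep φ)) (g, g')) →
        ∀ v, ∀ hv : Q v.1 ∈ cyc (spoLow φ) g, T ⟨Q v.1, hv⟩ = Q (T v) := by
  have hD := hg.doubleRep hg'
  -- The module generated by (g, g') in two copies of U is the graph of the isomorphism. It is a
  -- highest weight module and so irreducible; the kernel of each projection is a submodule missing
  -- the generator, hence 0.
  set D := cyc (spoLow (SpoHowe.doubleRep φ)) (g, g') with hDdef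
  have hirr : ∀ N ≤ D, N ≠ ⊥ → (∀ X ∈ (spo n).toSubmodule, ∀ v ∈ N,
      SpoHowe.doubleRep φ X v ∈ N) → N = D := by
    intro N hle hne hN
    refine hD.eq_cyc_of_ne_bot h.doubleRep (doubleForm_pos hF) (fun X v w => ?_) hle hne hN
    rw [doubleForm_apply, doubleForm_apply, doubleRep_apply, doubleRep_apply, hadj, hadj]
  have hmem : (g, g') ∈ D := self_mem_cyc
  have hinv : ∀ X ∈ (spo n).toSubmodule, ∀ v ∈ D, SpoHowe.doubleRep φ X v ∈ D :=
    fun X hX v hv => h.doubleRep.apply_mem_cyc_of_mem_spo hD hX hv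
  have hker : ∀ p : U × U →ₗ[ℂ] U, (∀ X v, p (SpoHowe.doubleRep φ X v) = φ X (p v)) →
      p (g, g') ≠ 0 → ∀ x ∈ D, p x = 0 → x = 0 := by
    intro p hp hpg x hx hx0
    by_contra hne
    have e := hirr (D ⊓ LinearMap.ker p) inf_le_left (fun hb => hne (by
      rw [← Submodule.mem_bot ℂ, ← hb]
      exact ⟨hx, hx0⟩)) (fun X hX v hv => ⟨hinv X hX v hv.1, by
        rw [SetLike.mem_coe, LinearMap.mem_ker, hp, LinearMap.mem_ker.1 hv.2, map_zero]⟩)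
    rw [← e] at hmem
    exact hpg hmem.2
  have hker1 := hker (LinearMap.fst ℂ U U) (fun _ _ => rfl) hg.ne_zero
  have hker2 := hker (LinearMap.snd ℂ U U) (fun _ _ => rfl) hg'.ne_zero
  have hmap : ∀ p : U × U →ₗ[ℂ] U, (∀ X v, p (SpoHowe.doubleRep φ X v) = φ X (p v)) →
      D.map p = cyc (spoLow φ) (p (g, g')) := by
    intro p hp
    refine map_cyc p ?_ ?_
    · rintro _ ⟨i, j, hij, rfl⟩
      exact ⟨_, ⟨i, j, hij, rfl⟩, hp _⟩
    · rintro _ ⟨i, j, hij, rfl⟩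
      exact ⟨_, ⟨i, j, hij, rfl⟩, hp _⟩
  have hmap1 : D.map (LinearMap.fst ℂ U U) = cyc (spoLow φ) g := hmap _ fun _ _ => rfl
  have hmap2 : D.map (LinearMap.snd ℂ U U) = cyc (spoLow φ) g' := hmap _ fun _ _ => rfl
  have hfst : ∀ x : D, x.1.1 ∈ cyc (spoLow φ) g := by
    intro x
    rw [← hmap1]
    exact ⟨x.1, x.2, rfl⟩
  set p : D →ₗ[ℂ] cyc (spoLow φ) g :=
    ((LinearMap.fst ℂ U U).comp D.subtype).codRestrict _ hfst with hp
  have hbij : Function.Bijective p := by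
    constructor
    · rw [← LinearMap.ker_eq_bot, LinearMap.ker_eq_bot']
      intro x hx
      exact Subtype.ext (hker1 x.1 x.2 (congrArg Subtype.val hx))
    · rintro ⟨v, hv⟩
      have hv' := hv
      rw [← hmap1] at hv'
      obtain ⟨x, hx, e⟩ := hv'
      exact ⟨⟨x, hx⟩, Subtype.ext e⟩
  set E := LinearEquiv.ofBijective p hbij with hE
  have hEs : ∀ x : D, E.symm ⟨x.1.1, hfst x⟩ = x := by
    intro x
    rw [LinearEquiv.symm_apply_eq]
    rfl
  have hE1 : ∀ v, (E.symm v).1.1 = v.1 := fun v => congrArg Subtype.val (E.apply_symm_apply v)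
  refine ⟨(LinearMap.snd ℂ U U).comp (D.subtype.comp E.symm.toLinearMap), ?_, ?_, ?_, ?_⟩
  · exact congrArg (fun x : D => x.1.2) (hEs ⟨(g, g'), hmem⟩)
  · intro v
    rw [← hmap2]
    exact ⟨(E.symm v).1, (E.symm v).2, rfl⟩
  · rw [← LinearMap.ker_eq_bot, LinearMap.ker_eq_bot']
    intro v hv
    have h1 : E.symm v = 0 := Subtype.ext (hker2 _ (E.symm v).2 hv)
    exact (LinearEquiv.map_eq_zero_iff E.symm).1 h1
  -- If Q × Q preserves the graph, then (Q v, Q (T v)) lies on it, which says that T commutes with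
  -- Q. This covers the parity operator as well as the action of spo(2n|1).
  · intro Q hQ v hv
    have h1 := hEs ⟨_, hQ _ (E.symm v).2⟩
    have h2 : (⟨Q v.1, hv⟩ : cyc (spoLow φ) g) = ⟨Q (E.symm v).1.1, by rw [hE1]; exact hv⟩ := by
      apply Subtype.ext
      dsimp only
      rw [hE1]
    change (E.symm ⟨Q v.1, hv⟩).1.2 = Q (E.symm v).1.2
    rw [h2]
    exact congrArg (fun x : D => x.1.2) h1

end Iso

/-! ### Gradings by an involution -/

section Involution

variable {U : Type} [AddCommGroup U] [Module ℂ U]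

theorem sgn_injective : Function.Injective sgn := by
  intro a b hab
  rcases zmod2_cases a with rfl | rfl <;> rcases zmod2_cases b with rfl | rfl
  · rfl
  · rw [sgn_zero, sgn_one] at hab
    norm_num at hab
  · rw [sgn_zero, sgn_one] at hab
    norm_num at hab
  · rfl

theorem mem_iSup_of_involution {P : Module.End ℂ U} (hP : ∀ v, P (P v) = v) {N : Submodule ℂ U}
    (hN : ∀ v ∈ N, P v ∈ N) {part : ZMod 2 → Submodule ℂ U}
    (hpart : ∀ a v, v ∈ part a ↔ P v = sgn a • v) : N ≤ ⨆ a, N ⊓ part a := by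
  intro v hv
  have e : v = (1 / 2 : ℂ) • (v + P v) + (1 / 2 : ℂ) • (v - P v) := by
    rw [← smul_add, add_add_sub_cancel, ← two_smul ℂ, smul_smul]
    norm_num
  rw [e]
  refine Submodule.add_mem _ (Submodule.smul_mem _ _ (Submodule.mem_iSup_of_mem 0
    ⟨N.add_mem hv (hN v hv), (hpart _ _).2 ?_⟩)) (Submodule.smul_mem _ _
    (Submodule.mem_iSup_of_mem 1 ⟨N.sub_mem hv (hN v hv), (hpart _ _).2 ?_⟩))
  · rw [map_add, hP, sgn_zero, one_smul, add_comm]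
  · rw [map_sub, hP, sgn_one, neg_smul, one_smul, neg_sub]

theorem isInternal_of_involution {P : Module.End ℂ U} (hP : ∀ v, P (P v) = v)
    {part : ZMod 2 → Submodule ℂ U} (hpart : ∀ a v, v ∈ part a ↔ P v = sgn a • v) :
    DirectSum.IsInternal part := by
  have e : part = fun a => P.eigenspace (sgn a) := by
    funext a
    ext v
    rw [hpart, Module.End.mem_eigenspace_iff]
  refine DirectSum.isInternal_submodule_of_iSupIndep_of_iSup_eq_top ?_ ?_
  · rw [e]
    exact (Module.End.eigenspaces_iSupIndep P).comp sgn_injective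
  · rw [eq_top_iff]
    refine (mem_iSup_of_involution hP (fun _ _ => Submodule.mem_top) hpart).trans ?_
    exact iSup_mono fun a => inf_le_right

/-- Eigenspaces of distinct eigenvalues are independent, so injectivity can be tested on each
summand. -/
theorem injective_toModule_of_eigenvalue {κ : Type} [DecidableEq κ] {A : κ → Type}
    [∀ c, AddCommGroup (A c)] [∀ c, Module ℂ (A c)] (Φ : ∀ c, A c →ₗ[ℂ] U)
    (hΦ : ∀ c, Function.Injective (Φ c)) {J : Module.End ℂ U} {j : κ → ℂ}
    (hj : Function.Injective j) (hJ : ∀ c x, J (Φ c x) = j c • Φ c x) :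
    Function.Injective (DirectSum.toModule ℂ κ U Φ) := by
  have hind := (Module.End.eigenspaces_iSupIndep J).comp hj
  have h1 := hind.dfinsupp_lsum_injective
  let Ψ : ∀ c, A c →ₗ[ℂ] J.eigenspace (j c) := fun c =>
    (Φ c).codRestrict _ fun x => Module.End.mem_eigenspace_iff.2 (hJ c x)
  have h2 : Function.Injective (DFinsupp.mapRange.linearMap Ψ) := by
    intro x y hxy
    ext c
    have := congrArg (fun z => (z c : U)) hxy
    exact hΦ c this
  have h3 : ∀ x, DirectSum.toModule ℂ κ U Φ x =
      DFinsupp.lsum ℕ (fun c => (J.eigenspace (j c)).subtype) (DFinsupp.mapRange.linearMap Ψ x) := by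
    intro x
    induction x using DirectSum.induction_on with
    | zero => simp
    | of c x =>
      change DirectSum.toModule ℂ κ U Φ (DirectSum.lof ℂ κ A c x) = _
      rw [DirectSum.toModule_lof]
      change _ = DFinsupp.lsum ℕ _ (DFinsupp.mapRange.linearMap Ψ (DFinsupp.single c x))
      rw [DFinsupp.mapRange.linearMap_apply, DFinsupp.mapRange_single, DFinsupp.lsum_single]
      rfl
    | add x y hx hy => rw [map_add, hx, hy, map_add, map_add]
  intro x y hxy
  rw [h3, h3] at hxy
  exact h2 (h1 hxy)

end Involution

/-! ### The parity operator -/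

section Parity

variable {κ : Type} [Fintype κ] [DecidableEq κ] (r : κ → ZMod 2)

theorem parityOp_parityOp (v : SuperSym r) : parityOp r (parityOp r v) = v := by
  have h : (⨆ a, superSymPart r a) ≤
      LinearMap.eqLocus ((parityOp r).comp (parityOp r)) LinearMap.id := by
    refine iSup_le fun a v hv => ?_
    rw [LinearMap.mem_eqLocus, LinearMap.comp_apply, parityOp_of_mem r hv, map_smul,
      parityOp_of_mem r hv, smul_smul, sgn_mul_self, one_smul, LinearMap.id_apply]
  have hv : v ∈ ⨆ a, superSymPart r a := by
    rw [iSup_superSymPart]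
    exact Submodule.mem_top
  exact h hv

theorem parityOp_naturalAction {A : Matrix κ κ ℂ} {a : ZMod 2} (hA : A ∈ homPart r a)
    (v : SuperSym r) :
    parityOp r (naturalAction r A v) = sgn a • naturalAction r A (parityOp r v) := by
  simp only [naturalAction, LinearMap.sum_apply, LinearMap.smul_apply, Module.End.mul_apply,
    map_sum, map_smul, parityOp_mulOp, parityOp_derOp, Finset.smul_sum]
  refine Finset.sum_congr rfl fun k _ => Finset.sum_congr rfl fun l _ => ?_
  by_cases h : r k + r l = a
  · rw [← h, sgn_add, smul_smul, smul_smul, smul_smul]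
    congr 1
    ring
  · rw [hA k l h, zero_smul, zero_smul, smul_zero]

/-- The product of two augmentations sends 1 ⊗ 1 to 1. -/
theorem tmul_one_ne_zero {A B : Type} [CommRing A] [Algebra ℂ A] [Ring B] [Algebra ℂ B]
    (f : A →ₐ[ℂ] ℂ) (f' : B →ₐ[ℂ] ℂ) : (1 : A) ⊗ₜ[ℂ] (1 : B) ≠ 0 := by
  intro h
  have h1 := congrArg (TensorProduct.lift ((LinearMap.mul ℂ ℂ).compl₁₂ f.toLinearMap
    f'.toLinearMap)) h
  rw [map_zero, TensorProduct.lift.tmul, LinearMap.compl₁₂_apply] at h1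
  simp at h1

theorem vac_ne_zero : vac r ≠ 0 :=
  tmul_one_ne_zero (MvPolynomial.aeval fun _ => (0 : ℂ)) ExteriorAlgebra.algebraMapInv

end Parity

/-! ### The joint highest weight vectors in the supersymmetric algebra -/

/-- The action of `gl(V)` on `S(E)`. -/
def glVLin (n : ℕ) : Matrix (IdxV n) (IdxV n) ℂ →ₗ[ℂ] Module.End ℂ (SE n) :=
  (quad (mulOp (parE n)) (derOp (parE n))).comp (onE n)

theorem glVLin_apply {n : ℕ} (X : Matrix (IdxV n) (IdxV n) ℂ) : glVLin n X = glVAction n X := rfl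

theorem isSuperHom_glVLin (n : ℕ) : IsSuperHom (R := Module.End ℂ (SE n)) (glVLin n) :=
  fun _ _ _ _ hX hY => glVAction_mul hX hY

section Labels

variable {n : ℕ}

/-- The joint highest weight vector with a given label. -/
def labelVec : Label n → SE n
  | Sum.inl _ => vac (parE n)
  | Sum.inr (Sum.inl (d, k)) => jointVec (mulOp (parE n)) (vac (parE n)) d k
  | Sum.inr (Sum.inr d) => jointVec (mulOp (parE n)) (vac (parE n)) d n

/-- The weight of `labelVec` for `gl(V)`. -/
def labelWeight : Label n → IdxV n → ℤ
  | Sum.inl _ => fun _ => 0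
  | Sum.inr (Sum.inl (d, k)) => jointWeight n d k
  | Sum.inr (Sum.inr d) => jointWeight n d n

/-- The degrees of `labelVec` in `V ⊗ v_1` and `V ⊗ w_1`. -/
def labelDeg : Label n → Fin 2 → ℕ
  | Sum.inl _ => ![0, 0]
  | Sum.inr (Sum.inl (d, k)) => ![d, k + 1]
  | Sum.inr (Sum.inr d) => ![d, n + 1]

/-- The parity of `labelVec`. -/
def labelPar : Label n → ℕ
  | Sum.inl _ => 0
  | Sum.inr (Sum.inl (_, k)) => k + 1
  | Sum.inr (Sum.inr _) => n

theorem derOp_vac' : ∀ x, derOp (parE n) x (vac (parE n)) = 0 := derOp_vac (parE n)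

theorem labelVec_ne_zero (hn : 1 ≤ n) (c : Label n) : labelVec c ≠ 0 := by
  rcases c with _ | ⟨d, k⟩ | d
  · exact vac_ne_zero _
  · exact (superCCR_superSym (parE n)).jointVec_ne_zero hn derOp_vac' (vac_ne_zero _) d k.2.le
  · exact (superCCR_superSym (parE n)).jointVec_ne_zero hn derOp_vac' (vac_ne_zero _) d le_rfl

theorem glVAction_vac (X : Matrix (IdxV n) (IdxV n) ℂ) : glVAction n X (vac (parE n)) = 0 :=
  naturalAction_vac _

theorem glXAction_vac (A : Matrix (Fin 2) (Fin 2) ℂ) : glXAction n A (vac (parE n)) = 0 :=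
  naturalAction_vac _

theorem glVAction_single_labelVec (c : Label n) {i j : IdxV n} (hij : pos i < pos j) :
    glVAction n (Matrix.single i j 1) (labelVec c) = 0 := by
  rcases c with _ | ⟨d, k⟩ | d
  · exact glVAction_vac _
  · exact (superCCR_superSym (parE n)).raise_jointVec derOp_vac' k.2.le hij d
  · exact (superCCR_superSym (parE n)).raise_jointVec derOp_vac' le_rfl hij d

theorem glVAction_diagonal_labelVec (c : Label n) (t : IdxV n → ℂ) :
    glVAction n (Matrix.diagonal t) (labelVec c) =
      (∑ i, (labelWeight c i : ℂ) * t i) • labelVec c := by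
  rcases c with _ | ⟨d, k⟩ | d
  · rw [labelVec, glVAction_vac]
    simp [labelWeight]
  · exact (superCCR_superSym (parE n)).diagonal_jointVec derOp_vac' t d k.2.le
  · exact (superCCR_superSym (parE n)).diagonal_jointVec derOp_vac' t d le_rfl

theorem glXAction_diagonal_labelVec (c : Label n) (t : Fin 2 → ℂ) :
    glXAction n (Matrix.diagonal t) (labelVec c) =
      (labelDeg c 0 * t 0 + labelDeg c 1 * t 1) • labelVec c := by
  rcases c with _ | ⟨d, k⟩ | d
  · rw [labelVec, glXAction_vac]
    simp [labelDeg]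
  · have := (superCCR_superSym (parE n)).diagonal'_jointVec derOp_vac' t d k
    simp only [labelDeg, Matrix.cons_val_zero, Matrix.cons_val_one, Nat.cast_add, Nat.cast_one]
    exact this
  · have := (superCCR_superSym (parE n)).diagonal'_jointVec derOp_vac' t d n
    simp only [labelDeg, Matrix.cons_val_zero, Matrix.cons_val_one, Nat.cast_add, Nat.cast_one]
    exact this

theorem glXAction_lower_labelVec (hn : 1 ≤ n) (c : Label n) :
    glXAction n (Matrix.single 1 0 1) (labelVec c) = 0 := by
  rcases c with _ | ⟨d, k⟩ | d
  · exact glXAction_vac _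
  · exact (superCCR_superSym (parE n)).lower'_jointVec hn derOp_vac' d k.2.le
  · exact (superCCR_superSym (parE n)).lower'_jointVec hn derOp_vac' d le_rfl

theorem lapOp_labelVec (hn : 1 ≤ n) (c : Label n) (a b : Fin 2) :
    lapOp n a b (labelVec c) = 0 := by
  rw [lapOp, LinearMap.sum_apply]
  refine Finset.sum_eq_zero fun i _ => ?_
  rw [LinearMap.smul_apply, Module.End.mul_apply]
  rcases c with _ | ⟨d, k⟩ | d
  · rw [labelVec, derOp_vac, map_zero, smul_zero]
  · rw [labelVec, (superCCR_superSym (parE n)).d_d_jointVec hn derOp_vac' d k.2.le, smul_zero]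
  · rw [labelVec, (superCCR_superSym (parE n)).d_d_jointVec hn derOp_vac' d le_rfl, smul_zero]

/-! ### Parities and weights of the joint highest weight vectors. -/

theorem wedgeVec_mem {p : ℕ} (hp : p ≤ n) :
    wedgeVec (mulOp (parE n)) (vac (parE n)) p ∈ superSymPart (parE n) (p : ZMod 2) := by
  induction p with
  | zero => exact vac_mem _
  | succ p ih =>
    have e : parE n (atPos n p, 1) = 1 := by
      rw [parE, parV_of_pos_lt (by rw [pos_atPos (by omega)]; omega)]
      rfl
    have := mulOp_mem (parE n) (atPos n p, 1) (ih (by omega))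
    rw [e, add_comm] at this
    rw [wedgeVec]
    exact_mod_cast this

theorem powVec_mem (hn : 1 ≤ n) {w : SE n} {a : ZMod 2} (hw : w ∈ superSymPart (parE n) a)
    (e : ℕ) : powVec (mulOp (parE n)) w e ∈ superSymPart (parE n) a := by
  induction e with
  | zero => exact hw
  | succ e ih =>
    have := mulOp_mem (parE n) (atPos n 0, 0) ih
    rwa [parE_atPos_zero hn, zero_add] at this

theorem labelVec_mem (hn : 1 ≤ n) (c : Label n) :
    labelVec c ∈ superSymPart (parE n) (labelPar c : ZMod 2) := by
  rcases c with _ | ⟨d, k⟩ | d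
  · exact vac_mem _
  · exact powVec_mem hn (wedgeVec_mem k.2) d
  · refine powVec_mem hn ?_ d
    have e : parE n (atPos n n, 1) = 0 := by
      have : atPos n n = Sum.inr () := by simp [atPos]
      rw [this]
      exact CharTwo.add_self_eq_zero (1 : ZMod 2)
    have := mulOp_mem (parE n) (atPos n n, 1) (wedgeVec_mem (le_refl n))
    rwa [e, zero_add] at this

theorem labelWeight_eq (hn : 1 ≤ n) (c : Label n) (i : IdxV n) : (labelWeight c i : ℂ) = glVWeight c i := by
  -- The clause `i < n` matters only for k = n: position n belongs to u_{2n+1}, and even vectors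
  -- with index at least n have positions beyond n.
  have key : ∀ (d k : ℕ), k ≤ n → ∀ i : Fin (2 * n), (jointWeight n d k (Sum.inl i) : ℂ) =
      if (i : ℕ) = 0 then (d : ℂ) + 1 else if (i : ℕ) ≤ k ∧ (i : ℕ) < n then 1 else 0 := by
    intro d k hk i
    have hp := pos_inl i
    rw [jointWeight]
    generalize pos (Sum.inl i : IdxV n) = p at *
    by_cases h0 : (i : ℕ) = 0
    · have := i.2
      rw [if_pos (by omega)] at hp
      rw [if_pos h0, if_pos (by omega), if_pos (by omega)]
      push_cast
      ring
    · rw [if_neg h0]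
      by_cases h1 : (i : ℕ) < n
      · rw [if_pos h1] at hp
        rw [if_neg (by omega : ¬ p = 0), add_zero, hp]
        by_cases h2 : (i : ℕ) ≤ k
        · rw [if_pos h2, if_pos ⟨h2, h1⟩, Int.cast_one]
        · rw [if_neg h2, if_neg fun h => h2 h.1, Int.cast_zero]
      · rw [if_neg h1] at hp
        rw [if_neg (by omega), if_neg (by omega), if_neg fun h => h1 h.2]
        simp
  rcases c with _ | ⟨d, k⟩ | d
  · simp [labelWeight, glVWeight]
  · rcases i with i | i
    · have e : ((i : ℕ) ≤ k ∧ (i : ℕ) < n) ↔ (i : ℕ) ≤ k :=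
        ⟨fun h => h.1, fun h => ⟨h, h.trans_lt k.2⟩⟩
      simp only [labelWeight, glVWeight, Sum.elim_inl, key d k k.2.le, e]
    · have := k.2
      have hp := pos_inr (n := n) i
      simp only [labelWeight, glVWeight, Sum.elim_inr, jointWeight]
      rw [if_neg (by omega), if_neg (by omega)]
      simp
  · rcases i with i | i
    · have e : ((i : ℕ) ≤ n ∧ (i : ℕ) < n) ↔ (i : ℕ) < n := ⟨fun h => h.2, fun h => ⟨h.le, h⟩⟩
      simp only [labelWeight, glVWeight, Sum.elim_inl, key d n le_rfl, e]
    · have hp := pos_inr (n := n) i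
      simp only [labelWeight, glVWeight, Sum.elim_inr, jointWeight]
      rw [if_pos (by omega), if_neg (by omega)]
      simp

theorem spoWeight_eq (c : Label n) (i : Fin n) : spoWeight c i = glVWeight c (lowIdx i) := by
  rcases c with _ | ⟨d, k⟩ | d
  · rfl
  · rfl
  · simp [spoWeight, glVWeight, lowIdx]

/-- None of the weights involves u_{n+1}, …, u_{2n}, so restriction to the Cartan subalgebra of
spo(2n|1) just keeps the first n entries. -/
theorem glVWeight_bar (c : Label n) (i : Fin n) : glVWeight c (bar (lowIdx i)) = 0 := by
  have := i.2
  rcases c with _ | ⟨d, k⟩ | d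
  · rfl
  · simp only [glVWeight, lowIdx, bar, Sum.map_inl, Sum.elim_inl, Fin.val_rev, Fin.val_castLE]
    rw [if_neg (by omega), if_neg (by omega)]
  · simp only [glVWeight, lowIdx, bar, Sum.map_inl, Sum.elim_inl, Fin.val_rev, Fin.val_castLE]
    rw [if_neg (by omega), if_neg (by omega)]

/-- The weight of `labelVec` for `spo(V)`, as an odd function on the basis of `V`. -/
def labelSpoWeight (c : Label n) (i : IdxV n) : ℤ := labelWeight c i - labelWeight c (bar i)

theorem labelSpoWeight_low (hn : 1 ≤ n) (c : Label n) (i : Fin n) :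
    (labelSpoWeight c (lowIdx i) : ℂ) = spoWeight c i := by
  rw [labelSpoWeight, Int.cast_sub, labelWeight_eq hn, labelWeight_eq hn, glVWeight_bar, spoWeight_eq,
    sub_zero]

theorem labelSpoWeight_bar (c : Label n) (i : IdxV n) :
    labelSpoWeight c (bar i) = -labelSpoWeight c i := by
  rw [labelSpoWeight, labelSpoWeight, bar_bar, neg_sub]

theorem labelSpoWeight_congr (hn : 1 ≤ n) {c c' : Label n} (h : spoWeight c = spoWeight c') :
    labelSpoWeight c = labelSpoWeight c' := by
  have hlow : ∀ i : Fin n, labelSpoWeight c (lowIdx i) = labelSpoWeight c' (lowIdx i) := by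
    intro i
    have : (labelSpoWeight c (lowIdx i) : ℂ) = labelSpoWeight c' (lowIdx i) := by
      rw [labelSpoWeight_low hn, labelSpoWeight_low hn, h]
    exact_mod_cast this
  funext i
  rcases i with i | i
  · by_cases hi : (i : ℕ) < n
    · exact hlow ⟨i, hi⟩
    · have hi' : ((i.rev : Fin (2 * n)) : ℕ) < n := by
        rw [Fin.val_rev]
        omega
      have e : (Sum.inl i : IdxV n) = bar (lowIdx ⟨i.rev, hi'⟩) := by
        simp only [bar, lowIdx, Sum.map_inl, Sum.inl.injEq, Fin.ext_iff, Fin.val_rev,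
          Fin.val_castLE]
        omega
      rw [e, labelSpoWeight_bar, labelSpoWeight_bar, hlow]
  · have h1 := labelSpoWeight_bar c (Sum.inr i)
    have h2 := labelSpoWeight_bar c' (Sum.inr i)
    have e : bar (Sum.inr i : IdxV n) = Sum.inr i := rfl
    rw [e] at h1 h2
    omega

theorem isHW_labelVec (hn : 1 ≤ n) (c : Label n) :
    IsHW (U := SE n) (glVLin n) (labelSpoWeight c) (labelVec c) := by
  refine ⟨labelVec_ne_zero hn c, fun i => ?_, fun i j hij => ?_⟩
  · rw [spoGen_self, glVLin_apply, glVAction_diagonal_labelVec]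
    congr 1
    simp only [mul_sub, mul_ite, mul_one, mul_zero, Finset.sum_sub_distrib, Finset.sum_ite_eq',
      Finset.mem_univ, if_true, labelSpoWeight]
    push_cast
    rfl
  · have e : (spoGen i j : Matrix (IdxV n) (IdxV n) ℂ) = Matrix.single i j 1 -
        tsgn (bar j) (bar i) • Matrix.single (bar j) (bar i) 1 := by
      ext k l
      rw [spoGen_apply, Matrix.sub_apply, Matrix.smul_apply, Matrix.single_apply,
        Matrix.single_apply, smul_eq_mul]
      congr 1
      by_cases hkl : i = bar l ∧ j = bar k
      · rw [if_pos hkl, if_pos ⟨by rw [hkl.2, bar_bar], by rw [hkl.1, bar_bar]⟩, hkl.1, hkl.2,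
          bar_bar, bar_bar]
      · rw [if_neg hkl, if_neg, mul_zero, mul_zero]
        rintro ⟨rfl, rfl⟩
        simp at hkl
    have h1 := pos_add_pos_bar i
    have h2 := pos_add_pos_bar j
    rw [e, map_sub, map_smul, LinearMap.sub_apply, LinearMap.smul_apply, glVLin_apply,
      glVLin_apply, glVAction_single_labelVec c hij,
      glVAction_single_labelVec c (by omega : pos (bar j) < pos (bar i)), smul_zero, sub_zero]

/-- The parity depends only on the weight of spo(2n|1). In the last family there are n + 1 factors
u_p ⊗ w_1, but the one with u_{2n+1} is even, so the two labels sharing a weight also share their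
parity. -/
theorem labelPar_eq_card (c : Label n) :
    labelPar c = (Finset.univ.filter fun i => spoWeight c i ≠ 0).card := by
  have hd : ∀ d : ℕ, (d : ℂ) + 1 ≠ 0 := fun d => by exact_mod_cast d.succ_ne_zero
  rcases c with _ | ⟨d, k⟩ | d
  · simp [labelPar, spoWeight]
  · have e : (Finset.univ.filter fun i => spoWeight (Sum.inr (Sum.inl (d, k)) : Label n) i ≠ 0) =
        Finset.Iic k := by
      ext i
      rw [Finset.mem_filter, Finset.mem_Iic, Fin.le_def]
      simp only [spoWeight]
      split_ifs with h0 h1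
      · simp [hd, h0]
      · simp [h1]
      · simp [h1]
    rw [e, Fin.card_Iic]
    rfl
  · have e : (Finset.univ.filter fun i => spoWeight (Sum.inr (Sum.inr d) : Label n) i ≠ 0) =
        Finset.univ := by
      ext i
      rw [Finset.mem_filter]
      simp only [spoWeight]
      split_ifs with h0
      · simp [hd]
      · simp
    rw [e, Finset.card_univ, Fintype.card_fin]
    rfl

theorem labelPar_congr {c c' : Label n} (h : spoWeight c = spoWeight c') :
    labelPar c = labelPar c' := by
  rw [labelPar_eq_card, labelPar_eq_card, h]

end Labels

/-! ### The modules generated by the joint highest weight vectors -/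

section Modules

variable {n : ℕ}

theorem form_glVAction {F : SE n →ₗ⋆[ℂ] SE n →ₗ[ℂ] ℂ}
    (h1 : ∀ v w, F w v = starRingEnd ℂ (F v w))
    (h2 : ∀ k v w, F (mulOp (parE n) k v) w = F v (derOp (parE n) k w))
    (X : Matrix (IdxV n) (IdxV n) ℂ) (v w : SE n) :
    F (glVAction n X v) w = F v (glVAction n X.conjTranspose w) := by
  have := form_naturalAction h1 h2 (onE n X) v w
  rw [onE_conjTranspose] at this
  exact this

theorem form_glXAction {F : SE n →ₗ⋆[ℂ] SE n →ₗ[ℂ] ℂ}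
    (h1 : ∀ v w, F w v = starRingEnd ℂ (F v w))
    (h2 : ∀ k v w, F (mulOp (parE n) k v) w = F v (derOp (parE n) k w))
    (A : Matrix (Fin 2) (Fin 2) ℂ) (v w : SE n) :
    F (glXAction n A v) w = F v (glXAction n A.conjTranspose w) := by
  have := form_naturalAction h1 h2 (onE' n A) v w
  rw [onE'_conjTranspose] at this
  exact this

theorem parityOp_glVAction {X : Matrix (IdxV n) (IdxV n) ℂ} {x : ZMod 2}
    (hX : X ∈ homPart (parV n) x) (v : SE n) :
    parityOp (parE n) (glVAction n X v) = sgn x • glVAction n X (parityOp (parE n) v) :=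
  parityOp_naturalAction _ (onE_mem hX) v

theorem parityOp_glXAction {A : Matrix (Fin 2) (Fin 2) ℂ} {a : ZMod 2}
    (hA : A ∈ homPart parX a) (v : SE n) :
    parityOp (parE n) (glXAction n A v) = sgn a • glXAction n A (parityOp (parE n) v) :=
  parityOp_naturalAction _ (onE'_mem hA) v

/-- The `spo(2n|1)`-module generated by `labelVec`. -/
def spoMod (c : Label n) : Submodule ℂ (SE n) := cyc (U := SE n) (spoLow (glVLin n)) (labelVec c)

theorem labelVec_mem_spoMod (c : Label n) : labelVec c ∈ spoMod c := self_mem_cyc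

theorem glVAction_mem_spoMod (hn : 1 ≤ n) {c : Label n} {X : Matrix (IdxV n) (IdxV n) ℂ}
    (hX : X ∈ (spo n).toSubmodule) {v : SE n} (hv : v ∈ spoMod c) :
    glVAction n X v ∈ spoMod c :=
  (isSuperHom_glVLin n).apply_mem_cyc_of_mem_spo (isHW_labelVec hn c) hX hv

theorem spoMod_le {c : Label n} {N : Submodule ℂ (SE n)} (h1 : labelVec c ∈ N)
    (h2 : ∀ i j, ∀ v ∈ N, glVAction n (spoGen i j) v ∈ N) : spoMod c ≤ N := by
  refine cyc_le h1 ?_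
  rintro _ ⟨i, j, -, rfl⟩ v hv
  exact h2 i j v hv

theorem parityOp_mem_spoMod (hn : 1 ≤ n) {c : Label n} {v : SE n} (hv : v ∈ spoMod c) :
    parityOp (parE n) v ∈ spoMod c := by
  have : spoMod c ≤ (spoMod c).comap (parityOp (parE n)) ⊓ spoMod c := by
    refine spoMod_le ⟨?_, labelVec_mem_spoMod c⟩ fun i j v hv =>
      ⟨?_, glVAction_mem_spoMod hn (spoGen_mem i j) hv.2⟩
    · rw [SetLike.mem_coe, Submodule.mem_comap, parityOp_of_mem _ (labelVec_mem hn c)]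
      exact Submodule.smul_mem _ _ (labelVec_mem_spoMod c)
    · rw [SetLike.mem_coe, Submodule.mem_comap, parityOp_glVAction (spoGen_mem_homPart i j)]
      exact Submodule.smul_mem _ _ (glVAction_mem_spoMod hn (spoGen_mem i j) hv.1)
  exact (this hv).1

/-- An operator that commutes with spo(2n|1) up to scalars and kills the generator kills the whole
module. This extends harmonicity and the lowest weight property from `labelVec c` to `spoMod c`. -/
theorem eq_zero_of_mem_spoMod {c : Label n} {Q : Module.End ℂ (SE n)} (h0 : Q (labelVec c) = 0)
    (hQ : ∀ i j, ∃ s : ℂ, ∀ v, Q (glVAction n (spoGen i j) v) =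
      s • glVAction n (spoGen i j) (Q v)) {v : SE n} (hv : v ∈ spoMod c) : Q v = 0 := by
  have : spoMod c ≤ LinearMap.ker Q := by
    refine spoMod_le h0 fun i j v hv => ?_
    obtain ⟨s, hs⟩ := hQ i j
    rw [LinearMap.mem_ker] at hv ⊢
    rw [hs, hv, map_zero, smul_zero]
  exact this hv

theorem lapOp_of_mem_spoMod (hn : 1 ≤ n) {c : Label n} {v : SE n} (hv : v ∈ spoMod c)
    (a b : Fin 2) : lapOp n a b v = 0 :=
  eq_zero_of_mem_spoMod (lapOp_labelVec hn c a b) (fun i j => ⟨_, fun v =>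
    LinearMap.congr_fun (lapOp_mul_glVAction (spoGen_mem_homPart i j) (spoGen_mem i j) a b) v⟩) hv

theorem glXAction_glVAction {X : Matrix (IdxV n) (IdxV n) ℂ}
    {A : Matrix (Fin 2) (Fin 2) ℂ} {x a : ZMod 2} (hX : X ∈ homPart (parV n) x)
    (hA : A ∈ homPart parX a) (v : SE n) :
    glXAction n A (glVAction n X v) = sgn (x * a) • glVAction n X (glXAction n A v) := by
  have h : glVAction n X (glXAction n A v) = sgn (x * a) • glXAction n A (glVAction n X v) :=
    LinearMap.congr_fun (glVAction_mul_glXAction hX hA) v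
  rw [h, smul_smul, sgn_mul_self, one_smul]

theorem glXAction_lower_of_mem_spoMod (hn : 1 ≤ n) {c : Label n} {v : SE n}
    (hv : v ∈ spoMod c) : glXAction n (Matrix.single 1 0 1) v = 0 :=
  eq_zero_of_mem_spoMod (glXAction_lower_labelVec hn c) (fun i j => ⟨_, fun v =>
    glXAction_glVAction (spoGen_mem_homPart i j) (single_mem_homPart_parX 1 0) v⟩) hv

theorem glXAction_diagonal_of_mem_spoMod {c : Label n} {v : SE n}
    (hv : v ∈ spoMod c) (t : Fin 2 → ℂ) : glXAction n (Matrix.diagonal t) v =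
      (labelDeg c 0 * t 0 + labelDeg c 1 * t 1) • v := by
  have : spoMod c ≤ LinearMap.eqLocus (glXAction n (Matrix.diagonal t))
      ((labelDeg c 0 * t 0 + labelDeg c 1 * t 1 : ℂ) • LinearMap.id) := by
    refine spoMod_le (glXAction_diagonal_labelVec c t) fun i j v hv => ?_
    rw [LinearMap.mem_eqLocus, LinearMap.smul_apply, LinearMap.id_apply] at hv ⊢
    rw [glXAction_glVAction (spoGen_mem_homPart i j) (diagonal_mem_homPart _ t), mul_zero,
      sgn_zero, one_smul, hv, map_smul]
  exact this hv

theorem spoMod_irreducible (hn : 1 ≤ n) {c : Label n} {N : Submodule ℂ (SE n)}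
    (hle : N ≤ spoMod c) (hne : N ≠ ⊥)
    (hN : ∀ X ∈ (spo n).toSubmodule, ∀ v ∈ N, glVAction n X v ∈ N) : N = spoMod c := by
  obtain ⟨F, h1, h2, h3⟩ := exists_fock_form (parE n)
  exact (isHW_labelVec hn c).eq_cyc_of_ne_bot (isSuperHom_glVLin n) h2 (form_glVAction h1 h3)
    hle hne hN

/-- The weight (d+1, 1_{n-1}) arises both from the second family with k = n and from the third, so a
single module has to be embedded at two places. -/
theorem exists_iso_spoMod (hn : 1 ≤ n) {c c' : Label n} (h : spoWeight c = spoWeight c') :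
    ∃ T : spoMod c →ₗ[ℂ] SE n, T ⟨labelVec c, labelVec_mem_spoMod c⟩ = labelVec c' ∧
      (∀ v, T v ∈ spoMod c') ∧ Function.Injective T ∧
      (∀ X, ∀ hX : X ∈ (spo n).toSubmodule, ∀ v : spoMod c,
        T ⟨glVAction n X v.1, glVAction_mem_spoMod hn hX v.2⟩ = glVAction n X (T v)) ∧
      (∀ v : spoMod c, T ⟨parityOp (parE n) v.1, parityOp_mem_spoMod hn v.2⟩ =
        parityOp (parE n) (T v)) := by
  obtain ⟨F, h1, h2, h3⟩ := exists_fock_form (parE n)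
  have hg := isHW_labelVec hn c
  have hg' := isHW_labelVec hn c'
  rw [← labelSpoWeight_congr hn h] at hg'
  have hφ := isSuperHom_glVLin n
  obtain ⟨T, hT1, hT2, hT3, hT4⟩ := hg.exists_iso hφ hg' h2 (form_glVAction h1 h3)
  have hD := hg.doubleRep hg'
  refine ⟨T, hT1, hT2, hT3, fun X hX v => hT4 _ (fun x hx =>
    hφ.doubleRep.apply_mem_cyc_of_mem_spo hD hX hx) v _, fun v => hT4 _ (fun x hx => ?_) v _⟩
  set D := cyc (spoLow (doubleRep (U := SE n) (glVLin n))) (labelVec c, labelVec c') with hDdef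
  -- The graph is stable under parity because the two generators have the same parity by
  -- `labelPar_congr`.
  have hle : D ≤ D.comap ((parityOp (parE n)).prodMap (parityOp (parE n))) ⊓ D := by
    refine cyc_le ⟨?_, self_mem_cyc⟩ ?_
    · change (parityOp (parE n) (labelVec c), parityOp (parE n) (labelVec c')) ∈ D
      rw [parityOp_of_mem _ (labelVec_mem hn c), parityOp_of_mem _ (labelVec_mem hn c'),
        labelPar_congr h]
      exact Submodule.smul_mem D _ self_mem_cyc
    · rintro _ ⟨i, j, hij, rfl⟩ y hy
      have hY : doubleRep (U := SE n) (glVLin n) (spoGen i j) ∈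
          spoLow (doubleRep (U := SE n) (glVLin n)) := ⟨i, j, hij, rfl⟩
      refine ⟨?_, apply_mem_cyc hY hy.2⟩
      change (parityOp (parE n) (glVAction n (spoGen i j) y.1),
        parityOp (parE n) (glVAction n (spoGen i j) y.2)) ∈ D
      rw [parityOp_glVAction (spoGen_mem_homPart i j), parityOp_glVAction (spoGen_mem_homPart i j)]
      exact Submodule.smul_mem D _ (hφ.doubleRep.apply_mem_cyc_of_mem_spo hD (spoGen_mem i j) hy.1)
  exact (hle hx).1

/-! ### The modules over `gl(2n|1) + gl(1|1)` -/

/-- The lowering operators of `gl(2n|1) + gl(1|1)`. -/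
def glLow (n : ℕ) : Set (Module.End ℂ (SE n)) :=
  {Y | ∃ i j : IdxV n, pos j < pos i ∧ Y = glVAction n (Matrix.single i j 1)} ∪
    {glXAction n (Matrix.single 0 1 1)}

/-- The `gl(2n|1) + gl(1|1)`-module generated by `labelVec`. -/
def glMod (c : Label n) : Submodule ℂ (SE n) := cyc (U := SE n) (glLow n) (labelVec c)

/-- The operators of the elementary matrices of `gl(2n|1)` and `gl(1|1)`. -/
def glGen (n : ℕ) : Set (Module.End ℂ (SE n)) :=
  (Set.range fun x : IdxV n × IdxV n => glVAction n (Matrix.single x.1 x.2 1)) ∪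
    Set.range fun x : Fin 2 × Fin 2 => glXAction n (Matrix.single x.1 x.2 1)

theorem glVAction_mem_span (X : Matrix (IdxV n) (IdxV n) ℂ) :
    glVAction n X ∈ Submodule.span ℂ (glGen n) := by
  rw [← glVLin_apply, Matrix.matrix_eq_sum_single X]
  simp only [map_sum]
  refine Submodule.sum_mem _ fun i _ => Submodule.sum_mem _ fun j _ => ?_
  have : Matrix.single i j (X i j) = X i j • Matrix.single i j (1 : ℂ) := by
    rw [Matrix.smul_single, smul_eq_mul, mul_one]
  rw [this, map_smul]
  exact Submodule.smul_mem _ _ (Submodule.subset_span (Or.inl ⟨(i, j), rfl⟩))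

theorem glXAction_mem_span (A : Matrix (Fin 2) (Fin 2) ℂ) :
    glXAction n A ∈ Submodule.span ℂ (glGen n) := by
  rw [glXAction, Matrix.matrix_eq_sum_single A]
  simp only [map_sum]
  refine Submodule.sum_mem _ fun i _ => Submodule.sum_mem _ fun j _ => ?_
  have : Matrix.single i j (A i j) = A i j • Matrix.single i j (1 : ℂ) := by
    rw [Matrix.smul_single, smul_eq_mul, mul_one]
  rw [this, map_smul, map_smul]
  exact Submodule.smul_mem _ _ (Submodule.subset_span (Or.inr ⟨(i, j), rfl⟩))

/-- The elementary matrix E_{0,1} of gl(1|1) counts as a lowering operator here: `labelVec c` is a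
lowest weight vector for gl(1|1), killed by E_{1,0}. -/
theorem glGen_mem_glMod (hn : 1 ≤ n) {c : Label n} {X : Module.End ℂ (SE n)}
    (hX : X ∈ Submodule.span ℂ (glGen n)) {v : SE n} (hv : v ∈ glMod c) : X v ∈ glMod c := by
  refine cyc_invariant ?_ ?_ hX hv
  · rintro _ (⟨⟨i, j⟩, rfl⟩ | ⟨⟨a, b⟩, rfl⟩) _ (⟨k, l, -, rfl⟩ | rfl)
    · exact ⟨_, _, glVAction_mem_span _,
        glVAction_mul (single_mem_homPart i j) (single_mem_homPart k l)⟩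
    · refine ⟨sgn ((parV n i + parV n j) * (parX 0 + parX 1)), 0, Submodule.zero_mem _, ?_⟩
      rw [add_zero]
      exact glVAction_mul_glXAction (single_mem_homPart i j) (single_mem_homPart_parX 0 1)
    · refine ⟨sgn ((parV n k + parV n l) * (parX a + parX b)), 0, Submodule.zero_mem _, ?_⟩
      rw [add_zero]
      exact LinearMap.ext fun v =>
        glXAction_glVAction (single_mem_homPart k l) (single_mem_homPart_parX a b) v
    · exact ⟨_, _, glXAction_mem_span _,
        glXAction_mul (single_mem_homPart_parX a b) (single_mem_homPart_parX 0 1)⟩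
  · rintro _ (⟨⟨i, j⟩, rfl⟩ | ⟨⟨a, b⟩, rfl⟩)
    · dsimp only
      rcases lt_trichotomy (pos i) (pos j) with hij | hij | hij
      · rw [glVAction_single_labelVec c hij]
        exact Submodule.zero_mem _
      · have := pos_injective n hij
        subst this
        rw [← Matrix.diagonal_single, glVAction_diagonal_labelVec]
        exact Submodule.smul_mem _ _ self_mem_cyc
      · exact apply_mem_cyc (Or.inl ⟨i, j, hij, rfl⟩) self_mem_cyc
    · dsimp only
      fin_cases a <;> fin_cases b
      · rw [← Matrix.diagonal_single, glXAction_diagonal_labelVec]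
        exact Submodule.smul_mem _ _ self_mem_cyc
      · exact apply_mem_cyc (Or.inr rfl) self_mem_cyc
      · have := glXAction_lower_labelVec hn c
        change glXAction n (Matrix.single 1 0 1) (labelVec c) ∈ _
        rw [this]
        exact Submodule.zero_mem _
      · rw [← Matrix.diagonal_single, glXAction_diagonal_labelVec]
        exact Submodule.smul_mem _ _ self_mem_cyc

theorem glVAction_mem_glMod (hn : 1 ≤ n) {c : Label n} (X : Matrix (IdxV n) (IdxV n) ℂ) {v : SE n}
    (hv : v ∈ glMod c) : glVAction n X v ∈ glMod c :=
  glGen_mem_glMod hn (glVAction_mem_span X) hv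

theorem glXAction_mem_glMod (hn : 1 ≤ n) {c : Label n} (A : Matrix (Fin 2) (Fin 2) ℂ) {v : SE n}
    (hv : v ∈ glMod c) : glXAction n A v ∈ glMod c :=
  glGen_mem_glMod hn (glXAction_mem_span A) hv

theorem spoMod_le_glMod (hn : 1 ≤ n) (c : Label n) : spoMod c ≤ glMod c :=
  spoMod_le self_mem_cyc fun _ _ _ hv => glVAction_mem_glMod hn _ hv

theorem parityOp_mem_glMod (hn : 1 ≤ n) {c : Label n} {v : SE n} (hv : v ∈ glMod c) :
    parityOp (parE n) v ∈ glMod c := by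
  have : glMod c ≤ (glMod c).comap (parityOp (parE n)) ⊓ glMod c := by
    refine cyc_le ⟨?_, self_mem_cyc⟩ ?_
    · rw [SetLike.mem_coe, Submodule.mem_comap, parityOp_of_mem _ (labelVec_mem hn c)]
      exact Submodule.smul_mem _ _ self_mem_cyc
    · rintro _ (⟨i, j, -, rfl⟩ | rfl) v hv
      · refine ⟨?_, glVAction_mem_glMod hn _ hv.2⟩
        rw [SetLike.mem_coe, Submodule.mem_comap, parityOp_glVAction (single_mem_homPart i j)]
        exact Submodule.smul_mem _ _ (glVAction_mem_glMod hn _ hv.1)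
      · refine ⟨?_, glXAction_mem_glMod hn _ hv.2⟩
        rw [SetLike.mem_coe, Submodule.mem_comap, parityOp_glXAction (single_mem_homPart_parX 0 1)]
        exact Submodule.smul_mem _ _ (glXAction_mem_glMod hn _ hv.1)
  exact (this hv).1

theorem isGlGlInvariant_glMod (hn : 1 ≤ n) (c : Label n) : IsGlGlInvariant n (glMod c) := by
  refine ⟨mem_iSup_of_involution (parityOp_parityOp (parE n)) (fun v hv =>
    parityOp_mem_glMod hn hv) fun a v => mem_superSymPart_iff (parE n),
    fun X v hv => glVAction_mem_glMod hn X hv, fun A v hv => ?_⟩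
  rw [gl11Action_eq]
  exact Submodule.add_mem _ (glXAction_mem_glMod hn A hv) (Submodule.smul_mem _ _ hv)

/-- An operator whose eigenvalues are lowered by the lowering operators of
`gl(2n|1) + gl(1|1)`. -/
def glHeight (n : ℕ) : Module.End ℂ (SE n) :=
  glVAction n (Matrix.diagonal fun i => -(pos i : ℂ)) + glXAction n (Matrix.diagonal ![0, 1])

theorem glHeight_glVAction (i j : IdxV n) (v : SE n) :
    glHeight n (glVAction n (Matrix.single i j 1) v) =
      glVAction n (Matrix.single i j 1) (glHeight n v) +
        ((pos j : ℂ) - pos i) • glVAction n (Matrix.single i j 1) v := by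
  have h1 := LinearMap.congr_fun (glVAction_mul (diagonal_mem_homPart (parV n) fun i =>
    -(pos i : ℂ)) (single_mem_homPart i j)) v
  have e : (Matrix.diagonal fun i => -(pos i : ℂ)) * Matrix.single i j 1 -
      sgn (0 * (parV n i + parV n j)) • (Matrix.single i j 1 *
        Matrix.diagonal fun i => -(pos i : ℂ)) = ((pos j : ℂ) - pos i) • Matrix.single i j 1 := by
    ext k l
    rw [zero_mul, sgn_zero, one_smul, Matrix.sub_apply, Matrix.diagonal_mul, Matrix.mul_diagonal,
      Matrix.smul_apply, Matrix.single_apply, smul_eq_mul]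
    split_ifs with h
    · rw [h.1, h.2]
      ring
    · ring
  rw [e] at h1
  have h2 := glXAction_glVAction (single_mem_homPart i j) (diagonal_mem_homPart parX ![0, 1]) v
  rw [mul_zero, sgn_zero, one_smul] at h2
  have h3 : glVAction n (((pos j : ℂ) - pos i) • Matrix.single i j 1) v =
      ((pos j : ℂ) - pos i) • glVAction n (Matrix.single i j 1) v := by
    rw [← glVLin_apply, map_smul]
    rfl
  have h4 : glVAction n (Matrix.diagonal fun i => -(pos i : ℂ))
      (glVAction n (Matrix.single i j 1) v) = glVAction n (Matrix.single i j 1)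
      (glVAction n (Matrix.diagonal fun i => -(pos i : ℂ)) v) +
      ((pos j : ℂ) - pos i) • glVAction n (Matrix.single i j 1) v := by
    rw [← h3]
    have h5 := h1
    rw [zero_mul, sgn_zero, one_smul] at h5
    exact h5
  rw [glHeight, LinearMap.add_apply, LinearMap.add_apply, h4, h2, map_add]
  abel

theorem glHeight_glXAction (a b : Fin 2) (v : SE n) :
    glHeight n (glXAction n (Matrix.single a b 1) v) =
      glXAction n (Matrix.single a b 1) (glHeight n v) +
        ((![0, 1] : Fin 2 → ℂ) a - (![0, 1] : Fin 2 → ℂ) b) •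
          glXAction n (Matrix.single a b 1) v := by
  rw [glHeight]
  generalize (![0, 1] : Fin 2 → ℂ) = t
  have h1 := LinearMap.congr_fun (glXAction_mul (n := n) (diagonal_mem_homPart parX t)
    (single_mem_homPart_parX a b)) v
  have e : Matrix.diagonal t * Matrix.single a b 1 -
      sgn (0 * (parX a + parX b)) • (Matrix.single a b 1 * Matrix.diagonal t) =
      (t a - t b) • Matrix.single a b 1 := by
    ext k l
    rw [zero_mul, sgn_zero, one_smul, Matrix.sub_apply, Matrix.diagonal_mul, Matrix.mul_diagonal,
      Matrix.smul_apply, Matrix.single_apply, smul_eq_mul]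
    split_ifs with h
    · rw [h.1, h.2]
      ring
    · ring
  rw [e, zero_mul, sgn_zero, one_smul] at h1
  have h2 := LinearMap.congr_fun (glVAction_mul_glXAction (diagonal_mem_homPart (parV n) fun i =>
    -(pos i : ℂ)) (single_mem_homPart_parX a b)) v
  rw [zero_mul, sgn_zero, one_smul] at h2
  have h3 : glXAction n ((t a - t b) •
      Matrix.single a b 1) v = (t a - t b) •
        glXAction n (Matrix.single a b 1) v := by
    rw [glXAction, map_smul, map_smul]
    rfl
  have h4 : glXAction n (Matrix.diagonal t) (glXAction n (Matrix.single a b 1) v) =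
      glXAction n (Matrix.single a b 1) (glXAction n (Matrix.diagonal t) v) +
      (t a - t b) •
        glXAction n (Matrix.single a b 1) v := by
    rw [← h3]
    exact h1
  have h5 : glVAction n (Matrix.diagonal fun i => -(pos i : ℂ))
      (glXAction n (Matrix.single a b 1) v) = glXAction n (Matrix.single a b 1)
      (glVAction n (Matrix.diagonal fun i => -(pos i : ℂ)) v) := h2
  rw [LinearMap.add_apply, LinearMap.add_apply, h4, h5, map_add]
  abel

/-- Unlike spo(2n|1), the algebra gl(2n|1) + gl(1|1) is stable under conjugate transposition, so the
unitary criterion applies directly and no Casimir argument is needed. -/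
theorem labelVec_mem_of_le_glMod {c : Label n} {N : Submodule ℂ (SE n)}
    (hle : N ≤ glMod c) (hne : N ≠ ⊥) (hV : ∀ X, ∀ v ∈ N, glVAction n X v ∈ N)
    (hX : ∀ A, ∀ v ∈ N, glXAction n A v ∈ N) : labelVec c ∈ N := by
  obtain ⟨F, h1, h2, h3⟩ := exists_fock_form (parE n)
  refine mem_of_unitary (U := SE n) (K := glHeight n) (low := glLow n)
    (t := ∑ i, labelWeight c i * -(pos i : ℤ) + labelDeg c 1) ?_ ?_ h2 ?_ hle hne ?_ ?_
  · rw [glHeight, LinearMap.add_apply, glVAction_diagonal_labelVec, glXAction_diagonal_labelVec,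
      ← add_smul]
    congr 1
    push_cast
    simp
  · rintro _ (⟨i, j, hij, rfl⟩ | rfl)
    · refine ⟨pos i - pos j, by omega, fun v => ?_⟩
      rw [glHeight_glVAction, sub_eq_add_neg (glVAction n _ _), ← neg_smul]
      congr 2
      push_cast
      ring
    · refine ⟨1, one_pos, fun v => ?_⟩
      rw [glHeight_glXAction, sub_eq_add_neg (glXAction n _ _), ← neg_smul]
      congr 2
      simp
  · intro v w
    rw [glHeight, LinearMap.add_apply, LinearMap.add_apply, map_add, LinearMap.add_apply, map_add,
      form_glVAction h1 h3, form_glXAction h1 h3, Matrix.diagonal_conjTranspose,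
      Matrix.diagonal_conjTranspose]
    congr 4
    · congr 2
      funext i
      simp
    · congr 2
      funext i
      fin_cases i <;> simp
  · intro v hv
    exact N.add_mem (hV _ v hv) (hX _ v hv)
  · rintro _ (⟨i, j, hij, rfl⟩ | rfl)
    · refine ⟨glVAction n (Matrix.single j i 1), fun v w => ?_, hV _, pos i - pos j, by omega,
        fun v => ?_⟩
      · rw [form_glVAction h1 h3, Matrix.conjTranspose_single, star_one]
      · rw [glHeight_glVAction]
        push_cast
        rfl
    · refine ⟨glXAction n (Matrix.single 1 0 1), fun v w => ?_, hX _, 1, one_pos, fun v => ?_⟩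
      · rw [form_glXAction h1 h3, Matrix.conjTranspose_single, star_one]
      · rw [glHeight_glXAction]
        simp

theorem isGlGlIrreducible_glMod (hn : 1 ≤ n) (c : Label n) : IsGlGlIrreducible n (glMod c) := by
  refine ⟨isGlGlInvariant_glMod hn c, fun h => ?_, fun N hle hN => ?_⟩
  · have : labelVec c ∈ glMod c := self_mem_cyc
    rw [h, Submodule.mem_bot] at this
    exact labelVec_ne_zero hn c this
  · by_cases hne : N = ⊥
    · exact Or.inl hne
    -- The two actions of gl(X') differ by scalars, so they have the same invariant subspaces.
    have hX : ∀ A, ∀ v ∈ N, glXAction n A v ∈ N := by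
      intro A v hv
      have h1 := hN.2.2 A v hv
      rw [gl11Action_eq, LinearMap.add_apply, LinearMap.smul_apply] at h1
      exact (Submodule.add_mem_iff_left _ (Submodule.smul_mem _ _ hv)).1 h1
    refine Or.inr (le_antisymm hle (cyc_le (labelVec_mem_of_le_glMod hle hne hN.2.1 hX) ?_))
    rintro _ (⟨i, j, -, rfl⟩ | rfl) v hv
    · exact hN.2.1 _ v hv
    · exact hX _ v hv

end Modules

/-! ### Irreducible modules of `gl(1|1)` -/

section GlModules

theorem homPart_parX_zero {A : Matrix (Fin 2) (Fin 2) ℂ} (hA : A ∈ homPart parX 0) :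
    A 0 1 = 0 ∧ A 1 0 = 0 :=
  ⟨hA 0 1 (by decide), hA 1 0 (by decide)⟩

theorem homPart_parX_one {A : Matrix (Fin 2) (Fin 2) ℂ} (hA : A ∈ homPart parX 1) :
    A 0 0 = 0 ∧ A 1 1 = 0 :=
  ⟨hA 0 0 (by decide), hA 1 1 (by decide)⟩

theorem gl11_bracket_val {a b : ZMod 2} {X Y : gl11.toSubmodule} (hX : X.1 ∈ homPart parX a)
    (hY : Y.1 ∈ homPart parX b) :
    (gl11.bracket X Y).1 = X.1 * Y.1 - sgn (a * b) • (Y.1 * X.1) :=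
  superBracket_of_mem hX hY

theorem sgn_zero_mul (a : ZMod 2) : sgn (0 * a) = 1 := by rw [zero_mul, sgn_zero]

theorem sgn_mul_zero (a : ZMod 2) : sgn (a * 0) = 1 := by rw [mul_zero, sgn_zero]

theorem sgn_one_mul_one : sgn (1 * 1) = -1 := by rw [mul_one, sgn_one]

/-- The one-dimensional module of `gl(1|1)` of weight `(s, -s)`. -/
def gl11One (s : ℂ) : SuperRep gl11 where
  carrier := ℂ
  part a := Module.End.eigenspace (LinearMap.id : Module.End ℂ ℂ) (sgn a)
  isInternal := isInternal_of_involution (P := LinearMap.id) (fun _ => rfl)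
    fun _ _ => Module.End.mem_eigenspace_iff
  ρ :=
    { toFun := fun A => (s * (A.1 0 0 - A.1 1 1)) • LinearMap.id
      map_add' := fun A B => by
        rw [← add_smul]
        congr 1
        simp only [Submodule.coe_add, Matrix.add_apply]
        ring
      map_smul' := fun c A => by
        rw [RingHom.id_apply, smul_smul]
        congr 1
        simp only [Submodule.coe_smul, Matrix.smul_apply, smul_eq_mul]
        ring }
  ρ_mem := by
    intro a b A v hA hv
    rcases zmod2_cases a with rfl | rfl
    · rw [zero_add]
      exact Submodule.smul_mem _ _ hv
    · obtain ⟨h1, h2⟩ := homPart_parX_one hA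
      change (((s * (A.1 0 0 - A.1 1 1)) • LinearMap.id : Module.End ℂ ℂ) v) ∈ _
      rw [h1, h2, sub_self, mul_zero, zero_smul, LinearMap.zero_apply]
      exact Submodule.zero_mem _
  ρ_bracket := by
    intro a b A B hA hB
    simp only [LinearMap.coe_mk, AddHom.coe_mk]
    rw [gl11_bracket_val hA hB]
    refine LinearMap.ext fun v => ?_
    simp only [Matrix.sub_apply, Matrix.smul_apply, Matrix.mul_apply, Fin.sum_univ_two,
      LinearMap.smul_apply, LinearMap.sub_apply, Module.End.mul_apply, LinearMap.id_apply,
      smul_eq_mul]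
    rcases zmod2_cases a with rfl | rfl <;> rcases zmod2_cases b with rfl | rfl
    · obtain ⟨h1, h2⟩ := homPart_parX_zero hA
      obtain ⟨h3, h4⟩ := homPart_parX_zero hB
      rw [h1, h2, h3, h4, sgn_mul_zero]
      ring
    · obtain ⟨h1, h2⟩ := homPart_parX_zero hA
      obtain ⟨h3, h4⟩ := homPart_parX_one hB
      rw [h1, h2, h3, h4, sgn_zero_mul]
      ring
    · obtain ⟨h1, h2⟩ := homPart_parX_one hA
      obtain ⟨h3, h4⟩ := homPart_parX_zero hB
      rw [h1, h2, h3, h4, sgn_mul_zero]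
      ring
    · obtain ⟨h1, h2⟩ := homPart_parX_one hA
      obtain ⟨h3, h4⟩ := homPart_parX_one hB
      rw [h1, h2, h3, h4, sgn_one_mul_one]
      ring

theorem gl11One_irreducible (s : ℂ) : (gl11One s).IsIrreducible := by
  refine ⟨inferInstanceAs (Nontrivial ℂ), fun N _ _ => ?_⟩
  have h : ∀ N : Submodule ℂ ℂ, N = ⊥ ∨ N = ⊤ := eq_bot_or_eq_top
  exact h N

/-- The sign involution of `ℂ^(1|1)`. -/
def signInv : Module.End ℂ (ℂ × ℂ) := LinearMap.prodMap LinearMap.id (-LinearMap.id)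

theorem mem_signInv_zero {x : ℂ × ℂ} : x ∈ signInv.eigenspace (sgn 0) ↔ x.2 = 0 := by
  rw [Module.End.mem_eigenspace_iff, sgn_zero, one_smul, Prod.ext_iff]
  change (x.1 = x.1 ∧ -x.2 = x.2) ↔ _
  rw [neg_eq_iff_add_eq_zero, ← two_mul]
  simp

theorem mem_signInv_one {x : ℂ × ℂ} : x ∈ signInv.eigenspace (sgn 1) ↔ x.1 = 0 := by
  rw [Module.End.mem_eigenspace_iff, sgn_one, neg_one_smul, Prod.ext_iff]
  change (x.1 = -x.1 ∧ -x.2 = -x.2) ↔ _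
  rw [eq_neg_iff_add_eq_zero, ← two_mul]
  simp

/-- The operators of the two-dimensional module of `gl(1|1)` of highest weight `μ`; the second
basis vector is the highest weight vector. -/
def gl11TwoAct (μ : Fin 2 → ℂ) : Matrix (Fin 2) (Fin 2) ℂ →ₗ[ℂ] Module.End ℂ (ℂ × ℂ) where
  toFun A :=
    { toFun := fun x =>
        (((μ 0 - 1) * A 0 0 + (μ 1 + 1) * A 1 1) * x.1 + (μ 0 + μ 1) * A 1 0 * x.2,
          A 0 1 * x.1 + (μ 0 * A 0 0 + μ 1 * A 1 1) * x.2)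
      map_add' := fun x y => by
        ext <;> simp only [Prod.fst_add, Prod.snd_add] <;> ring
      map_smul' := fun c x => by
        ext <;> simp only [Prod.smul_fst, Prod.smul_snd, smul_eq_mul, RingHom.id_apply] <;> ring }
  map_add' A B := by
    refine LinearMap.ext fun x => ?_
    ext <;> simp only [Matrix.add_apply, LinearMap.coe_mk, AddHom.coe_mk,
      LinearMap.add_apply, Prod.mk_add_mk] <;> ring
  map_smul' c A := by
    refine LinearMap.ext fun x => ?_
    ext <;> simp only [Matrix.smul_apply, LinearMap.coe_mk, AddHom.coe_mk,
      LinearMap.smul_apply, Prod.smul_mk, smul_eq_mul, RingHom.id_apply] <;> ring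

theorem gl11TwoAct_apply (μ : Fin 2 → ℂ) (A : Matrix (Fin 2) (Fin 2) ℂ) (x : ℂ × ℂ) :
    gl11TwoAct μ A x =
      (((μ 0 - 1) * A 0 0 + (μ 1 + 1) * A 1 1) * x.1 + (μ 0 + μ 1) * A 1 0 * x.2,
        A 0 1 * x.1 + (μ 0 * A 0 0 + μ 1 * A 1 1) * x.2) := rfl

theorem gl11TwoAct_mem (μ : Fin 2 → ℂ) {a b : ZMod 2} {A : Matrix (Fin 2) (Fin 2) ℂ} {v : ℂ × ℂ}
    (hA : A ∈ homPart parX a) (hv : v ∈ signInv.eigenspace (sgn b)) :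
    gl11TwoAct μ A v ∈ signInv.eigenspace (sgn (a + b)) := by
  rcases zmod2_cases a with rfl | rfl <;> rcases zmod2_cases b with rfl | rfl
  · obtain ⟨h1, h2⟩ := homPart_parX_zero hA
    rw [mem_signInv_zero] at hv
    rw [zero_add, mem_signInv_zero, gl11TwoAct_apply, h1, hv]
    ring
  · obtain ⟨h1, h2⟩ := homPart_parX_zero hA
    rw [mem_signInv_one] at hv
    rw [zero_add, mem_signInv_one, gl11TwoAct_apply, h2, hv]
    ring
  · obtain ⟨h1, h2⟩ := homPart_parX_one hA
    rw [mem_signInv_zero] at hv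
    rw [add_zero, mem_signInv_one, gl11TwoAct_apply, h1, h2, hv]
    ring
  · obtain ⟨h1, h2⟩ := homPart_parX_one hA
    rw [mem_signInv_one] at hv
    rw [CharTwo.add_self_eq_zero, mem_signInv_zero, gl11TwoAct_apply, h1, h2, hv]
    ring

theorem gl11TwoAct_bracket (μ : Fin 2 → ℂ) {a b : ZMod 2} {A B : Matrix (Fin 2) (Fin 2) ℂ}
    (hA : A ∈ homPart parX a) (hB : B ∈ homPart parX b) (v : ℂ × ℂ) :
    gl11TwoAct μ (A * B - sgn (a * b) • (B * A)) v =
      gl11TwoAct μ A (gl11TwoAct μ B v) - sgn (a * b) • gl11TwoAct μ B (gl11TwoAct μ A v) := by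
  simp only [gl11TwoAct_apply, Matrix.sub_apply, Matrix.smul_apply, Matrix.mul_apply,
    Fin.sum_univ_two, smul_eq_mul, Prod.smul_mk, Prod.mk_sub_mk]
  rcases zmod2_cases a with rfl | rfl <;> rcases zmod2_cases b with rfl | rfl
  · obtain ⟨h1, h2⟩ := homPart_parX_zero hA
    obtain ⟨h3, h4⟩ := homPart_parX_zero hB
    rw [h1, h2, h3, h4, sgn_mul_zero]
    ext <;> dsimp only <;> ring
  · obtain ⟨h1, h2⟩ := homPart_parX_zero hA
    obtain ⟨h3, h4⟩ := homPart_parX_one hB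
    rw [h1, h2, h3, h4, sgn_zero_mul]
    ext <;> dsimp only <;> ring
  · obtain ⟨h1, h2⟩ := homPart_parX_one hA
    obtain ⟨h3, h4⟩ := homPart_parX_zero hB
    rw [h1, h2, h3, h4, sgn_mul_zero]
    ext <;> dsimp only <;> ring
  · obtain ⟨h1, h2⟩ := homPart_parX_one hA
    obtain ⟨h3, h4⟩ := homPart_parX_one hB
    rw [h1, h2, h3, h4, sgn_one_mul_one]
    ext <;> dsimp only <;> ring

/-- The two-dimensional module of `gl(1|1)` of highest weight `μ`. -/
def gl11Two (μ : Fin 2 → ℂ) : SuperRep gl11 where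
  carrier := ℂ × ℂ
  part a := signInv.eigenspace (sgn a)
  isInternal := isInternal_of_involution (P := signInv) (fun v => by simp [signInv])
    fun _ _ => Module.End.mem_eigenspace_iff
  ρ := gl11TwoAct μ ∘ₗ Submodule.subtype _
  ρ_mem := fun _ _ _ _ hA hv => gl11TwoAct_mem μ hA hv
  ρ_bracket := by
    intro a b A B hA hB
    refine LinearMap.ext fun v => ?_
    rw [LinearMap.comp_apply, Submodule.subtype_apply, gl11_bracket_val hA hB]
    exact gl11TwoAct_bracket μ hA hB v

theorem gl11Two_apply (μ : Fin 2 → ℂ) (A : gl11.toSubmodule) (x : ℂ × ℂ) :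
    (gl11Two μ).ρ A x =
      (((μ 0 - 1) * A.1 0 0 + (μ 1 + 1) * A.1 1 1) * x.1 + (μ 0 + μ 1) * A.1 1 0 * x.2,
        A.1 0 1 * x.1 + (μ 0 * A.1 0 0 + μ 1 * A.1 1 1) * x.2) := rfl

/-- The raising operator moves the first coordinate to the second, and the lowering operator returns
it with the factor μ_1 + μ_2, here nonzero. So any nonzero vector generates everything. -/
theorem gl11Two_irreducible {μ : Fin 2 → ℂ} (hμ : μ 0 + μ 1 ≠ 0) :
    (gl11Two μ).IsIrreducible := by
  refine ⟨inferInstanceAs (Nontrivial (ℂ × ℂ)), fun N _ hN => ?_⟩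
  let e : gl11.toSubmodule := ⟨Matrix.single 0 1 1, Submodule.mem_top⟩
  let f : gl11.toSubmodule := ⟨Matrix.single 1 0 1, Submodule.mem_top⟩
  have he : ∀ x : ℂ × ℂ, (gl11Two μ).ρ e x = ((0 : ℂ), x.1) := by
    intro x
    rw [gl11Two_apply]
    simp [e]
    rfl
  have hf : ∀ x : ℂ × ℂ, (gl11Two μ).ρ f x = ((μ 0 + μ 1) * x.2, (0 : ℂ)) := by
    intro x
    rw [gl11Two_apply]
    simp [f]
    rfl
  have hsmul : ∀ (c : ℂ) (x : ℂ × ℂ), x ∈ (show Submodule ℂ (ℂ × ℂ) from N) →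
      c • x ∈ (show Submodule ℂ (ℂ × ℂ) from N) := fun c x hx => Submodule.smul_mem _ c hx
  have hadd : ∀ x y : ℂ × ℂ, x ∈ (show Submodule ℂ (ℂ × ℂ) from N) →
      y ∈ (show Submodule ℂ (ℂ × ℂ) from N) → x + y ∈ (show Submodule ℂ (ℂ × ℂ) from N) :=
    fun x y hx hy => Submodule.add_mem _ hx hy
  by_cases hbot : N = ⊥
  · exact Or.inl hbot
  right
  obtain ⟨x, hx, hx0⟩ := Submodule.exists_mem_ne_zero_of_ne_bot hbot
  have hfull : ((0 : ℂ), (1 : ℂ)) ∈ (show Submodule ℂ (ℂ × ℂ) from N) →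
      ∀ y : ℂ × ℂ, y ∈ (show Submodule ℂ (ℂ × ℂ) from N) := by
    intro h1 y
    have h2 := hN f _ h1
    rw [hf] at h2
    have e1 : y = (y.1 / (μ 0 + μ 1)) • ((μ 0 + μ 1) * (1 : ℂ), (0 : ℂ)) +
        y.2 • ((0 : ℂ), (1 : ℂ)) := by
      ext
      · simp [div_mul_cancel₀ _ hμ]
      · simp
    rw [e1]
    exact hadd _ _ (hsmul _ _ h2) (hsmul _ _ h1)
  refine eq_top_iff.2 fun y _ => hfull ?_ y
  obtain ⟨x1, x2⟩ : ℂ × ℂ := x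
  by_cases h1 : x1 = 0
  · have h2 : x2 ≠ 0 := by
      rintro rfl
      exact hx0 (by rw [h1]; rfl)
    have := hsmul x2⁻¹ _ hx
    rw [h1] at this
    simpa [h2] using this
  · have := hsmul x1⁻¹ _ (hN e _ hx)
    rw [he] at this
    simpa [h1] using this

end GlModules

/-! ### The modules of `spo(2n|1)` -/

section SpoModules

variable {n : ℕ}

theorem spo_bracket_val {a b : ZMod 2} {X Y : (spo n).toSubmodule}
    (hX : X.1 ∈ homPart (parV n) a) (hY : Y.1 ∈ homPart (parV n) b) :
    ((spo n).bracket X Y).1 = X.1 * Y.1 - sgn (a * b) • (Y.1 * X.1) :=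
  superBracket_of_mem hX hY

/-- The `spo(2n|1)`-module generated by `labelVec`, as a representation. -/
def spoRep (hn : 1 ≤ n) (c : Label n) : SuperRep (spo n) where
  carrier := spoMod c
  part a := (superSymPart (parE n) a).comap (spoMod c).subtype
  isInternal := isInternal_of_involution
    (P := (parityOp (parE n)).restrict fun _ hv => parityOp_mem_spoMod hn hv)
    (fun v => Subtype.ext (parityOp_parityOp _ _)) fun a v => by
      rw [Submodule.mem_comap, mem_superSymPart_iff, Subtype.ext_iff]
      rfl
  ρ :=
    { toFun := fun X => (glVAction n X.1).restrict fun _ hv => glVAction_mem_spoMod hn X.2 hv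
      map_add' := fun X Y => LinearMap.ext fun v => Subtype.ext
        (LinearMap.congr_fun ((glVLin n).map_add X.1 Y.1) v.1)
      map_smul' := fun c X => LinearMap.ext fun v => Subtype.ext
        (LinearMap.congr_fun ((glVLin n).map_smul c X.1) v.1) }
  ρ_mem := fun _ _ _ _ hX hv => naturalAction_mem (onE_mem hX) hv
  ρ_bracket := by
    intro a b X Y hX hY
    refine LinearMap.ext fun v => Subtype.ext ?_
    change glVAction n ((spo n).bracket X Y).1 v.1 = glVAction n X.1 (glVAction n Y.1 v.1) -
      sgn (a * b) • glVAction n Y.1 (glVAction n X.1 v.1)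
    have h : glVAction n X.1 (glVAction n Y.1 v.1) =
        sgn (a * b) • glVAction n Y.1 (glVAction n X.1 v.1) +
          glVAction n (X.1 * Y.1 - sgn (a * b) • (Y.1 * X.1)) v.1 :=
      LinearMap.congr_fun (glVAction_mul hX hY) v.1
    rw [spo_bracket_val hX hY, h, add_sub_cancel_left]

theorem spoRep_irreducible (hn : 1 ≤ n) (c : Label n) : (spoRep hn c).IsIrreducible := by
  refine ⟨⟨⟨⟨labelVec c, labelVec_mem_spoMod c⟩, 0, fun h =>
    labelVec_ne_zero hn c (congrArg Subtype.val h)⟩⟩, fun N _ hN => ?_⟩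
  have key : ∀ N : Submodule ℂ (spoMod c), (∀ X : (spo n).toSubmodule, ∀ v ∈ N,
      (⟨glVAction n X.1 v.1, glVAction_mem_spoMod hn X.2 v.2⟩ : spoMod c) ∈ N) →
      N = ⊥ ∨ N = ⊤ := by
    intro N hN
    by_cases hne : N = ⊥
    · exact Or.inl hne
    right
    have h1 := spoMod_irreducible hn (c := c) (N := N.map (spoMod c).subtype)
      (Submodule.map_subtype_le _ _) (fun h => hne (Submodule.map_injective_of_injective
        (Submodule.injective_subtype _) (h.trans (Submodule.map_bot _).symm))) (by
        rintro X hX _ ⟨v, hv, rfl⟩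
        exact ⟨_, hN ⟨X, hX⟩ v hv, rfl⟩)
    rw [eq_top_iff]
    intro v _
    have h2 : v.1 ∈ N.map (spoMod c).subtype := by
      rw [h1]
      exact v.2
    obtain ⟨w, hw, e⟩ := h2
    rwa [← Subtype.ext (a1 := w) (a2 := v) e]
  exact key N hN

theorem isPosNilp_apply {X : Matrix (IdxV n) (IdxV n) ℂ} (hX : IsPosNilp n X) {i j : IdxV n}
    (hij : pos j ≤ pos i) : X i j = 0 := by
  obtain ⟨h1, h2, h3, h4⟩ := hX
  rcases i with i | i <;> rcases j with j | j
  · refine h1 i j (not_lt.1 fun h => ?_)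
    exact absurd (pos_inl_lt.2 h) (not_lt.2 hij)
  · refine h3 i (not_lt.1 fun h => ?_)
    exact absurd (pos_inl_lt_inr.2 h) (not_lt.2 hij)
  · refine h2 j (not_le.1 fun h => ?_)
    exact absurd (pos_inr_lt_inl.2 h) (not_lt.2 hij)
  · exact h4

theorem glVAction_of_isPosNilp {X : Matrix (IdxV n) (IdxV n) ℂ} (hX : IsPosNilp n X) {v : SE n}
    (hv : ∀ i j : IdxV n, pos i < pos j → glVAction n (Matrix.single i j 1) v = 0) :
    glVAction n X v = 0 := by
  rw [← glVLin_apply, Matrix.matrix_eq_sum_single X]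
  simp only [map_sum, LinearMap.sum_apply]
  refine Finset.sum_eq_zero fun i _ => Finset.sum_eq_zero fun j _ => ?_
  by_cases hij : pos i < pos j
  · have : Matrix.single i j (X i j) = X i j • Matrix.single i j (1 : ℂ) := by
      rw [Matrix.smul_single, smul_eq_mul, mul_one]
    rw [this, map_smul, LinearMap.smul_apply, glVLin_apply, hv i j hij, smul_zero]
  · rw [isPosNilp_apply hX (not_lt.1 hij), Matrix.single_zero, map_zero, LinearMap.zero_apply]

theorem isDiag_eq {ι : Type} [DecidableEq ι] {X : Matrix ι ι ℂ} (hX : X.IsDiag) :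
    X = Matrix.diagonal fun i => X i i := by
  ext i j
  by_cases hij : i = j
  · rw [hij, Matrix.diagonal_apply_eq]
  · rw [hX hij, Matrix.diagonal_apply_ne _ hij]

theorem isGlVHWV_of {c : Label n} {v : SE n} (hn : 1 ≤ n) (h0 : v ≠ 0)
    (hpar : ∃ a, v ∈ superSymPart (parE n) a)
    (h1 : ∀ i j : IdxV n, pos i < pos j → glVAction n (Matrix.single i j 1) v = 0)
    (h2 : ∀ t, glVAction n (Matrix.diagonal t) v = (∑ i, (labelWeight c i : ℂ) * t i) • v) :
    IsGlVHWV n (glVWeight c) v := by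
  refine ⟨h0, hpar, fun X hX => glVAction_of_isPosNilp hX h1, fun X hX => ?_⟩
  rw [isDiag_eq hX, h2]
  simp only [labelWeight_eq hn, Matrix.diagonal_apply_eq]

/-- Elements of spo(2n|1) have entry 0 at u_{2n+1}, so the last entry 1 of the gl(2n|1)-weight in
the third family is invisible to spo(2n|1). -/
theorem sum_glVWeight_spo (c : Label n) {X : Matrix (IdxV n) (IdxV n) ℂ}
    (hX : X ∈ (spo n).toSubmodule) : ∑ i, glVWeight c i * X i i =
      ∑ i : Fin n, spoWeight c i * X (lowIdx i) (lowIdx i) := by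
  have h0 : X (Sum.inr ()) (Sum.inr ()) = 0 := by
    have h := (mem_spo_iff X).1 hX (Sum.inr ()) (Sum.inr ())
    have hb : bar (Sum.inr () : IdxV n) = Sum.inr () := rfl
    have hp : parV n (Sum.inr ()) = 1 := rfl
    have hs : bsgn (Sum.inr () : IdxV n) = 1 := rfl
    rw [tsgn, hb, hp, hs, mul_one, mul_one, CharTwo.add_self_eq_zero, sgn_zero, one_mul,
      one_mul, eq_neg_iff_add_eq_zero, ← two_mul] at h
    exact (mul_eq_zero.1 h).resolve_left two_ne_zero
  rw [sum_idxV, h0, mul_zero, add_zero]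
  symm
  refine Finset.sum_of_injOn (Fin.castLE (by omega)) ?_ ?_ ?_ ?_
  · exact (Fin.castLE_injective _).injOn
  · intro i _
    exact Finset.mem_coe.2 (Finset.mem_univ _)
  · intro i _ hi
    have hin : n ≤ (i : ℕ) := by
      by_contra h
      refine hi ⟨⟨i, not_le.1 h⟩, Finset.mem_coe.2 (Finset.mem_univ _), ?_⟩
      ext
      rfl
    have hi' : ((i.rev : Fin (2 * n)) : ℕ) < n := by
      rw [Fin.val_rev]
      omega
    have e : (Sum.inl i : IdxV n) = bar (lowIdx ⟨i.rev, hi'⟩) := by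
      simp only [bar, lowIdx, Sum.map_inl, Sum.inl.injEq, Fin.ext_iff, Fin.val_rev,
        Fin.val_castLE]
      omega
    rw [e, glVWeight_bar, zero_mul]
  · intro i _
    rw [spoWeight_eq]
    rfl

theorem isSpoHWV_spoRep (hn : 1 ≤ n) (c : Label n) :
    IsSpoHWV (spoRep hn c) (spoWeight c) (⟨labelVec c, labelVec_mem_spoMod c⟩ : spoMod c) := by
  refine ⟨fun h => labelVec_ne_zero hn c (congrArg Subtype.val h), ⟨_, labelVec_mem hn c⟩,
    fun X hX => Subtype.ext ?_, fun X hX => Subtype.ext ?_⟩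
  · exact glVAction_of_isPosNilp hX fun i j hij => glVAction_single_labelVec c hij
  · change glVAction n X.1 (labelVec c) = _ • labelVec c
    rw [← sum_glVWeight_spo c X.2]
    conv_lhs => rw [isDiag_eq hX]
    rw [glVAction_diagonal_labelVec]
    simp only [labelWeight_eq hn]

end SpoModules

/-! ### The raising operator of `gl(1|1)` -/

section Raising

variable {n : ℕ}

/-- The operator of the strictly upper triangular elementary matrix of `gl(1|1)`. -/
def raiseOp (n : ℕ) : Module.End ℂ (SE n) := glXAction n (Matrix.single 0 1 1)

/-- The operator of the strictly lower triangular elementary matrix of `gl(1|1)`. -/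
def lowerOp (n : ℕ) : Module.End ℂ (SE n) := glXAction n (Matrix.single 1 0 1)

/-- The degree of `labelVec`. -/
def labelSize (c : Label n) : ℕ := labelDeg c 0 + labelDeg c 1

theorem upper_mem_homPart : Matrix.single 0 1 (1 : ℂ) ∈ homPart parX 1 :=
  single_mem_homPart_parX 0 1

theorem lower_mem_homPart : Matrix.single 1 0 (1 : ℂ) ∈ homPart parX 1 :=
  single_mem_homPart_parX 1 0

theorem lowerOp_raiseOp (v : SE n) :
    lowerOp n (raiseOp n v) = -raiseOp n (lowerOp n v) + glXAction n (Matrix.diagonal ![1, 1]) v := by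
  have h := LinearMap.congr_fun (glXAction_mul (n := n) lower_mem_homPart upper_mem_homPart) v
  have e : Matrix.single (1 : Fin 2) (0 : Fin 2) (1 : ℂ) * Matrix.single 0 1 1 -
      sgn (1 * 1) • (Matrix.single (0 : Fin 2) (1 : Fin 2) (1 : ℂ) * Matrix.single 1 0 1) =
      Matrix.diagonal ![1, 1] := by
    rw [sgn_one_mul_one]
    ext i j
    fin_cases i <;> fin_cases j <;> simp
  rw [e, sgn_one_mul_one] at h
  have h' : lowerOp n (raiseOp n v) = (-1 : ℂ) • raiseOp n (lowerOp n v) +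
      glXAction n (Matrix.diagonal ![1, 1]) v := h
  have hneg : (-1 : ℂ) • raiseOp n (lowerOp n v) = -raiseOp n (lowerOp n v) := neg_one_smul (M := SE n) ℂ _
  rw [h', hneg]

theorem raiseOp_raiseOp (v : SE n) : raiseOp n (raiseOp n v) = 0 := by
  have h := LinearMap.congr_fun (glXAction_mul (n := n) upper_mem_homPart upper_mem_homPart) v
  have e : Matrix.single (0 : Fin 2) (1 : Fin 2) (1 : ℂ) * Matrix.single 0 1 1 -
      sgn (1 * 1) • (Matrix.single (0 : Fin 2) (1 : Fin 2) (1 : ℂ) * Matrix.single 0 1 1) = 0 := by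
    rw [sgn_one_mul_one]
    ext i j
    fin_cases i <;> fin_cases j <;> simp
  rw [e, sgn_one_mul_one] at h
  have h0 : glXAction n 0 = 0 := by rw [glXAction, map_zero, map_zero]
  rw [h0, add_zero] at h
  have h' : raiseOp n (raiseOp n v) = (-1 : ℂ) • raiseOp n (raiseOp n v) := h
  have hneg : (-1 : ℂ) • raiseOp n (raiseOp n v) = -raiseOp n (raiseOp n v) := neg_one_smul (M := SE n) ℂ _
  rw [hneg, eq_neg_iff_add_eq_zero, ← two_smul ℂ] at h'
  exact (smul_eq_zero.1 h').resolve_left two_ne_zero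

theorem glXAction_diagonal_raiseOp (t : Fin 2 → ℂ) (v : SE n) :
    glXAction n (Matrix.diagonal t) (raiseOp n v) =
      raiseOp n (glXAction n (Matrix.diagonal t) v) + (t 0 - t 1) • raiseOp n v := by
  have h1 := LinearMap.congr_fun (glXAction_mul (n := n) (diagonal_mem_homPart parX t)
    upper_mem_homPart) v
  have e : Matrix.diagonal t * Matrix.single 0 1 1 -
      sgn (0 * 1) • (Matrix.single 0 1 1 * Matrix.diagonal t) =
      (t 0 - t 1) • Matrix.single (0 : Fin 2) (1 : Fin 2) (1 : ℂ) := by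
    rw [sgn_zero_mul]
    ext i j
    fin_cases i <;> fin_cases j <;> simp
  rw [e, sgn_zero_mul, one_smul] at h1
  have h3 : glXAction n ((t 0 - t 1) • Matrix.single 0 1 1) v = (t 0 - t 1) • raiseOp n v := by
    rw [raiseOp, glXAction, glXAction, map_smul, map_smul]
    rfl
  rw [← h3]
  exact h1

theorem raiseOp_glVAction {X : Matrix (IdxV n) (IdxV n) ℂ} {x : ZMod 2}
    (hX : X ∈ homPart (parV n) x) (v : SE n) :
    raiseOp n (glVAction n X v) = sgn x • glVAction n X (raiseOp n v) := by
  have h := glXAction_glVAction hX upper_mem_homPart v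
  rwa [mul_one] at h

theorem eq_parityComp_add {ι : Type} [Fintype ι] [DecidableEq ι] (p : ι → ZMod 2)
    (X : Matrix ι ι ℂ) : X = parityComp p 0 X + parityComp p 1 X := by
  ext i j
  rcases zmod2_cases (p i + p j) with h | h <;> simp [parityComp, h]

/-- The raising operator is odd and supercommutes with gl(V). Composition with the parity operator
absorbs the sign, so the composite commutes with every X, homogeneous or not. -/
theorem raiseOp_parityOp_glVAction (X : Matrix (IdxV n) (IdxV n) ℂ) (v : SE n) :
    raiseOp n (parityOp (parE n) (glVAction n X v)) =
      glVAction n X (raiseOp n (parityOp (parE n) v)) := by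
  have key : ∀ {x : ZMod 2} {X : Matrix (IdxV n) (IdxV n) ℂ}, X ∈ homPart (parV n) x →
      raiseOp n (parityOp (parE n) (glVAction n X v)) =
        glVAction n X (raiseOp n (parityOp (parE n) v)) := by
    intro x X hX
    rw [parityOp_glVAction hX, map_smul, raiseOp_glVAction hX, smul_smul, sgn_mul_self, one_smul]
  have e : glVAction n X = glVAction n (parityComp (parV n) 0 X) +
      glVAction n (parityComp (parV n) 1 X) := by
    rw [← glVLin_apply, ← glVLin_apply, ← glVLin_apply, ← map_add, ← eq_parityComp_add]
  rw [e, LinearMap.add_apply, LinearMap.add_apply, map_add, map_add,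
    key (parityComp_mem_homPart _ _ _), key (parityComp_mem_homPart _ _ _)]

theorem lowerOp_of_mem_spoMod (hn : 1 ≤ n) {c : Label n} {v : SE n} (hv : v ∈ spoMod c) :
    lowerOp n v = 0 :=
  glXAction_lower_of_mem_spoMod hn hv

theorem lowerOp_raiseOp_of_mem_spoMod (hn : 1 ≤ n) {c : Label n} {v : SE n} (hv : v ∈ spoMod c) :
    lowerOp n (raiseOp n v) = (labelSize c : ℂ) • v := by
  rw [lowerOp_raiseOp, lowerOp_of_mem_spoMod hn hv, map_zero, neg_zero, zero_add,
    glXAction_diagonal_of_mem_spoMod hv, labelSize]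
  simp

theorem glXAction_diagonal_raiseOp_of_mem_spoMod {c : Label n} {v : SE n}
    (hv : v ∈ spoMod c) (t : Fin 2 → ℂ) : glXAction n (Matrix.diagonal t) (raiseOp n v) =
      ((labelDeg c 0 + 1) * t 0 + (labelDeg c 1 - 1) * t 1) • raiseOp n v := by
  rw [glXAction_diagonal_raiseOp, glXAction_diagonal_of_mem_spoMod hv, map_smul, ← add_smul]
  congr 1
  ring

theorem lapOp_raiseOp_of_mem_spoMod (hn : 1 ≤ n) {c : Label n} {v : SE n} (hv : v ∈ spoMod c)
    (a b : Fin 2) : lapOp n a b (raiseOp n v) = 0 := by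
  have h := LinearMap.congr_fun (lapOp_mul_glXAction (n := n) upper_mem_homPart a b) v
  have h0 := lapOp_of_mem_spoMod hn hv
  simp only [Module.End.mul_apply, LinearMap.add_apply, LinearMap.smul_apply, LinearMap.sum_apply,
    h0, smul_zero, map_zero, Finset.sum_const_zero, add_zero] at h
  exact h

theorem glXAction_eq_sum (A : Matrix (Fin 2) (Fin 2) ℂ) (v : SE n) :
    glXAction n A v = glXAction n (Matrix.diagonal ![A 0 0, A 1 1]) v + A 0 1 • raiseOp n v +
      A 1 0 • lowerOp n v := by
  have e : A = Matrix.diagonal ![A 0 0, A 1 1] + A 0 1 • Matrix.single 0 1 1 +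
      A 1 0 • Matrix.single 1 0 1 := by
    ext i j
    fin_cases i <;> fin_cases j <;> simp
  conv_lhs => rw [e]
  rw [glXAction, map_add, map_add, map_smul, map_smul, map_add, map_add, map_smul, map_smul]
  rfl

/-- An operator which separates the constituents. -/
def labelOp (n : ℕ) : Module.End ℂ (SE n) :=
  glXAction n (Matrix.diagonal ![1, 1]) * glXAction n (Matrix.diagonal ![0, 1]) -
    lowerOp n * raiseOp n + Complex.I • glXAction n (Matrix.diagonal ![1, 1])

/-- The eigenvalue of `labelOp` on the constituent with label `c`. -/
def labelEig (c : Label n) : ℂ :=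
  labelSize c * (labelDeg c 1 - 1) + Complex.I * labelSize c

/-- The first two terms of `labelOp` form a Casimir element of gl(1|1), and the degree operator is
central. Hence the eigenvalue is the same here and on the raised vectors. -/
theorem labelOp_of_mem_spoMod (hn : 1 ≤ n) {c : Label n} {v : SE n} (hv : v ∈ spoMod c) :
    labelOp n v = labelEig c • v := by
  rw [labelOp, LinearMap.add_apply, LinearMap.sub_apply, LinearMap.smul_apply,
    Module.End.mul_apply, Module.End.mul_apply, lowerOp_raiseOp_of_mem_spoMod hn hv]
  simp only [glXAction_diagonal_of_mem_spoMod hv, map_smul, smul_smul]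
  rw [← sub_smul, ← add_smul]
  congr 1
  simp only [labelEig, labelSize, Matrix.cons_val_zero, Matrix.cons_val_one]
  push_cast
  ring

theorem labelOp_raiseOp_of_mem_spoMod {c : Label n} {v : SE n}
    (hv : v ∈ spoMod c) : labelOp n (raiseOp n v) = labelEig c • raiseOp n v := by
  rw [labelOp, LinearMap.add_apply, LinearMap.sub_apply, LinearMap.smul_apply,
    Module.End.mul_apply, Module.End.mul_apply, raiseOp_raiseOp, map_zero, sub_zero]
  simp only [glXAction_diagonal_raiseOp_of_mem_spoMod hv, map_smul, smul_smul]
  rw [← add_smul]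
  congr 1
  simp only [labelEig, labelSize, Matrix.cons_val_zero, Matrix.cons_val_one]
  push_cast
  ring

/-! ### Telling the labels apart by their degrees. -/

theorem labelSize_inr (c : (ℕ × Fin n) ⊕ ℕ) : labelSize (Sum.inr c : Label n) ≠ 0 := by
  rcases c with ⟨d, k⟩ | d
  · change d + ((k : ℕ) + 1) ≠ 0
    omega
  · change d + (n + 1) ≠ 0
    omega

/-- The degree in V ⊗ w_1 is 0 for the first family, between 1 and n for the second and n + 1 for
the third. -/
theorem labelDeg_injective {c c' : Label n} (h0 : labelDeg c 0 = labelDeg c' 0)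
    (h1 : labelDeg c 1 = labelDeg c' 1) : c = c' := by
  rcases c with ⟨⟩ | ⟨d, k⟩ | d <;> rcases c' with ⟨⟩ | ⟨d', k'⟩ | d' <;>
    simp only [labelDeg, Matrix.cons_val_zero, Matrix.cons_val_one] at h0 h1
  · rfl
  · omega
  · omega
  · omega
  · have : k = k' := Fin.ext (by omega)
    rw [h0, this]
  · omega
  · omega
  · omega
  · rw [h0]

/-- The imaginary part is the total degree. If it is nonzero, dividing by it recovers the degree in
V ⊗ w_1; if it is 0, both degrees vanish. -/
theorem labelEig_injective : Function.Injective (labelEig (n := n)) := by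
  intro c c' h
  rw [labelEig, labelEig] at h
  have hs : labelSize c = labelSize c' := by
    have := congrArg Complex.im h
    simp at this
    exact this
  by_cases h0 : labelSize c = 0
  · have h0' : labelSize c' = 0 := hs ▸ h0
    rw [labelSize] at h0 h0'
    exact labelDeg_injective (by omega) (by omega)
  · have h1 : labelDeg c 1 = labelDeg c' 1 := by
      rw [← hs] at h
      have h2 := mul_left_cancel₀ (Nat.cast_ne_zero.2 h0) (add_right_cancel h)
      exact_mod_cast sub_left_injective h2
    rw [labelSize, labelSize] at hs
    exact labelDeg_injective (by omega) h1

end Raising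

/-! ### The embeddings of the constituents -/

section Constituents

variable {n : ℕ}

/-- A bilinear map `β : M × W → S(E)` realizes `M ⊗ W` as the constituent with label `c` of the
harmonic tensors. -/
structure IsConstituent (c : Label n) (M : SuperRep (spo n)) (W : SuperRep gl11)
    (β : M →ₗ[ℂ] W →ₗ[ℂ] SE n) : Prop where
  injective : Function.Injective (TensorProduct.lift β)
  harmonic : ∀ v w, β v w ∈ harmonicTensors n
  labelOp_apply : ∀ v w, labelOp n (β v w) = labelEig c • β v w
  even : ∀ a b, ∀ v ∈ M.part a, ∀ w ∈ W.part b, β v w ∈ superSymPart (parE n) (a + b)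
  spo : ∀ (X : (spo n).toSubmodule) v w, spoAction n X.1 (β v w) = β (M.ρ X v) w
  gl : ∀ (a b : ZMod 2) (A : gl11.toSubmodule), A.1 ∈ homPart parX a → ∀ v ∈ M.part b, ∀ w,
    gl11Action n A.1 (β v w) = sgn (a * b) • β v (W.ρ A w)
  mem_glMod : ∀ v w, β v w ∈ glMod c
  highest : ∃ v w, IsSpoHWV M (spoWeight c) v ∧ IsGl11HWV W (glWeight c) w ∧
    IsGlVHWV n (glVWeight c) (β v w)

theorem glWeight_inr (c : (ℕ × Fin n) ⊕ ℕ) : glWeight (Sum.inr c : Label n) =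
    ![(labelDeg (Sum.inr c : Label n) 0 : ℂ) + 1 + alpha n,
      (labelDeg (Sum.inr c : Label n) 1 : ℂ) - 1 - alpha n] := by
  rcases c with ⟨d, k⟩ | d <;> simp [glWeight, labelDeg]

theorem sum_glWeight (c : Label n) : glWeight c 0 + glWeight c 1 = labelSize c := by
  rcases c with c | c
  · simp [glWeight, labelSize, labelDeg]
  · rw [glWeight_inr, labelSize]
    simp only [Matrix.cons_val_zero, Matrix.cons_val_one]
    push_cast
    ring

theorem raiseOp_labelVec_inl (u : Unit) : raiseOp n (labelVec (Sum.inl u)) = 0 :=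
  glXAction_vac _

theorem raiseOp_of_mem_spoMod_inl {u : Unit} {v : SE n} (hv : v ∈ spoMod (Sum.inl u : Label n)) :
    raiseOp n v = 0 :=
  eq_zero_of_mem_spoMod (raiseOp_labelVec_inl u) (fun i j => ⟨_, fun v =>
    raiseOp_glVAction (spoGen_mem_homPart i j) v⟩) hv

/-- The bilinear map `(v, z) ↦ z T(v)`. -/
def oneEmb {M : Submodule ℂ (SE n)} (T : M →ₗ[ℂ] SE n) : M →ₗ[ℂ] ℂ →ₗ[ℂ] SE n :=
  LinearMap.mk₂ ℂ (fun v z => z • T v)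
    (fun v w z => by rw [map_add, smul_add])
    (fun s v z => by rw [map_smul, smul_comm])
    (fun v y z => add_smul y z _)
    (fun s v z => smul_assoc s z _)

/-- The bilinear map `(v, (x, y)) ↦ x T(v) + y E(P(T(v)))`, where `E` is the raising operator of
`gl(1|1)` and `P` the parity operator. -/
def twoEmb {M : Submodule ℂ (SE n)} (T : M →ₗ[ℂ] SE n) : M →ₗ[ℂ] (ℂ × ℂ) →ₗ[ℂ] SE n :=
  LinearMap.mk₂ ℂ (fun v x => x.1 • T v + x.2 • raiseOp n (parityOp (parE n) (T v)))
    (fun v w x => by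
      simp only [map_add, smul_add]
      abel)
    (fun s v x => by
      simp only [map_smul, smul_add, smul_comm s])
    (fun v x y => by
      simp only [Prod.fst_add, Prod.snd_add, add_smul]
      abel)
    (fun s v x => by
      simp only [Prod.smul_fst, Prod.smul_snd, smul_add, smul_assoc])

theorem oneEmb_apply {M : Submodule ℂ (SE n)} (T : M →ₗ[ℂ] SE n) (v : M) (z : ℂ) :
    oneEmb T v z = z • T v := rfl

theorem twoEmb_apply {M : Submodule ℂ (SE n)} (T : M →ₗ[ℂ] SE n) (v : M) (x : ℂ × ℂ) :
    twoEmb T v x = x.1 • T v + x.2 • raiseOp n (parityOp (parE n) (T v)) := rfl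

theorem gl11Action_apply (A : Matrix (Fin 2) (Fin 2) ℂ) (v : SE n) :
    gl11Action n A v = glXAction n A v + (alpha n * (A 0 0 - A 1 1)) • v := by
  rw [gl11Action_eq]
  rfl

theorem gl11Action_of_mem_spoMod (hn : 1 ≤ n) {c : Label n} {v : SE n} (hv : v ∈ spoMod c)
    (A : Matrix (Fin 2) (Fin 2) ℂ) : gl11Action n A v =
      ((labelDeg c 0 + alpha n) * A 0 0 + (labelDeg c 1 - alpha n) * A 1 1) • v +
        A 0 1 • raiseOp n v := by
  rw [gl11Action_apply, glXAction_eq_sum, glXAction_diagonal_of_mem_spoMod hv,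
    lowerOp_of_mem_spoMod hn hv, smul_zero, add_zero, add_right_comm, ← add_smul]
  congr 2
  simp only [Matrix.cons_val_zero, Matrix.cons_val_one]
  ring

theorem gl11Action_raiseOp_of_mem_spoMod (hn : 1 ≤ n) {c : Label n} {v : SE n} (hv : v ∈ spoMod c)
    (A : Matrix (Fin 2) (Fin 2) ℂ) : gl11Action n A (raiseOp n v) =
      ((labelDeg c 0 + 1 + alpha n) * A 0 0 + (labelDeg c 1 - 1 - alpha n) * A 1 1) •
        raiseOp n v + (labelSize c * A 1 0) • v := by
  rw [gl11Action_apply, glXAction_eq_sum, glXAction_diagonal_raiseOp_of_mem_spoMod hv,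
    lowerOp_raiseOp_of_mem_spoMod hn hv, raiseOp_raiseOp, smul_zero, add_zero, add_right_comm,
    ← add_smul, smul_smul, mul_comm (A 1 0)]
  congr 2
  simp only [Matrix.cons_val_zero, Matrix.cons_val_one]
  ring

theorem isGl11HWV_gl11One : IsGl11HWV (gl11One (alpha n)) (glWeight (Sum.inl () : Label n))
    (1 : ℂ) := by
  refine ⟨one_ne_zero (α := ℂ), ⟨0, ?_⟩, fun A hA => ?_, fun A _ => ?_⟩
  · change (1 : ℂ) ∈ Module.End.eigenspace (LinearMap.id : Module.End ℂ ℂ) (sgn 0)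
    rw [Module.End.mem_eigenspace_iff, sgn_zero, one_smul]
    rfl
  · change (alpha n * (A.1 0 0 - A.1 1 1)) • (1 : ℂ) = 0
    rw [hA 0 0 le_rfl, hA 1 1 le_rfl, sub_self, mul_zero, zero_smul]
  · change (alpha n * (A.1 0 0 - A.1 1 1)) • (1 : ℂ) = _ • (1 : ℂ)
    congr 1
    rw [Fin.sum_univ_two]
    simp only [glWeight, Matrix.cons_val_zero, Matrix.cons_val_one]
    ring

theorem isGl11HWV_gl11Two (μ : Fin 2 → ℂ) : IsGl11HWV (gl11Two μ) μ ((0, 1) : ℂ × ℂ) := by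
  refine ⟨fun h => one_ne_zero (congrArg Prod.snd (show ((0, 1) : ℂ × ℂ) = 0 from h)),
    ⟨1, mem_signInv_one.2 rfl⟩, fun A hA => ?_, fun A hA => ?_⟩
  · change gl11TwoAct μ A.1 (0, 1) = 0
    rw [gl11TwoAct_apply, hA 0 0 le_rfl, hA 1 1 le_rfl, hA 1 0 (by decide)]
    simp
  · change gl11TwoAct μ A.1 (0, 1) = _ • ((0, 1) : ℂ × ℂ)
    rw [gl11TwoAct_apply, hA (show (1 : Fin 2) ≠ 0 by decide), Fin.sum_univ_two]
    simp only [mul_zero, add_zero, zero_add, mul_one]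
    exact Prod.ext (mul_zero _).symm (mul_one _).symm

theorem isSpoHWV_spoRep_of_eq (hn : 1 ≤ n) {c c' : Label n} (h : spoWeight c = spoWeight c') :
    IsSpoHWV (spoRep hn c) (spoWeight c') (⟨labelVec c, labelVec_mem_spoMod c⟩ : spoMod c) :=
  h ▸ isSpoHWV_spoRep hn c

theorem isGlVHWV_labelVec (hn : 1 ≤ n) (c : Label n) : IsGlVHWV n (glVWeight c) (labelVec c) :=
  isGlVHWV_of hn (labelVec_ne_zero hn c) ⟨_, labelVec_mem hn c⟩
    (fun _ _ hij => glVAction_single_labelVec c hij) (glVAction_diagonal_labelVec c)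

/-- Raising composed with parity commutes with gl(V), so it keeps the highest weight property and
the weight. The result is nonzero because lowering it gives back a nonzero multiple of the parity
image of `labelVec c`. -/
theorem isGlVHWV_raiseOp_labelVec (hn : 1 ≤ n) {c : Label n} (hc : labelSize c ≠ 0) :
    IsGlVHWV n (glVWeight c) (raiseOp n (parityOp (parE n) (labelVec c))) := by
  have hP := parityOp_mem_spoMod hn (labelVec_mem_spoMod c)
  refine isGlVHWV_of hn (fun h => ?_) ⟨1 + (labelPar c : ZMod 2), ?_⟩ (fun i j hij => ?_)
    fun t => ?_
  · have h1 := lowerOp_raiseOp_of_mem_spoMod hn hP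
    rw [h, map_zero] at h1
    have h2 := (smul_eq_zero.1 h1.symm).resolve_left (Nat.cast_ne_zero.2 hc)
    have h3 := parityOp_parityOp (parE n) (labelVec c)
    rw [h2, map_zero] at h3
    exact labelVec_ne_zero hn c h3.symm
  · rw [parityOp_of_mem _ (labelVec_mem hn c), map_smul]
    exact Submodule.smul_mem _ _ (naturalAction_mem (onE'_mem upper_mem_homPart) (labelVec_mem hn c))
  · rw [← raiseOp_parityOp_glVAction, glVAction_single_labelVec c hij, map_zero, map_zero]
  · rw [← raiseOp_parityOp_glVAction, glVAction_diagonal_labelVec, map_smul, map_smul]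

/-- The properties of a homomorphism from `spoMod c` to `spoMod c'` in `exists_iso_spoMod`. -/
structure IsSpoEmb (hn : 1 ≤ n) (c c' : Label n) (T : spoMod c →ₗ[ℂ] SE n) : Prop where
  highest : T ⟨labelVec c, labelVec_mem_spoMod c⟩ = labelVec c'
  mem : ∀ v, T v ∈ spoMod c'
  injective : Function.Injective T
  spo : ∀ X, ∀ hX : X ∈ (spo n).toSubmodule, ∀ v : spoMod c,
    T ⟨glVAction n X v.1, glVAction_mem_spoMod hn hX v.2⟩ = glVAction n X (T v)
  parity : ∀ v : spoMod c, T ⟨parityOp (parE n) v.1, parityOp_mem_spoMod hn v.2⟩ =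
    parityOp (parE n) (T v)

theorem IsSpoEmb.mem_part {hn : 1 ≤ n} {c c' : Label n} {T : spoMod c →ₗ[ℂ] SE n}
    (hT : IsSpoEmb hn c c' T) {a : ZMod 2} {v : spoMod c} (hv : v.1 ∈ superSymPart (parE n) a) :
    T v ∈ superSymPart (parE n) a := by
  rw [mem_superSymPart_iff, ← hT.parity, ← map_smul]
  congr 1
  exact Subtype.ext (parityOp_of_mem _ hv)

theorem injective_lift_of_smul {U U' : Type} [AddCommGroup U] [Module ℂ U] [AddCommGroup U']
    [Module ℂ U'] {β : U →ₗ[ℂ] ℂ →ₗ[ℂ] U'} {T : U →ₗ[ℂ] U'} (hT : Function.Injective T)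
    (h : ∀ v z, β v z = z • T v) : Function.Injective (TensorProduct.lift β) := by
  have e : ∀ t : U ⊗[ℂ] ℂ, TensorProduct.lift β t = T (TensorProduct.rid ℂ U t) := by
    intro t
    induction t using TensorProduct.induction_on with
    | zero => rw [map_zero, map_zero, map_zero]
    | tmul v z => rw [TensorProduct.lift.tmul, h, TensorProduct.rid_tmul, map_smul]
    | add x y hx hy => rw [map_add, map_add, map_add, hx, hy]
  intro t t' htt
  rw [e, e] at htt
  exact (TensorProduct.rid ℂ U).injective (hT htt)

theorem isConstituent_one {hn : 1 ≤ n} {c : Label n} {T : spoMod c →ₗ[ℂ] SE n}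
    (hT : IsSpoEmb hn c (Sum.inl ()) T) (h : spoWeight c = spoWeight (Sum.inl () : Label n)) :
    IsConstituent (Sum.inl ()) (spoRep hn c) (gl11One (alpha n)) (oneEmb T) where
  injective := injective_lift_of_smul (U := spoMod c) (U' := SE n) hT.injective
    (oneEmb_apply T)
  harmonic := fun v z => Submodule.smul_mem _ (show ℂ from z)
    (mem_harmonicTensors (lapOp_of_mem_spoMod hn (hT.mem v)))
  labelOp_apply := fun v z =>
    labelOp_of_mem_spoMod hn (Submodule.smul_mem _ (show ℂ from z) (hT.mem v))
  even := by
    intro a b v hv z hz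
    have hTv : T v ∈ superSymPart (parE n) a := hT.mem_part hv
    obtain ⟨z, rfl⟩ : ∃ z' : ℂ, z' = z := ⟨z, rfl⟩
    have hz' : z = sgn b * z := Module.End.mem_eigenspace_iff.1
      (show z ∈ Module.End.eigenspace (LinearMap.id : Module.End ℂ ℂ) (sgn b) from hz)
    change z • T v ∈ _
    rcases zmod2_cases b with rfl | rfl
    · rw [add_zero]
      exact Submodule.smul_mem _ _ hTv
    -- The one-dimensional module is purely even, so its odd part is 0.
    · have hz0 : z = 0 := by
        rw [sgn_one] at hz'
        linear_combination (1 / 2 : ℂ) * hz'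
      rw [hz0, zero_smul]
      exact Submodule.zero_mem _
  spo := by
    intro X v z
    rw [spoAction_eq X.2]
    obtain ⟨z, rfl⟩ : ∃ z' : ℂ, z' = z := ⟨z, rfl⟩
    have h1 : T ((spoRep hn c).ρ X v) = glVAction n X.1 (T v) := hT.spo X.1 X.2 v
    change glVAction n X.1 (z • T v) = z • T ((spoRep hn c).ρ X v)
    rw [h1, map_smul]
  gl := by
    intro a b A hA v hv z
    obtain ⟨z, rfl⟩ : ∃ z' : ℂ, z' = z := ⟨z, rfl⟩
    change gl11Action n A.1 (z • T v) =
      sgn (a * b) • ((alpha n * (A.1 0 0 - A.1 1 1)) * z) • T v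
    rw [map_smul, gl11Action_of_mem_spoMod hn (hT.mem v), raiseOp_of_mem_spoMod_inl (hT.mem v),
      smul_zero, add_zero, smul_smul, smul_smul]
    congr 1
    simp only [labelDeg, Matrix.cons_val_zero, Matrix.cons_val_one, Nat.cast_zero]
    rcases zmod2_cases a with rfl | rfl
    · rw [sgn_zero_mul]
      ring
    · obtain ⟨h1, h2⟩ := homPart_parX_one hA
      rw [h1, h2]
      ring
  mem_glMod := fun v z => Submodule.smul_mem _ (show ℂ from z) (spoMod_le_glMod hn _ (hT.mem v))
  highest := by
    refine ⟨_, _, isSpoHWV_spoRep_of_eq hn h, isGl11HWV_gl11One, ?_⟩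
    change IsGlVHWV n _ ((1 : ℂ) • T ⟨labelVec c, labelVec_mem_spoMod c⟩)
    rw [hT.highest, one_smul]
    exact isGlVHWV_labelVec hn _

theorem exists_tensor_prod_eq {U : Type} [AddCommGroup U] [Module ℂ U] (t : U ⊗[ℂ] (ℂ × ℂ)) :
    ∃ v w : U, t = v ⊗ₜ[ℂ] ((1, 0) : ℂ × ℂ) + w ⊗ₜ[ℂ] ((0, 1) : ℂ × ℂ) := by
  induction t using TensorProduct.induction_on with
  | zero => exact ⟨0, 0, by simp⟩
  | tmul v x =>
    refine ⟨x.1 • v, x.2 • v, ?_⟩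
    rw [TensorProduct.smul_tmul, TensorProduct.smul_tmul, ← TensorProduct.tmul_add]
    congr 1
    ext <;> simp
  | add s t hs ht =>
    obtain ⟨v, w, rfl⟩ := hs
    obtain ⟨v', w', rfl⟩ := ht
    refine ⟨v + v', w + w', ?_⟩
    rw [TensorProduct.add_tmul, TensorProduct.add_tmul]
    abel

theorem injective_lift_of_prod {U U' : Type} [AddCommGroup U] [Module ℂ U] [AddCommGroup U']
    [Module ℂ U'] {β : U →ₗ[ℂ] (ℂ × ℂ) →ₗ[ℂ] U'}
    (h : ∀ v w, β v (1, 0) + β w (0, 1) = 0 → v = 0 ∧ w = 0) :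
    Function.Injective (TensorProduct.lift β) := by
  rw [injective_iff_map_eq_zero]
  intro t ht
  obtain ⟨v, w, rfl⟩ := exists_tensor_prod_eq t
  rw [map_add, TensorProduct.lift.tmul, TensorProduct.lift.tmul] at ht
  obtain ⟨rfl, rfl⟩ := h v w ht
  rw [TensorProduct.zero_tmul, TensorProduct.zero_tmul, add_zero]

/-- The lowering operator kills the first term and multiplies the parity image of `T w` by the
nonzero degree, which separates the two components. -/
theorem twoEmb_eq_zero {hn : 1 ≤ n} {c c' : Label n} {T : spoMod c →ₗ[ℂ] SE n}
    (hT : IsSpoEmb hn c c' T) (hc : labelSize c' ≠ 0) {v w : spoMod c}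
    (h : twoEmb T v (1, 0) + twoEmb T w (0, 1) = 0) : v = 0 ∧ w = 0 := by
  rw [twoEmb_apply, twoEmb_apply] at h
  dsimp only at h
  rw [one_smul, zero_smul, zero_smul, one_smul, add_zero, zero_add] at h
  have h1 := congrArg (lowerOp n) h
  rw [map_add, lowerOp_of_mem_spoMod hn (hT.mem v), zero_add, map_zero,
    lowerOp_raiseOp_of_mem_spoMod hn (parityOp_mem_spoMod hn (hT.mem w))] at h1
  have h2 := (smul_eq_zero.1 h1).resolve_left (Nat.cast_ne_zero.2 hc)
  rw [h2, map_zero, add_zero] at h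
  have h3 : T w = 0 := by rw [← parityOp_parityOp (parE n) (T w), h2, map_zero]
  exact ⟨hT.injective (h.trans (map_zero T).symm), hT.injective (h3.trans (map_zero T).symm)⟩

/-- The first coordinate of W carries the lowest weight vectors and the second the raised ones.
Raising shifts the degrees by (1, -1), which together with the shift by α gives the highest weight
of `glWeight_inr`. -/
theorem isConstituent_two {hn : 1 ≤ n} {c : Label n} {c' : (ℕ × Fin n) ⊕ ℕ}
    {T : spoMod c →ₗ[ℂ] SE n} (hT : IsSpoEmb hn c (Sum.inr c') T)
    (h : spoWeight c = spoWeight (Sum.inr c' : Label n)) :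
    IsConstituent (Sum.inr c') (spoRep hn c) (gl11Two (glWeight (Sum.inr c' : Label n)))
      (twoEmb T) where
  injective := injective_lift_of_prod (U := spoMod c) (U' := SE n)
    fun _ _ => twoEmb_eq_zero hT (labelSize_inr c')
  harmonic := fun v x => Submodule.add_mem _ (Submodule.smul_mem _ _
    (mem_harmonicTensors (lapOp_of_mem_spoMod hn (hT.mem v)))) (Submodule.smul_mem _ _
    (mem_harmonicTensors (lapOp_raiseOp_of_mem_spoMod hn (parityOp_mem_spoMod hn (hT.mem v)))))
  labelOp_apply := by
    intro v x
    obtain ⟨x, rfl⟩ : ∃ x' : ℂ × ℂ, x' = x := ⟨x, rfl⟩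
    change labelOp n (x.1 • T v +
      x.2 • raiseOp n (parityOp (parE n) (T v))) =
      labelEig _ • (x.1 • T v +
        x.2 • raiseOp n (parityOp (parE n) (T v)))
    rw [map_add, map_smul, map_smul, labelOp_of_mem_spoMod hn (hT.mem v),
      labelOp_raiseOp_of_mem_spoMod (parityOp_mem_spoMod hn (hT.mem v)), smul_add, smul_comm,
      smul_comm (labelEig _) x.2]
  even := by
    intro a b v hv x hx
    have hTv : T v ∈ superSymPart (parE n) a := hT.mem_part hv
    obtain ⟨x, rfl⟩ : ∃ x' : ℂ × ℂ, x' = x := ⟨x, rfl⟩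
    change x.1 • T v +
      x.2 • raiseOp n (parityOp (parE n) (T v)) ∈ _
    rcases zmod2_cases b with rfl | rfl
    · have hx' : x.2 = 0 := mem_signInv_zero.1 hx
      rw [hx', zero_smul, add_zero, add_zero]
      exact Submodule.smul_mem _ _ hTv
    · have hx' : x.1 = 0 := mem_signInv_one.1 hx
      rw [hx', zero_smul, zero_add, parityOp_of_mem _ hTv, map_smul, add_comm a]
      exact Submodule.smul_mem _ _ (Submodule.smul_mem _ _
        (naturalAction_mem (onE'_mem upper_mem_homPart) hTv))
  spo := by
    intro X v x
    rw [spoAction_eq X.2]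
    obtain ⟨x, rfl⟩ : ∃ x' : ℂ × ℂ, x' = x := ⟨x, rfl⟩
    have h1 : T ((spoRep hn c).ρ X v) = glVAction n X.1 (T v) := hT.spo X.1 X.2 v
    change glVAction n X.1 (x.1 • T v +
      x.2 • raiseOp n (parityOp (parE n) (T v))) =
      x.1 • T ((spoRep hn c).ρ X v) +
        x.2 • raiseOp n (parityOp (parE n) (T ((spoRep hn c).ρ X v)))
    rw [h1, map_add, map_smul, map_smul, raiseOp_parityOp_glVAction]
  gl := by
    intro a b A hA v hv x
    have hTv : parityOp (parE n) (T v) = sgn b • T v := parityOp_of_mem _ (hT.mem_part hv)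
    have hP := hT.mem v
    obtain ⟨x1, x2⟩ : ℂ × ℂ := x
    change gl11Action n A.1 (x1 • T v + x2 • raiseOp n (parityOp (parE n) (T v))) =
      sgn (a * b) • ((gl11TwoAct (glWeight (Sum.inr c' : Label n)) A.1 (x1, x2)).1 • T v +
        (gl11TwoAct (glWeight (Sum.inr c' : Label n)) A.1 (x1, x2)).2 •
          raiseOp n (parityOp (parE n) (T v)))
    generalize T v = u at *
    rw [gl11TwoAct_apply, hTv, glWeight_inr, map_smul (raiseOp n), map_add, map_smul, map_smul,
      map_smul, gl11Action_of_mem_spoMod hn hP, gl11Action_raiseOp_of_mem_spoMod hn hP]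
    simp only [Matrix.cons_val_zero, Matrix.cons_val_one, labelSize]
    push_cast
    rcases zmod2_cases a with rfl | rfl
    · obtain ⟨h1, h2⟩ := homPart_parX_zero hA
      rw [h1, h2, sgn_zero_mul]
      module
    · obtain ⟨h1, h2⟩ := homPart_parX_one hA
      rw [h1, h2, one_mul]
      have hs := sgn_mul_self b
      generalize sgn b = s at *
      match_scalars
      · ring
      -- The sign of the parity operator on `T v` meets the sign of the rule for odd A, and their
      -- product is 1.
      · linear_combination (-(x1 * A.1 0 1)) * hs
  mem_glMod := fun v x => Submodule.add_mem _
    (Submodule.smul_mem _ _ (spoMod_le_glMod hn _ (hT.mem v))) (Submodule.smul_mem _ _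
      (glXAction_mem_glMod hn _ (parityOp_mem_glMod hn (spoMod_le_glMod hn _ (hT.mem v)))))
  highest := by
    refine ⟨_, _, isSpoHWV_spoRep_of_eq hn h, isGl11HWV_gl11Two _, ?_⟩
    change IsGlVHWV n _ ((0 : ℂ) • T ⟨labelVec c, labelVec_mem_spoMod c⟩ +
      (1 : ℂ) • raiseOp n (parityOp (parE n) (T ⟨labelVec c, labelVec_mem_spoMod c⟩)))
    rw [hT.highest, zero_smul, zero_add, one_smul]
    exact isGlVHWV_raiseOp_labelVec hn (labelSize_inr c')

open Classical in
/-- A label with a given weight of `spo(2n|1)`. -/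
def repLabel (lam : Fin n → ℂ) : Label n :=
  -- The choice depends on the weight alone, so labels with equal weights get the same module. The
  -- default serves weights of no label, which never enter.
  if h : ∃ c, spoWeight c = lam then h.choose else Sum.inl ()

theorem spoWeight_repLabel (c : Label n) : spoWeight (repLabel (spoWeight c)) = spoWeight c := by
  have h : ∃ c', spoWeight c' = spoWeight c := ⟨c, rfl⟩
  rw [repLabel, dif_pos h]
  exact h.choose_spec

open Classical in
/-- The irreducible `gl(1|1)`-module of highest weight `μ`, if `μ 0 + μ 1 ≠ 0` or `μ` is of the
form `(s, -s)`. -/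
def glRep (μ : Fin 2 → ℂ) : SuperRep gl11 := if μ 0 + μ 1 = 0 then gl11One (μ 0) else gl11Two μ

theorem glRep_irreducible (μ : Fin 2 → ℂ) : (glRep μ).IsIrreducible := by
  rw [glRep]
  split_ifs with h
  · exact gl11One_irreducible _
  · exact gl11Two_irreducible h

theorem exists_isConstituent (hn : 1 ≤ n) (c : Label n) :
    ∃ β, IsConstituent c (spoRep hn (repLabel (spoWeight c))) (glRep (glWeight c)) β := by
  have h := spoWeight_repLabel c
  obtain ⟨T, h1, h2, h3, h4, h5⟩ := exists_iso_spoMod hn h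
  have hT : IsSpoEmb hn _ c T := ⟨h1, h2, h3, h4, h5⟩
  have hs := sum_glWeight c
  rcases c with ⟨⟩ | c
  · have e : glRep (glWeight (Sum.inl () : Label n)) = gl11One (alpha n) := by
      rw [glRep, if_pos]
      · rfl
      · rw [hs]
        simp [labelSize, labelDeg]
    rw [e]
    exact ⟨_, isConstituent_one hT h⟩
  · have e : glRep (glWeight (Sum.inr c : Label n)) = gl11Two (glWeight (Sum.inr c)) := by
      rw [glRep, if_neg]
      rw [hs]
      exact Nat.cast_ne_zero.2 (labelSize_inr c)
    rw [e]
    exact ⟨_, isConstituent_two hT h⟩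

end Constituents

end SpoHowe

end

theorem mainTheorem6 (n : ℕ) (hn : 1 ≤ n) :
    ∃ (V : (Fin n → ℂ) → SuperRep (spo n)) (W : (Fin 2 → ℂ) → SuperRep gl11)
      (Φ : ConstituentSum V W →ₗ[ℂ] SE n),
      -- `V_λ` and `W_μ` are irreducible
      (∀ c : Label n, (V (spoWeight c)).IsIrreducible ∧ (W (glWeight c)).IsIrreducible) ∧
      -- `Φ` embeds the direct sum of the `V_λ ⊗ W_μ` into the harmonic tensors
      Function.Injective Φ ∧ LinearMap.range Φ ≤ harmonicTensors n ∧
      -- `Φ` is even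
      (∀ (c : Label n) (a b : ZMod 2), ∀ v ∈ (V (spoWeight c)).part a,
        ∀ w ∈ (W (glWeight c)).part b,
          Φ (pureTensor V W c v w) ∈ superSymPart (parE n) (a + b)) ∧
      -- `Φ` commutes with `spo(2n|1)`
      (∀ (c : Label n) (X : (spo n).toSubmodule) (v : V (spoWeight c)) (w : W (glWeight c)),
        spoAction n X.1 (Φ (pureTensor V W c v w)) =
          Φ (pureTensor V W c ((V (spoWeight c)).ρ X v) w)) ∧
      -- `Φ` commutes with `gl(1|1)`
      (∀ (c : Label n) (a b : ZMod 2) (A : gl11.toSubmodule), A.1 ∈ homPart parX a →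
        ∀ v ∈ (V (spoWeight c)).part b, ∀ w : W (glWeight c),
          gl11Action n A.1 (Φ (pureTensor V W c v w)) =
            sgn (a * b) • Φ (pureTensor V W c v ((W (glWeight c)).ρ A w))) ∧
      -- the highest weights are `λ` and `μ`; each constituent lies in an irreducible
      -- `gl(2n|1) + gl(1|1)`-submodule, and its highest weight vector is one for `gl(2n|1)`
      (∀ c : Label n, ∃ (v : V (spoWeight c)) (w : W (glWeight c)) (M : Submodule ℂ (SE n)),
        IsSpoHWV (V (spoWeight c)) (spoWeight c) v ∧
        IsGl11HWV (W (glWeight c)) (glWeight c) w ∧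
        IsGlGlIrreducible n M ∧
        IsGlVHWV n (glVWeight c) (Φ (pureTensor V W c v w)) ∧
        ∀ (v' : V (spoWeight c)) (w' : W (glWeight c)), Φ (pureTensor V W c v' w') ∈ M) := by
  choose β hβ using exists_isConstituent (n := n) hn
  refine ⟨fun lam => spoRep hn (repLabel lam), glRep,
    DirectSum.toModule ℂ (Label n) (SE n) fun c => TensorProduct.lift (β c), ?_⟩
  have hΦ : ∀ c v w, DirectSum.toModule ℂ (Label n) (SE n) (fun c => TensorProduct.lift (β c))
      (pureTensor (fun lam => spoRep hn (repLabel lam)) glRep c v w) = β c v w := by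
    intro c v w
    rw [pureTensor, DirectSum.toModule_lof, TensorProduct.lift.tmul]
  have hlift : ∀ (N : Submodule ℂ (SE n)) c, (∀ v w, β c v w ∈ N) →
      ∀ t, TensorProduct.lift (β c) t ∈ N := by
    intro N c hN t
    induction t using TensorProduct.induction_on with
    | zero =>
      rw [map_zero]
      exact N.zero_mem
    | tmul v w =>
      rw [TensorProduct.lift.tmul]
      exact hN v w
    | add s t hs ht =>
      rw [map_add]
      exact N.add_mem hs ht
  refine ⟨fun c => ⟨spoRep_irreducible hn _, glRep_irreducible _⟩, ?_, ?_, ?_, ?_, ?_, ?_⟩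
  -- Each constituent is an eigenspace vector by vector for `labelOp`, with eigenvalues distinct for
  -- distinct labels, so the sum is direct even where two constituents share the same V_λ.
  · refine injective_toModule_of_eigenvalue (U := SE n) _ (fun c => (hβ c).injective)
      (J := labelOp n) labelEig_injective fun c t => ?_
    rw [← Module.End.mem_eigenspace_iff]
    exact hlift _ c (fun v w => Module.End.mem_eigenspace_iff.2 ((hβ c).labelOp_apply v w)) t
  · rintro _ ⟨x, rfl⟩
    induction x using DirectSum.induction_on with
    | zero =>
      rw [map_zero]
      exact Submodule.zero_mem _
    | of c t =>
      change DirectSum.toModule ℂ (Label n) (SE n) (fun c => TensorProduct.lift (β c))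
        (DirectSum.lof ℂ (Label n) _ c t) ∈ _
      rw [DirectSum.toModule_lof]
      exact hlift _ c (hβ c).harmonic t
    | add x y hx hy =>
      rw [map_add]
      exact Submodule.add_mem _ hx hy
  · intro c a b v hv w hw
    rw [hΦ]
    exact (hβ c).even a b v hv w hw
  · intro c X v w
    rw [hΦ, hΦ]
    exact (hβ c).spo X v w
  · intro c a b A hA v hv w
    rw [hΦ, hΦ]
    exact (hβ c).gl a b A hA v hv w
  · intro c
    obtain ⟨v, w, hv, hw, hf⟩ := (hβ c).highest
    refine ⟨v, w, glMod c, hv, hw, isGlGlIrreducible_glMod hn c, ?_, fun v' w' => ?_⟩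
    · rw [hΦ]
      exact hf
    · rw [hΦ]
      exact (hβ c).mem_glMod v' w'
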